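/- **Setting.** Let $m,m_1,\vartheta_1>0$, $u_1\in\mathbb R^3$, $0<\epsilon<1$, $\alpha=\frac{m_1}{m+m_1}$, $\beta=\frac{1-\epsilon}{2}$, and $$\mathcal M_1(v)=\Big(\frac{m_1}{2\pi\vartheta_1}\Big)^{3/2}e^{-\frac{m_1|v-u_1|^2}{2\vartheta_1}},\qquad \mathcal M(v)=\Big(\frac{m}{2\pi\vartheta^\#}\Big)^{3/2}e^{-\frac{m|v-u_1|^2}{2\vartheta^\#}},\qquad \vartheta^\#=\frac{(1-\alpha)(1-\beta)}{1-\alpha(1-\beta)}\,\vartheta_1 .$$ For $v,w\in\mathbb R^3$, $n\in\mathbb S^2$, $q=v-w$ put $v_\star=v-2\alpha\frac{1-\beta}{1-2\beta}(q\cdot n)n$ and $w_\star=w+2(1-\alpha)\frac{1-\beta}{1-2\beta}(q\cdot n)n$. The linear Boltzmann operator for dissipative hard spheres is $$Q(f)(v)=\epsilon^{-2}\int_{\mathbb R^3\times\mathbb S^2}|q\cdot n|\,f(v_\star)\mathcal M_1(w_\star)\,dw\,dn-\sigma(v)f(v),\qquad \sigma(v)=\int_{\mathbb R^3\times\mathbb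 S^2}|q\cdot n|\,\mathcal M_1(w)\,dw\,dn,$$ and $\nu_0=\inf_{v}\sigma(v)$. Let $\mathcal H=L^2(\mathbb R^3;\mathcal M^{-1}(v)\,dv)$ (complex-valued functions), and let $\mathcal L$ be the realization of $Q$ in $\mathcal H$ with domain $\{f\in\mathcal H:\sigma f\in\mathcal H\}$, with spectrum $\mathfrak S(\mathcal L)$. **Corollary 3.7 (exponential trend to equilibrium).** The set $\mathfrak S(\mathcal L)\setminus\{0\}$ consists of real numbers and has a largest element $\lambda_1$; either $\lambda_1$ is an eigenvalue of $\mathcal L$ or $\lambda_1=-\nu_0$; and $\lambda_1<0$, $0<|\lambda_1|\le\nu_0$. Moreover there is a constant $C\ge 0$, independent of $f_0$ and $t$, such that the following holds. For every $f_0\in\mathcal H$ the space-homogeneous linear Boltzmann equation $$\partial_t f(t)=Q(f(t)),\qquad f(0)=f_0,$$ has a unique solution $f:[0,\infty)\to\mathcal H$ (that is, $f$ is continuous on $[0,\infty)$ with $f(0)=f_0$ and, for every $t>0$, $f(t)$ belongs to the domain of $\mathcal L$ and $f$ is differentiable at $t$ in $\mathcal H$ with derivative $\mathcal Lf(t)$);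 and if $\int_{\mathbb R^3}f_0(v)\,dv=1$, then $$\|f(t)-\mathcal M\|_{\mathcal H}\le C\,e^{-|\lambda_1|t}\,\|f_0-\mathcal M\|_{\mathcal H}\qquad\text{for all }t\ge 0 .$$ -/

import Mathlib

open MeasureTheory Set

noncomputable section

namespace GranularBoltzmann

/-- Velocity space `ℝ³` with its Euclidean structure. -/
abbrev Vel : Type := EuclideanSpace ℝ (Fin 3)

/-- The unit sphere `𝕊²` of velocity space. -/
abbrev Sph : Type := Metric.sphere (0 : Vel) 1

/-- The physical parameters of the model: the mass `m` of the test particles, the mass `m₁`,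
the effective temperature `ϑ₁` and the bulk velocity `u₁` of the host fluid, and the constant
restitution coefficient `ε`. -/
structure Params where
  m : ℝ
  m₁ : ℝ
  ϑ₁ : ℝ
  ε : ℝ
  u₁ : Vel
  m_pos : 0 < m
  m₁_pos : 0 < m₁
  ϑ₁_pos : 0 < ϑ₁
  ε_pos : 0 < ε
  ε_lt_one : ε < 1

namespace Params

variable (P : Params)

/-- The mass ratio `α = m₁ / (m + m₁)`. -/
def α : ℝ := P.m₁ / (P.m + P.m₁)

/-- The inelasticity parameter `β = (1 - ε) / 2`. -/
def β : ℝ := (1 - P.ε) / 2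

/-- The Maxwellian distribution of the host fluid. -/
def maxwellian₁ (v : Vel) : ℝ :=
  (P.m₁ / (2 * Real.pi * P.ϑ₁)) ^ (3 / 2 : ℝ) *
    Real.exp (-(P.m₁ * ‖v - P.u₁‖ ^ 2) / (2 * P.ϑ₁))

/-- The equilibrium temperature `ϑ^#`. -/
def ϑsharp : ℝ := (1 - P.α) * (1 - P.β) / (1 - P.α * (1 - P.β)) * P.ϑ₁

/-- The Maxwellian equilibrium `𝓜`. -/
def maxwellian (v : Vel) : ℝ :=
  (P.m / (2 * Real.pi * P.ϑsharp)) ^ (3 / 2 : ℝ) *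
    Real.exp (-(P.m * ‖v - P.u₁‖ ^ 2) / (2 * P.ϑsharp))

/-- The measure `dw dn` on `ℝ³ × 𝕊²` (Lebesgue measure times surface measure). -/
def collisionMeasure : Measure (Vel × Sph) :=
  (volume : Measure Vel).prod (volume : Measure Vel).toSphere

/-- The pre-collisional velocity `v_⋆`. -/
def preV (v w : Vel) (n : Sph) : Vel :=
  v - (2 * P.α * ((1 - P.β) / (1 - 2 * P.β)) * inner ℝ (v - w) (n : Vel)) • (n : Vel)

/-- The pre-collisional velocity `w_⋆`. -/
def preW (v w : Vel) (n : Sph) : Vel :=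
  w + (2 * (1 - P.α) * ((1 - P.β) / (1 - 2 * P.β)) * inner ℝ (v - w) (n : Vel)) • (n : Vel)

/-- The collision frequency `σ(v) = ∫ |q · n| 𝓜₁(w) dw dn`, where `q = v - w`. -/
def collisionFrequency (v : Vel) : ℝ :=
  ∫ p : Vel × Sph, |inner ℝ (v - p.1) (p.2 : Vel)| * P.maxwellian₁ p.1 ∂collisionMeasure

/-- The gain operator `Q⁺(f)(v) = ε⁻² ∫ |q · n| f(v_⋆) 𝓜₁(w_⋆) dw dn`. -/
def gain (f : Vel → ℂ) (v : Vel) : ℂ :=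
  ((P.ε ^ 2)⁻¹ : ℝ) *
    ∫ p : Vel × Sph,
      ((|inner ℝ (v - p.1) (p.2 : Vel)| * P.maxwellian₁ (P.preW v p.1 p.2) : ℝ) : ℂ) *
        f (P.preV v p.1 p.2) ∂collisionMeasure

/-- The collision operator `Q(f) = Q⁺(f) - σ f`. -/
def collision (f : Vel → ℂ) (v : Vel) : ℂ :=
  P.gain f v - (P.collisionFrequency v : ℂ) * f v

/-- `ν₀ = inf σ`. -/
def ν₀ : ℝ := ⨅ v : Vel, P.collisionFrequency v

/-- The measure `𝓜⁻¹(v) dv`. -/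
def weight : Measure Vel :=
  (volume : Measure Vel).withDensity fun v => ENNReal.ofReal (P.maxwellian v)⁻¹

/-- The Hilbert space `𝓗 = L²(ℝ³; 𝓜⁻¹(v) dv)` (of complex-valued functions). -/
abbrev Hsp : Type := Lp ℂ 2 P.weight

lemma α_pos : 0 < P.α := div_pos P.m₁_pos (add_pos P.m_pos P.m₁_pos)

lemma α_lt_one : P.α < 1 := by
  rw [α, div_lt_one (add_pos P.m_pos P.m₁_pos)]
  linarith [P.m_pos]

lemma ϑsharp_pos : 0 < P.ϑsharp := by
  have h1 := P.α_pos
  have h2 := P.α_lt_one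
  have hb : 0 < 1 - P.β := by unfold β; linarith [P.ε_pos]
  have hb' : 1 - P.β < 1 := by unfold β; linarith [P.ε_lt_one]
  have h3 : P.α * (1 - P.β) < 1 := by nlinarith
  exact mul_pos (div_pos (mul_pos (by linarith) hb) (by linarith)) P.ϑ₁_pos

lemma maxwellian_pos (v : Vel) : 0 < P.maxwellian v := by
  have := P.ϑsharp_pos
  have := P.m_pos
  unfold maxwellian
  positivity

lemma continuous_maxwellian : Continuous P.maxwellian := by
  unfold maxwellian
  fun_prop

lemma integrable_maxwellian : Integrable P.maxwellian := by
  have hb : 0 < P.m / (2 * P.ϑsharp) := div_pos P.m_pos (by linarith [P.ϑsharp_pos])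
  have h0 : Integrable (fun v : Vel => Real.exp (-(P.m / (2 * P.ϑsharp)) * ‖v‖ ^ 2)) := by
    have h := (GaussianFourier.integrable_cexp_neg_mul_sq_norm_add (V := Vel)
      (b := ((P.m / (2 * P.ϑsharp) : ℝ) : ℂ)) (by rwa [Complex.ofReal_re]) 0 0).norm
    refine h.congr (Filter.Eventually.of_forall fun v => ?_)
    simp only [Complex.norm_exp]
    congr 1
    simp [← Complex.ofReal_pow, ← Complex.ofReal_mul, -Complex.ofReal_div]
  have h1 := (h0.comp_sub_right P.u₁).const_mul ((P.m / (2 * Real.pi * P.ϑsharp)) ^ (3 / 2 : ℝ))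
  refine h1.congr (Filter.Eventually.of_forall fun v => ?_)
  simp only [maxwellian]
  congr 2
  ring

lemma memLp_maxwellian : MemLp (fun v => (P.maxwellian v : ℂ)) 2 P.weight := by
  have hc := P.continuous_maxwellian
  have hm : AEStronglyMeasurable (fun v => (P.maxwellian v : ℂ)) P.weight :=
    (Complex.continuous_ofReal.comp hc).measurable.aestronglyMeasurable
  rw [memLp_two_iff_integrable_sq_norm hm, weight,
    integrable_withDensity_iff (by fun_prop) (by simp)]
  refine P.integrable_maxwellian.congr (Filter.Eventually.of_forall fun v => ?_)
  have hv := P.maxwellian_pos v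
  simp only [Complex.norm_real, Real.norm_eq_abs, sq_abs]
  rw [ENNReal.toReal_ofReal (by positivity)]
  field_simp

/-- The equilibrium `𝓜` as an element of `𝓗`. -/
def equilibrium : P.Hsp := P.memLp_maxwellian.toLp _

/-- The graph of the realization `𝓛` of `Q` in `𝓗`: `P.Graph f g` says that `f` is in the domain
`{f ∈ 𝓗 ; σ f ∈ 𝓗}` of `𝓛` and that `g = 𝓛 f`, i.e. `g(v) = Q(f)(v)` for almost every `v`. -/
def Graph (f g : P.Hsp) : Prop :=
  MemLp (fun v => (P.collisionFrequency v : ℂ) * f v) 2 P.weight ∧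
    (g : Vel → ℂ) =ᵐ[volume] P.collision f

/-- The resolvent set of `𝓛`: those `z` for which `z - 𝓛`, from the domain of `𝓛` to `𝓗`, has a
bounded everywhere defined two-sided inverse `R`. -/
def resolventSet : Set ℂ :=
  {z | ∃ R : P.Hsp →L[ℂ] P.Hsp, ∀ f h : P.Hsp, R h = f ↔ ∃ g, P.Graph f g ∧ z • f - g = h}

/-- The spectrum of `𝓛` in `𝓗`. -/
def spectrum : Set ℂ := P.resolventSetᶜ

/-- `z` is an eigenvalue of `𝓛`. -/
def IsEigenvalue (z : ℂ) : Prop := ∃ f : P.Hsp, f ≠ 0 ∧ P.Graph f (z • f)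

/-- `f : [0, ∞) → 𝓗` solves `∂ₜ f = Q(f)`, `f(0) = f₀`: it is continuous on `[0, ∞)`, takes the value
`f₀` at `0`, and for every `t > 0` it is in the domain of `𝓛` and differentiable in `𝓗` with
derivative `𝓛 f(t)`. The values of `f` at negative times play no role. -/
structure IsSolution (f₀ : P.Hsp) (f : ℝ → P.Hsp) : Prop where
  initial : f 0 = f₀
  continuousOn : ContinuousOn f (Ici 0)
  hasDerivAt : ∀ t : ℝ, 0 < t → ∃ g, P.Graph (f t) g ∧ HasDerivAt f g t

end Params

end GranularBoltzmann

end

/-!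
# Spectral gap and exponential relaxation for the linear Boltzmann operator

The operator `𝓛` is unbounded, but everything that has to be known about it can be read off from its
resolvent `A = (1 - 𝓛)⁻¹`, a bounded self-adjoint operator: `𝓛 f = g` means `A (f - g) = f`, the
point `x` of the spectrum of `A` corresponds to the point `1 - x⁻¹` of the spectrum of `𝓛`, and the
semigroup `exp (t 𝓛)` is the function `x ↦ exp (t (1 - x⁻¹))` of `A`. The two results on the abstract
level are `GapData.exists_gap` and `GapData.exists_evolution`. They use the operator obtained from `A`
by subtracting the orthogonal projection onto the equilibrium: it has the spectrum of `A` with the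
point `1` removed, and the norm of its functions gives the rate of decay without a constant.

What makes this possible is detailed balance. The change of variables `lintegral_collision`, in
which the velocity `v_⋆` replaces the field velocity and the direction of impact, turns the gain
operator into an integral operator. Its kernel `J` with respect to `𝓜⁻¹(v) dv` is symmetric
(`Params.kernel_comm`, `Params.gain_eq`) exactly because the temperature `ϑ^#` of the equilibrium
satisfies `η = 2 d κ` (`Params.η_eq`). As the gain balances the loss for `f = 𝓜`, the quadratic form
of `-𝓛` is `∬ J 𝓜 𝓜' |f / 𝓜 - f' / 𝓜'|² / 2` (`BalanceKernel.energy_identity`): it is nonnegative,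
and it vanishes on the multiples of `𝓜` only.

Let `S` be the multiplication by `σ^(-1/2)` and `K` the gain operator. The operator `S K S` is
compact, since `J` is square integrable over sets on which the collision frequency `σ` is bounded,
and `σ` is large elsewhere. Hence `A = S (1 + S² - S K S)⁻¹ S` exists, and it differs from the
resolvent `(1 + σ)⁻¹` of the multiplication by `-σ` by a compact operator
(`BalanceKernel.exists_gapData`). By the Fredholm alternative the spectrum of `A` above
`(1 + ν₀)⁻¹` consists of eigenvalues, and it cannot accumulate at the simple eigenvalue `1`. The
point `(1 + ν₀)⁻¹` itself is in the spectrum, because `σ` is close to `ν₀` on an infinite-dimensional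
space of functions.
-/

namespace GranularBoltzmann

/-! ### Spectral gap of a self-adjoint resolvent -/

section Abstract

variable {H : Type*} [NormedAddCommGroup H] [InnerProductSpace ℂ H] [CompleteSpace H]

/-- The Fredholm alternative for compact perturbations of an invertible operator. -/
lemma isUnit_sub_of_isCompactOperator {D C : H →L[ℂ] H} (hD : IsUnit D)
    (hC : IsCompactOperator C) (hinj : ∀ f, (D - C) f = 0 → f = 0) : IsUnit (D - C) := by
  obtain ⟨u, rfl⟩ := hD
  have hfac : (u : H →L[ℂ] H) - C = u * (1 - (↑u⁻¹ : H →L[ℂ] H) * C) := by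
    rw [mul_sub, mul_one, ← mul_assoc, u.mul_inv, one_mul]
  have hT : IsCompactOperator ((↑u⁻¹ : H →L[ℂ] H) * C) := hC.clm_comp _
  rw [hfac]
  refine u.isUnit.mul ?_
  rcases hT.hasEigenvalue_or_mem_resolventSet (one_ne_zero (α := ℂ)) with h | h
  · obtain ⟨f, hf, hf0⟩ := h.exists_hasEigenvector
    refine absurd (hinj f ?_) hf0
    have h1 : ((↑u⁻¹ : H →L[ℂ] H) * C) f = f := by
      simpa using Module.End.mem_eigenspace_iff.1 hf
    rw [hfac, mul_apply_eq_comp, sub_apply, h1]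
    simp
  · simpa [spectrum.mem_resolventSet_iff] using h

lemma isUnit_of_re_inner_ge {D : H →L[ℂ] H} {δ : ℝ} (hδ : 0 < δ)
    (h : ∀ f, δ * ‖f‖ ^ 2 ≤ (inner ℂ (D f) f).re) : IsUnit D := by
  refine D.isUnit_of_forall_le_norm_inner_map (c := ⟨δ, hδ.le⟩) hδ fun f => ?_
  calc ‖f‖ ^ 2 * δ = δ * ‖f‖ ^ 2 := mul_comm _ _
    _ ≤ _ := h f
    _ ≤ _ := Complex.re_le_norm _

/-- The bounded operator obtained from `A` by removing the contribution of the unit vector `e`. -/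
noncomputable def deflate (A : H →L[ℂ] H) (e : H) : H →L[ℂ] H :=
  A - InnerProductSpace.rankOne ℂ e e

omit [CompleteSpace H] in
lemma deflate_apply (A : H →L[ℂ] H) (e f : H) :
    deflate A e f = A f - inner ℂ e f • e := rfl

/-- The properties of the resolvent `A = (1 - 𝓛)⁻¹` at the point `1` from which spectrum and
semigroup of `𝓛` are determined: `A` is an injective self-adjoint contraction, it fixes exactly the
multiples of the unit vector `e`, and up to a compact perturbation it is bounded above by
`xe < 1`, a point of its spectrum. -/
structure GapData (A A₀ : H →L[ℂ] H) (e : H) (xe : ℝ) : Prop where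
  selfAdjoint : IsSelfAdjoint A
  injective : ∀ f, A f = 0 → f = 0
  sq_norm_le : ∀ f, ‖A f‖ ^ 2 ≤ (inner ℂ (A f) f).re
  norm_e : ‖e‖ = 1
  map_e : A e = e
  fixed : ∀ f, A f = f → ∃ c : ℂ, f = c • e
  compact : IsCompactOperator (A - A₀)
  le_xe : ∀ f, (inner ℂ (A₀ f) f).re ≤ xe * ‖f‖ ^ 2
  xe_pos : 0 < xe
  xe_lt_one : xe < 1
  xe_mem : (xe : ℂ) ∈ spectrum ℂ A

namespace GapData

variable {A A₀ : H →L[ℂ] H} {e : H} {xe : ℝ} (G : GapData A A₀ e xe)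
include G

lemma isPositive : A.IsPositive := by
  rw [ContinuousLinearMap.isPositive_def']
  exact ⟨G.selfAdjoint, fun f => (sq_nonneg _).trans (G.sq_norm_le f)⟩

lemma norm_le_one : ‖A‖ ≤ 1 := by
  refine A.opNorm_le_bound zero_le_one fun f => ?_
  rw [one_mul]
  have h1 := (G.sq_norm_le f).trans ((Complex.re_le_norm _).trans (norm_inner_le_norm _ _))
  by_cases h0 : ‖A f‖ = 0
  · rw [h0]; positivity
  · have : 0 < ‖A f‖ := lt_of_le_of_ne (norm_nonneg _) (Ne.symm h0)
    nlinarith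

lemma isSelfAdjoint_deflate : IsSelfAdjoint (deflate A e) :=
  G.selfAdjoint.sub (InnerProductSpace.isStarProjection_rankOne_self G.norm_e).isSelfAdjoint

lemma inner_e_map (f : H) : inner ℂ e (A f) = inner ℂ e f := by
  have := (ContinuousLinearMap.isSelfAdjoint_iff_isSymmetric.1 G.selfAdjoint) e f
  simpa [G.map_e] using this.symm

lemma inner_e_e : inner ℂ e e = 1 := by
  simp [inner_self_eq_norm_sq_to_K, G.norm_e]

lemma inner_e_deflate (f : H) : inner ℂ e (deflate A e f) = 0 := by
  rw [deflate_apply, inner_sub_right, inner_smul_right, G.inner_e_e, G.inner_e_map, mul_one,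
    sub_self]

lemma mem_spectrum_real {z : ℂ} (hz : z ∈ spectrum ℂ A) :
    ∃ x : ℝ, z = x ∧ 0 ≤ x ∧ x ≤ 1 := by
  have h1 := G.selfAdjoint.mem_spectrum_eq_re hz
  refine ⟨z.re, h1, ?_, ?_⟩
  · have h2 := (ContinuousLinearMap.nonneg_iff_isPositive A).2 G.isPositive
    exact spectrum_nonneg_of_nonneg h2 ((spectrum.algebraMap_mem_iff ℂ).1 (by rwa [h1] at hz))
  · refine (Complex.re_le_norm z).trans ((spectrum.norm_le_norm_mul_of_mem hz).trans ?_)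
    exact mul_le_one₀ G.norm_le_one (norm_nonneg _) ContinuousLinearMap.norm_id_le

/-- Away from `0` and `1` the deflated operator has the spectrum of `A`. -/
lemma mem_spectrum_deflate_iff {z : ℂ} (h0 : z ≠ 0) (h1 : z ≠ 1) :
    z ∈ spectrum ℂ (deflate A e) ↔ z ∈ spectrum ℂ A := by
  set p : H →L[ℂ] H := InnerProductSpace.rankOne ℂ e e with hp
  have hpp : p * p = p := InnerProductSpace.isIdempotentElem_rankOne_self G.norm_e
  have hap : A * p = p := by
    ext f
    simp [hp, G.map_e]
  have hz1 : z - 1 ≠ 0 := sub_ne_zero.2 h1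
  -- `z - A = (z - deflate A e) (1 - z⁻¹ p)`, and the second factor is invertible for `z ≠ 1`
  have hu : IsUnit (1 - z⁻¹ • p) := by
    refine ⟨⟨1 - z⁻¹ • p, 1 + (z - 1)⁻¹ • p, ?_, ?_⟩, rfl⟩
    · simp only [sub_mul, mul_add, one_mul, mul_one, smul_mul_assoc, mul_smul_comm, hpp]
      have : (z - 1)⁻¹ - z⁻¹ - (z - 1)⁻¹ * z⁻¹ = 0 := by field_simp; ring
      linear_combination (norm := module) this • p
    · simp only [add_mul, mul_sub, one_mul, mul_one, smul_mul_assoc, mul_smul_comm, hpp]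
      have : (z - 1)⁻¹ - z⁻¹ - (z - 1)⁻¹ * z⁻¹ = 0 := by field_simp; ring
      linear_combination (norm := module) this • p
  have hfac : algebraMap ℂ (H →L[ℂ] H) z - A
      = (algebraMap ℂ (H →L[ℂ] H) z - deflate A e) * (1 - z⁻¹ • p) := by
    have : deflate A e = A - p := rfl
    rw [this]
    simp only [sub_mul, mul_sub, mul_one, mul_smul_comm, hpp, hap, Algebra.algebraMap_eq_smul_one,
      smul_mul_assoc, one_mul]
    have : z⁻¹ * z = 1 := inv_mul_cancel₀ h0
    linear_combination (norm := module) this • p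
  rw [spectrum.mem_iff, spectrum.mem_iff, not_iff_not, hfac]
  constructor
  · exact fun h => h.mul hu
  · intro h
    obtain ⟨u, hu'⟩ := hu
    have := h.mul (u⁻¹).isUnit
    rwa [← hu', mul_assoc, u.mul_inv, mul_one] at this

/-- Above `xe` the spectrum consists of eigenvalues, by the Fredholm alternative. -/
lemma eigenvalue_of_mem_spectrum {A' : H →L[ℂ] H} (hA' : IsCompactOperator (A' - A₀)) {x : ℝ}
    (hx : xe < x) (hmem : (x : ℂ) ∈ spectrum ℂ A') : ∃ f, f ≠ 0 ∧ A' f = (x : ℂ) • f := by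
  by_contra! hcon
  refine hmem ?_
  have hD : IsUnit (algebraMap ℂ (H →L[ℂ] H) x - A₀) := by
    refine isUnit_of_re_inner_ge (sub_pos.2 hx) fun f => ?_
    have := G.le_xe f
    have h2 : (inner ℂ ((algebraMap ℂ (H →L[ℂ] H) x - A₀) f) f).re
        = x * ‖f‖ ^ 2 - (inner ℂ (A₀ f) f).re := by
      simp [Algebra.algebraMap_eq_smul_one,
        inner_self_eq_norm_sq_to_K, ← Complex.ofReal_pow]
    rw [h2]
    linarith
  have := isUnit_sub_of_isCompactOperator hD hA' fun f hf => ?_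
  · rwa [sub_sub_sub_cancel_right] at this
  · rw [sub_sub_sub_cancel_right] at hf
    by_contra h0
    refine hcon f h0 ?_
    rw [sub_apply, sub_eq_zero] at hf
    simpa [Algebra.algebraMap_eq_smul_one] using hf.symm

/-- If `1` were in the spectrum of the deflated operator, it would be an eigenvalue, and the
eigenvector would be fixed by `A` and orthogonal to `e`. -/
lemma one_notMem_spectrum_deflate : (1 : ℂ) ∉ spectrum ℂ (deflate A e) := by
  intro h
  have hc : IsCompactOperator (deflate A e - A₀) := by
    have h1 : IsCompactOperator (InnerProductSpace.rankOne ℂ e e : H →L[ℂ] H) := by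
      have : IsCompactOperator (innerSL ℂ e) :=
        isCompactOperator_of_locallyCompactSpace_dom (innerSL ℂ e)
      exact this.clm_comp (ContinuousLinearMap.toSpanSingleton ℂ e)
    have h2 := G.compact.sub h1
    have h3 : (⇑(deflate A e - A₀) : H → H)
        = ⇑(A - A₀) - ⇑(InnerProductSpace.rankOne ℂ e e : H →L[ℂ] H) := by
      ext f
      simp only [sub_apply, deflate_apply, Pi.sub_apply, InnerProductSpace.rankOne_apply]
      abel
    rw [h3]
    exact h2
  obtain ⟨f, hf0, hf⟩ := G.eigenvalue_of_mem_spectrum hc (x := 1) G.xe_lt_one (by simpa using h)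
  rw [Complex.ofReal_one, one_smul] at hf
  have h1 : inner ℂ e f = 0 := by rw [← hf]; exact G.inner_e_deflate f
  rw [deflate_apply, h1, zero_smul, sub_zero] at hf
  obtain ⟨c, hc⟩ := G.fixed f hf
  rw [hc, inner_smul_right, G.inner_e_e, mul_one] at h1
  exact hf0 (by rw [hc, h1, zero_smul])

/-- The largest point of the spectrum of `A` below `1`: it is the largest point of the spectrum of
the deflated operator, in which `1` has been moved to `0`. -/
theorem exists_gap : ∃ x₁ : ℝ, xe ≤ x₁ ∧ x₁ < 1 ∧ (x₁ : ℂ) ∈ spectrum ℂ A ∧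
    (∀ z ∈ spectrum ℂ A, z ≠ 1 → ∃ x : ℝ, z = x ∧ 0 ≤ x ∧ x ≤ x₁) ∧
    (x₁ = xe ∨ ∃ f, f ≠ 0 ∧ A f = (x₁ : ℂ) • f) ∧
    ∀ x ∈ spectrum ℝ (deflate A e), 0 ≤ x ∧ x ≤ x₁ := by
  have hxe1 : (xe : ℂ) ≠ 1 := by exact_mod_cast G.xe_lt_one.ne
  have hxe0 : (xe : ℂ) ≠ 0 := by exact_mod_cast G.xe_pos.ne'
  have hmemR : ∀ x : ℝ, x ∈ spectrum ℝ (deflate A e) ↔ (x : ℂ) ∈ spectrum ℂ (deflate A e) :=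
    fun x => (spectrum.algebraMap_mem_iff ℂ).symm
  have hxe : xe ∈ spectrum ℝ (deflate A e) :=
    (hmemR _).2 ((G.mem_spectrum_deflate_iff hxe0 hxe1).2 G.xe_mem)
  have hcpt : IsCompact (spectrum ℝ (deflate A e)) := spectrum.isCompact _
  obtain ⟨x₁, hx₁, hmax⟩ := hcpt.exists_isGreatest ⟨xe, hxe⟩
  have hle : xe ≤ x₁ := hmax hxe
  have hx0 : 0 < x₁ := G.xe_pos.trans_le hle
  have hne1 : ∀ x ∈ spectrum ℝ (deflate A e), (x : ℂ) ≠ 1 := by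
    intro x hx h
    exact G.one_notMem_spectrum_deflate (h ▸ (hmemR x).1 hx)
  have hmem : (x₁ : ℂ) ∈ spectrum ℂ A :=
    (G.mem_spectrum_deflate_iff (by exact_mod_cast hx0.ne') (hne1 _ hx₁)).1 ((hmemR _).1 hx₁)
  refine ⟨x₁, hle, ?_, hmem, ?_, ?_, ?_⟩
  · obtain ⟨x, hx, -, hx1⟩ := G.mem_spectrum_real hmem
    have hxx : x₁ = x := by exact_mod_cast hx
    refine lt_of_le_of_ne (hxx ▸ hx1) fun h => hne1 _ hx₁ (by exact_mod_cast h)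
  · intro z hz hz1
    obtain ⟨x, rfl, hx0', hx1⟩ := G.mem_spectrum_real hz
    refine ⟨x, rfl, hx0', ?_⟩
    rcases hx0'.eq_or_lt with h | h
    · exact h ▸ hx0.le
    · exact hmax ((hmemR _).2 ((G.mem_spectrum_deflate_iff (by exact_mod_cast h.ne') hz1).2 hz))
  · rcases hle.eq_or_lt with h | h
    · exact Or.inl h.symm
    · exact Or.inr (G.eigenvalue_of_mem_spectrum G.compact h hmem)
  · intro x hx
    refine ⟨?_, hmax hx⟩
    by_cases h : (x : ℂ) = 0
    · exact (Complex.ofReal_eq_zero.1 h).ge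
    · obtain ⟨x', hx', h0, -⟩ :=
        G.mem_spectrum_real ((G.mem_spectrum_deflate_iff h (hne1 _ hx)).1 ((hmemR _).1 hx))
      have : x = x' := by exact_mod_cast hx'
      exact this ▸ h0

end GapData

end Abstract

/-! ### The semigroup as a function of the resolvent -/

section Semigroup

open Filter Topology Asymptotics

lemma abs_exp_sub_one_sub_id_le_sq_mul_exp (z : ℝ) :
    |Real.exp z - 1 - z| ≤ z ^ 2 * Real.exp |z| := by
  have h := Complex.norm_exp_sub_sum_le_norm_mul_exp (z : ℂ) 2
  simp only [Finset.sum_range_succ, Finset.sum_range_zero, pow_zero, Nat.factorial, pow_one,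
    zero_add, Nat.cast_one, div_one, Complex.norm_real, Real.norm_eq_abs, sq_abs, mul_one] at h
  have h2 : Complex.exp z - (1 + z) = ((Real.exp z - 1 - z : ℝ) : ℂ) := by push_cast; ring
  rwa [h2, Complex.norm_real, Real.norm_eq_abs] at h

/-- A Taylor estimate for `exp (t y)` in `t`, uniform in `y ≤ 0`: the growth of the second
derivative in `y` is absorbed by the decay of the exponential. -/
lemma abs_exp_taylor_le {t r y : ℝ} (ht : 0 < t) (hr : |r| ≤ t / 2) (hy : y ≤ 0) :
    |Real.exp ((t + r) * y) - Real.exp (t * y) - r * (y * Real.exp (t * y))|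
      ≤ 8 / t ^ 2 * r ^ 2 := by
  have h1 : Real.exp ((t + r) * y) - Real.exp (t * y) - r * (y * Real.exp (t * y))
      = Real.exp (t * y) * (Real.exp (r * y) - 1 - r * y) := by
    rw [add_mul, Real.exp_add]; ring
  have h2 := abs_exp_sub_one_sub_id_le_sq_mul_exp (r * y)
  have h3 : |r * y| ≤ t / 2 * -y := by
    rw [abs_mul, abs_of_nonpos hy]
    exact mul_le_mul_of_nonneg_right hr (by linarith)
  have h4 := Real.quadratic_le_exp_of_nonneg (x := t / 2 * -y) (by nlinarith)
  have h5 : (t / 2 * -y) ^ 2 / 2 ≤ Real.exp (t / 2 * -y) := by nlinarith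
  have h6 : Real.exp (t * y) * Real.exp (t / 2 * -y) = (Real.exp (t / 2 * -y))⁻¹ := by
    rw [← Real.exp_add, ← Real.exp_neg]; congr 1; ring
  have hE : 0 < Real.exp (t / 2 * -y) := Real.exp_pos _
  rw [h1, abs_mul, abs_of_pos (Real.exp_pos _)]
  calc Real.exp (t * y) * |Real.exp (r * y) - 1 - r * y|
      ≤ Real.exp (t * y) * ((r * y) ^ 2 * Real.exp (t / 2 * -y)) := by
        refine mul_le_mul_of_nonneg_left (h2.trans ?_) (Real.exp_pos _).le
        exact mul_le_mul_of_nonneg_left (Real.exp_le_exp.2 h3) (sq_nonneg _)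
    _ = r ^ 2 * y ^ 2 * (Real.exp (t / 2 * -y))⁻¹ := by rw [← h6]; ring
    _ ≤ 8 / t ^ 2 * r ^ 2 := by
        rw [← div_eq_mul_inv, div_le_iff₀ hE]
        calc r ^ 2 * y ^ 2 = 8 / t ^ 2 * r ^ 2 * ((t / 2 * -y) ^ 2 / 2) := by
              field_simp; ring
          _ ≤ _ := mul_le_mul_of_nonneg_left h5 (by positivity)

/-- The continuous function equal to `x⁻ᵏ exp (t (1 - x⁻¹))` for `x > 0` and to `0` for `x ≤ 0`
(when `t > 0`). For `k = 0` it takes the resolvent `(1 - 𝓛)⁻¹` to the semigroup `exp (t 𝓛)`. -/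
noncomputable def semigroupFun (k : ℕ) (t x : ℝ) : ℝ :=
  x⁻¹ ^ k * (Real.exp t * expNegInvGlue (x / t))

lemma continuous_semigroupFun (k : ℕ) {t : ℝ} (ht : 0 < t) : Continuous (semigroupFun k t) := by
  have h := (expNegInvGlue.continuous_polynomial_eval_inv_mul (Polynomial.X ^ k)).comp
    (continuous_id.div_const t)
  have h2 := h.const_mul (Real.exp t * t⁻¹ ^ k)
  convert h2 using 1
  ext x
  simp only [semigroupFun, Function.comp, Polynomial.eval_pow, Polynomial.eval_X, id, inv_div,
    div_pow, inv_pow]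
  field_simp

lemma semigroupFun_of_nonpos (k : ℕ) {t x : ℝ} (ht : 0 < t) (hx : x ≤ 0) :
    semigroupFun k t x = 0 := by
  rw [semigroupFun, expNegInvGlue.zero_of_nonpos (div_nonpos_of_nonpos_of_nonneg hx ht.le)]
  simp

lemma semigroupFun_of_pos (k : ℕ) {t x : ℝ} (ht : 0 < t) (hx : 0 < x) :
    semigroupFun k t x = x⁻¹ ^ k * Real.exp (t * (1 - x⁻¹)) := by
  rw [semigroupFun, expNegInvGlue, if_neg (div_pos hx ht).not_ge, ← Real.exp_add]
  congr 2
  field_simp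
  ring

lemma mul_semigroupFun_succ (k : ℕ) {t : ℝ} (ht : 0 < t) (x : ℝ) :
    x * semigroupFun (k + 1) t x = semigroupFun k t x := by
  rcases le_or_gt x 0 with h | h
  · rw [semigroupFun_of_nonpos _ ht h, semigroupFun_of_nonpos _ ht h, mul_zero]
  · rw [semigroupFun, semigroupFun, pow_succ]
    field_simp

variable {H : Type*} [NormedAddCommGroup H] [InnerProductSpace ℂ H] [CompleteSpace H]

/-- The operator `(1 - 𝓛)ᵏ exp (t 𝓛)` for `t > 0`, as a function of `B = (1 - 𝓛)⁻¹` in the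
continuous functional calculus. -/
noncomputable def semigroupOp (B : H →L[ℂ] H) (k : ℕ) (t : ℝ) : H →L[ℂ] H :=
  cfc (semigroupFun k t) B

variable {B : H →L[ℂ] H} {x₁ : ℝ}

lemma mul_semigroupOp_succ (hB : IsSelfAdjoint B) (k : ℕ) {t : ℝ} (ht : 0 < t) :
    B * semigroupOp B (k + 1) t = semigroupOp B k t := by
  have hc := (continuous_semigroupFun (k + 1) ht).continuousOn (s := spectrum ℝ B)
  have hid : cfc (fun x : ℝ => x) B = B := cfc_id' ℝ B
  calc B * semigroupOp B (k + 1) t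
      = cfc (fun x : ℝ => x) B * cfc (semigroupFun (k + 1) t) B := by rw [hid]; rfl
    _ = cfc (fun x : ℝ => x * semigroupFun (k + 1) t x) B :=
        (cfc_mul (fun x : ℝ => x) (semigroupFun (k + 1) t) B continuousOn_id hc).symm
    _ = semigroupOp B k t := by
        rw [semigroupOp]
        exact cfc_congr fun x _ => mul_semigroupFun_succ k ht x

lemma norm_semigroupOp_zero_le (hσ : ∀ x ∈ spectrum ℝ B, 0 ≤ x ∧ x ≤ x₁) {t : ℝ} (ht : 0 < t) :
    ‖semigroupOp B 0 t‖ ≤ Real.exp (t * (1 - x₁⁻¹)) := by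
  refine norm_cfc_le (Real.exp_pos _).le fun x hx => ?_
  obtain ⟨h0, h1⟩ := hσ x hx
  rcases h0.eq_or_lt with h | h
  · rw [semigroupFun_of_nonpos _ ht h.symm.le, norm_zero]
    exact (Real.exp_pos _).le
  · rw [semigroupFun_of_pos _ ht h, pow_zero, one_mul, Real.norm_eq_abs, Real.abs_exp,
      Real.exp_le_exp]
    have := inv_anti₀ h h1
    nlinarith

lemma norm_semigroupOp_zero_mul_sub_le (hB : IsSelfAdjoint B)
    (hσ : ∀ x ∈ spectrum ℝ B, 0 ≤ x ∧ x ≤ 1) {t : ℝ} (ht : 0 < t) :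
    ‖semigroupOp B 0 t * B - B‖ ≤ t := by
  have hc := (continuous_semigroupFun 0 ht).continuousOn (s := spectrum ℝ B)
  have hid : cfc (fun x : ℝ => x) B = B := cfc_id' ℝ B
  have h : semigroupOp B 0 t * B - B = cfc (fun x : ℝ => semigroupFun 0 t x * x - x) B := by
    rw [cfc_sub (fun x : ℝ => semigroupFun 0 t x * x) (fun x : ℝ => x) B
      (hc.mul continuousOn_id) continuousOn_id,
      cfc_mul (semigroupFun 0 t) (fun x : ℝ => x) B hc continuousOn_id, hid]
    rfl
  rw [h]
  refine norm_cfc_le ht.le fun x hx => ?_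
  obtain ⟨h0, h1⟩ := hσ x hx
  rcases h0.eq_or_lt with h | h
  · rw [← h, mul_zero, sub_zero, norm_zero]
    exact ht.le
  · have hy : 1 - x⁻¹ ≤ 0 := by linarith [(one_le_inv₀ h).2 h1]
    have hle : Real.exp (t * (1 - x⁻¹)) ≤ 1 := Real.exp_le_one_iff.2 (by nlinarith)
    have hge := Real.add_one_le_exp (t * (1 - x⁻¹))
    rw [semigroupFun_of_pos _ ht h, pow_zero, one_mul, Real.norm_eq_abs, abs_le]
    have hx' : x * x⁻¹ = 1 := mul_inv_cancel₀ h.ne'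
    have h3 : (t * (1 - x⁻¹) + 1) * x ≤ Real.exp (t * (1 - x⁻¹)) * x :=
      mul_le_mul_of_nonneg_right hge h.le
    have h4 : (t * (1 - x⁻¹) + 1) * x = t * x - t * (x * x⁻¹) + x := by ring
    rw [h4, hx'] at h3
    constructor
    · nlinarith
    · nlinarith

/-- The derivative is `𝓛 exp (t 𝓛)`, written as `exp (t 𝓛) - (1 - 𝓛) exp (t 𝓛)`. -/
lemma hasDerivAt_semigroupOp (hσ : ∀ x ∈ spectrum ℝ B, 0 ≤ x ∧ x ≤ 1) {t : ℝ} (ht : 0 < t) :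
    HasDerivAt (semigroupOp B 0) (semigroupOp B 0 t - semigroupOp B 1 t) t := by
  rw [hasDerivAt_iff_isLittleO]
  refine IsBigO.trans_isLittleO (IsBigO.of_bound (8 / t ^ 2) ?_)
    (isLittleO_pow_sub_sub t one_lt_two)
  filter_upwards [Metric.closedBall_mem_nhds t (half_pos ht)] with s hs
  rw [Metric.mem_closedBall, Real.dist_eq] at hs
  have hs0 : 0 < s := by linarith [(abs_le.1 hs).1]
  have hc := fun k => (continuous_semigroupFun k ht).continuousOn (s := spectrum ℝ B)
  have hcs := (continuous_semigroupFun 0 hs0).continuousOn (s := spectrum ℝ B)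
  have h : semigroupOp B 0 s - semigroupOp B 0 t
      - (s - t) • (semigroupOp B 0 t - semigroupOp B 1 t)
      = cfc (fun x : ℝ => semigroupFun 0 s x - semigroupFun 0 t x
        - (s - t) • (semigroupFun 0 t x - semigroupFun 1 t x)) B := by
    rw [cfc_sub (fun x : ℝ => semigroupFun 0 s x - semigroupFun 0 t x)
        (fun x : ℝ => (s - t) • (semigroupFun 0 t x - semigroupFun 1 t x)) B
        (hcs.sub (hc 0)) (((hc 0).sub (hc 1)).const_smul (s - t)),
      cfc_sub (semigroupFun 0 s) (semigroupFun 0 t) B hcs (hc 0),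
      cfc_smul (s - t) (fun x : ℝ => semigroupFun 0 t x - semigroupFun 1 t x) B
        ((hc 0).sub (hc 1)),
      cfc_sub (semigroupFun 0 t) (semigroupFun 1 t) B (hc 0) (hc 1)]
    rfl
  rw [h]
  have hR : ‖‖s - t‖ ^ 2‖ = (s - t) ^ 2 := by
    rw [norm_pow, norm_norm, Real.norm_eq_abs, sq_abs]
  rw [hR]
  refine norm_cfc_le (by positivity) fun x hx => ?_
  obtain ⟨h0, h1⟩ := hσ x hx
  rcases h0.eq_or_lt with h | h
  · simp only [semigroupFun_of_nonpos _ hs0 h.symm.le, semigroupFun_of_nonpos _ ht h.symm.le]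
    simp
    positivity
  · have hy : 1 - x⁻¹ ≤ 0 := by linarith [(one_le_inv₀ h).2 h1]
    have := abs_exp_taylor_le ht hs hy
    simp only [semigroupFun_of_pos _ hs0 h, semigroupFun_of_pos _ ht h, pow_zero, one_mul, pow_one,
      smul_eq_mul, Real.norm_eq_abs]
    convert this using 2
    rw [show t + (s - t) = s by ring]
    ring

/-- Strong continuity of the semigroup at `0`, on the closure of the range of `B`. -/
lemma tendsto_semigroupOp_apply (hB : IsSelfAdjoint B)
    (hσ : ∀ x ∈ spectrum ℝ B, 0 ≤ x ∧ x ≤ 1) {f : H} (hf : f ∈ closure (range B)) :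
    Tendsto (fun t => semigroupOp B 0 t f) (𝓝[>] 0) (𝓝 f) := by
  rw [Metric.tendsto_nhds]
  intro ε hε
  obtain ⟨_, ⟨p, rfl⟩, hp⟩ := Metric.mem_closure_iff.1 hf (ε / 3) (by positivity)
  rw [dist_eq_norm] at hp
  have hδ : 0 < ε / (3 * (‖p‖ + 1)) := by positivity
  filter_upwards [Ioo_mem_nhdsGT hδ] with t ht
  have hn : ‖semigroupOp B 0 t‖ ≤ 1 := by
    simpa using norm_semigroupOp_zero_le hσ ht.1
  have h1 : ‖semigroupOp B 0 t (f - B p)‖ ≤ ‖f - B p‖ :=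
    (ContinuousLinearMap.le_of_opNorm_le _ hn _).trans (by rw [one_mul])
  have h2 : ‖semigroupOp B 0 t (B p) - B p‖ ≤ t * ‖p‖ :=
    ContinuousLinearMap.le_of_opNorm_le _ (norm_semigroupOp_zero_mul_sub_le hB hσ ht.1) p
  have h3 : t * ‖p‖ ≤ ε / 3 := by
    have h4 := mul_le_mul ht.2.le (by linarith : ‖p‖ ≤ ‖p‖ + 1) (norm_nonneg _) hδ.le
    refine h4.trans (le_of_eq ?_)
    field_simp
  have hsplit : semigroupOp B 0 t f - f
      = semigroupOp B 0 t (f - B p) + (semigroupOp B 0 t (B p) - B p) - (f - B p) := by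
    rw [map_sub]; abel
  rw [dist_eq_norm, hsplit]
  calc _ ≤ ‖semigroupOp B 0 t (f - B p)‖ + ‖semigroupOp B 0 t (B p) - B p‖ + ‖f - B p‖ :=
        (norm_sub_le _ _).trans (add_le_add_left (norm_add_le _ _) _)
    _ < ε := by linarith

end Semigroup

/-! ### The evolution equation -/

section Evolution

open Filter Topology

variable {H : Type*} [NormedAddCommGroup H] [InnerProductSpace ℂ H] [CompleteSpace H]

/-- A solution of `∂ₜ f = 𝓛 f`, where the generator `𝓛` is given by its resolvent
`A = (1 - 𝓛)⁻¹`: the relation `A (f - g) = f` says that `f` is in the domain and `𝓛 f = g`. -/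
structure IsEvolution (A : H →L[ℂ] H) (f₀ : H) (f : ℝ → H) : Prop where
  initial : f 0 = f₀
  continuousOn : ContinuousOn f (Ici 0)
  hasDerivAt : ∀ t : ℝ, 0 < t → ∃ g, A (f t - g) = f t ∧ HasDerivAt f g t

namespace GapData

variable {A A₀ : H →L[ℂ] H} {e : H} {xe : ℝ} (G : GapData A A₀ e xe)
include G

/-- The generator is dissipative. -/
lemma re_inner_nonpos {f g : H} (h : A (f - g) = f) : (inner ℂ f g).re ≤ 0 := by
  have h1 := G.sq_norm_le (f - g)
  rw [h, inner_sub_right, Complex.sub_re, inner_self_eq_norm_sq_to_K] at h1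
  have : ((‖f‖ : ℂ) ^ 2).re = ‖f‖ ^ 2 := by rw [← Complex.ofReal_pow, Complex.ofReal_re]
  erw [this] at h1
  linarith

/-- Uniqueness: by dissipativity the norm of the difference of two solutions decreases. -/
theorem evolution_unique {f₀ : H} {f g : ℝ → H} (hf : IsEvolution A f₀ f)
    (hg : IsEvolution A f₀ g) : EqOn g f (Ici 0) := by
  let _ : InnerProductSpace ℝ H := InnerProductSpace.rclikeToReal ℂ H
  have hcont : ContinuousOn (fun t => ‖g t - f t‖ ^ 2) (Ici 0) :=
    (hg.continuousOn.sub hf.continuousOn).norm.pow 2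
  have hderiv : ∀ t ∈ interior (Ici (0 : ℝ)), ∃ d ≤ 0,
      HasDerivAt (fun t => ‖g t - f t‖ ^ 2) d t := by
    intro t ht
    rw [interior_Ici] at ht
    obtain ⟨f', hf1, hf2⟩ := hf.hasDerivAt t ht
    obtain ⟨g', hg1, hg2⟩ := hg.hasDerivAt t ht
    refine ⟨_, ?_, (hg2.sub hf2).norm_sq⟩
    have h := G.re_inner_nonpos (f := g t - f t) (g := g' - f') (by
      rw [sub_sub_sub_comm, map_sub, hg1, hf1])
    have h2 : inner ℝ (g t - f t) (g' - f') = (inner ℂ (g t - f t) (g' - f')).re := rfl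
    simp only [Pi.sub_apply]
    rw [h2]
    linarith
  have hanti : AntitoneOn (fun t => ‖g t - f t‖ ^ 2) (Ici 0) := by
    refine antitoneOn_of_deriv_nonpos (convex_Ici 0) hcont (fun t ht => ?_) fun t ht => ?_
    · obtain ⟨d, -, hd⟩ := hderiv t ht
      exact hd.differentiableAt.differentiableWithinAt
    · obtain ⟨d, hd0, hd⟩ := hderiv t ht
      rwa [hd.deriv]
  intro t ht
  have h := hanti (self_mem_Ici (a := (0 : ℝ))) ht ht
  simp only [hf.initial, hg.initial, sub_self, norm_zero] at h
  have : ‖g t - f t‖ ^ 2 = 0 := le_antisymm (by simpa using h) (sq_nonneg _)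
  exact sub_eq_zero.1 (norm_eq_zero.1 (pow_eq_zero_iff (two_ne_zero)|>.1 this))

/-- The kernel of the deflated resolvent is spanned by `e`, so that its range is dense in the
orthogonal complement of `e`. -/
lemma mem_closure_range_deflate {h : H} (hh : inner ℂ e h = 0) :
    h ∈ closure (range (deflate A e)) := by
  have hcl : closure (range (deflate A e))
      = ((LinearMap.range (deflate A e).toLinearMap).topologicalClosure : Set H) := by
    rw [Submodule.topologicalClosure_coe]
    rfl
  rw [hcl, SetLike.mem_coe, ← Submodule.orthogonal_orthogonal_eq_closure,
    Submodule.mem_orthogonal]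
  intro w hw
  have hBw : deflate A e w = 0 := by
    rw [← inner_self_eq_zero (𝕜 := ℂ)]
    have h1 := (ContinuousLinearMap.isSelfAdjoint_iff_isSymmetric.1 G.isSelfAdjoint_deflate)
      (deflate A e w) w
    exact (h1.symm.trans ((Submodule.mem_orthogonal _ _).1 hw _ ⟨deflate A e w, rfl⟩))
  have hw2 : w = inner ℂ e w • e := by
    refine sub_eq_zero.1 (G.injective _ ?_)
    rw [map_sub, map_smul, G.map_e]
    exact hBw
  rw [hw2, inner_smul_left, hh, mul_zero]

/-- The solution of the evolution equation: the component along the equilibrium `e` is constant,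
and the component orthogonal to `e` evolves under the semigroup generated from the deflated
resolvent, whose spectrum lies in `[0, x₁]`; this gives the rate of decay. -/
theorem exists_evolution {x₁ : ℝ} (hx₁ : x₁ < 1)
    (hσ : ∀ x ∈ spectrum ℝ (deflate A e), 0 ≤ x ∧ x ≤ x₁) (f₀ : H) :
    ∃ f : ℝ → H, IsEvolution A f₀ f ∧ (inner ℂ e f₀ = 1 → ∀ t, 0 ≤ t →
      ‖f t - e‖ ≤ Real.exp (t * (1 - x₁⁻¹)) * ‖f₀ - e‖) := by
  set B := deflate A e with hBdef
  have hB : IsSelfAdjoint B := G.isSelfAdjoint_deflate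
  have hσ1 : ∀ x ∈ spectrum ℝ B, 0 ≤ x ∧ x ≤ 1 :=
    fun x hx => ⟨(hσ x hx).1, (hσ x hx).2.trans hx₁.le⟩
  set c : ℂ := inner ℂ e f₀
  set h : H := f₀ - c • e with hh
  have hperp : inner ℂ e h = 0 := by
    rw [hh, inner_sub_right, inner_smul_right, G.inner_e_e, mul_one, sub_self]
  set f : ℝ → H := fun t => if t ≤ 0 then f₀ else c • e + semigroupOp B 0 t h with hf
  have hfpos : ∀ t, 0 < t → f t = c • e + semigroupOp B 0 t h := fun t ht => by
    simp only [hf, if_neg ht.not_ge]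
  have hf0 : f 0 = f₀ := by simp [hf]
  have hderiv : ∀ t, 0 < t →
      HasDerivAt f (semigroupOp B 0 t h - semigroupOp B 1 t h) t := by
    intro t ht
    have h1 := ((ContinuousLinearMap.apply ℂ H h).restrictScalars ℝ).hasFDerivAt.comp_hasDerivAt t
      (hasDerivAt_semigroupOp hσ1 ht)
    have h2 : HasDerivAt (fun s => c • e + semigroupOp B 0 s h)
        (semigroupOp B 0 t h - semigroupOp B 1 t h) t := h1.const_add (c • e)
    refine h2.congr_of_eventuallyEq ?_
    filter_upwards [lt_mem_nhds ht] with s hs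
    rw [hfpos s hs]
  refine ⟨f, ⟨hf0, ?_, ?_⟩, ?_⟩
  · intro t ht
    rcases (mem_Ici.1 ht).eq_or_lt with rfl | ht'
    · rw [ContinuousWithinAt, ← Ioi_insert, nhdsWithin_insert, hf0, tendsto_sup]
      refine ⟨by rw [← hf0]; exact tendsto_pure_nhds f 0, ?_⟩
      have h1 := (tendsto_semigroupOp_apply hB hσ1
        (G.mem_closure_range_deflate hperp)).const_add (c • e)
      rw [hh, add_sub_cancel] at h1
      refine h1.congr' ?_
      filter_upwards [self_mem_nhdsWithin] with s hs
      rw [hfpos s hs]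
    · exact (hderiv t ht').continuousAt.continuousWithinAt
  · intro t ht
    refine ⟨_, ?_, hderiv t ht⟩
    have h1 : ∀ k, B (semigroupOp B (k + 1) t h) = semigroupOp B k t h := fun k => by
      rw [← mul_semigroupOp_succ hB k ht]; rfl
    have h2 : A (semigroupOp B 1 t h) = semigroupOp B 0 t h := by
      have h3 : inner ℂ e (semigroupOp B 1 t h) = 0 := by
        rw [← h1 1]; exact G.inner_e_deflate _
      rw [← h1 0, hBdef, deflate_apply, h3, zero_smul, sub_zero]
    rw [hfpos t ht]
    have h4 : c • e + semigroupOp B 0 t h - (semigroupOp B 0 t h - semigroupOp B 1 t h)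
        = c • e + semigroupOp B 1 t h := by abel
    rw [h4, map_add, map_smul, G.map_e, h2]
  · intro hc t ht
    rcases ht.eq_or_lt with rfl | ht'
    · rw [hf0]; simp
    · have hh' : f₀ - e = h := by rw [hh, hc, one_smul]
      rw [hfpos t ht', hc, one_smul, add_sub_cancel_left, hh']
      exact ContinuousLinearMap.le_of_opNorm_le _ (norm_semigroupOp_zero_le hσ ht') h

end GapData

end Evolution

/-! ### Hilbert-Schmidt operators on `L²` -/

section HilbertSchmidt

open Filter Topology

/-- An operator whose values on a Hilbert basis are square summable is compact: it is the limit in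
norm of its finite sections. -/
lemma isCompactOperator_of_summable_sq {H ι : Type*} [NormedAddCommGroup H]
    [InnerProductSpace ℂ H] [CompleteSpace H] (b : HilbertBasis ι ℂ H) (T : H →L[ℂ] H)
    (hs : Summable fun i => ‖T (b i)‖ ^ 2) : IsCompactOperator T := by
  classical
  set F : Finset ι → (H →L[ℂ] H) := fun s =>
    ∑ i ∈ s, InnerProductSpace.rankOne ℂ (T (b i)) (b i) with hF
  have hFapply : ∀ s f, F s f = ∑ i ∈ s, inner ℂ (b i) f • T (b i) := fun s f => by
    simp [hF]
  have hcomp : ∀ s, IsCompactOperator (F s) := by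
    intro s
    refine Submodule.sum_mem (compactOperator (RingHom.id ℂ) H H) fun i _ => ?_
    have h1 : IsCompactOperator (innerSL ℂ (b i)) :=
      isCompactOperator_of_locallyCompactSpace_dom (innerSL ℂ (b i))
    exact h1.clm_comp (ContinuousLinearMap.toSpanSingleton ℂ (T (b i)))
  refine isCompactOperator_of_tendsto (l := atTop) (F := F) ?_ (Eventually.of_forall hcomp)
  rw [Metric.tendsto_nhds]
  intro ε hε
  obtain ⟨s₀, hs₀⟩ := summable_iff_vanishing_norm.1 hs ((ε / 2) ^ 2) (by positivity)
  filter_upwards [eventually_ge_atTop s₀] with s hss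
  rw [dist_comm, dist_eq_norm]
  refine lt_of_le_of_lt (ContinuousLinearMap.opNorm_le_bound _ (half_pos hε).le fun f => ?_)
    (half_lt_self hε)
  have hlim : Tendsto (fun t : Finset ι => F t f - F s f) atTop (𝓝 ((T - F s) f)) := by
    have h1 : HasSum (fun i => inner ℂ (b i) f • T (b i)) (T f) := by
      simpa only [map_smul, b.repr_apply_apply] using (b.hasSum_repr f).mapL T
    refine Tendsto.sub_const ?_ _
    simp only [hFapply]
    exact h1
  refine le_of_tendsto hlim.norm ?_
  filter_upwards [eventually_ge_atTop s] with t ht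
  rw [hFapply, hFapply, ← Finset.sum_sdiff ht, add_sub_cancel_right]
  have h1 : ∑ i ∈ t \ s, ‖T (b i)‖ ^ 2 ≤ (ε / 2) ^ 2 := by
    have := hs₀ (t \ s) (Finset.disjoint_of_subset_right hss Finset.sdiff_disjoint)
    exact (le_abs_self _).trans this.le
  have h2 : ∑ i ∈ t \ s, ‖inner ℂ (b i) f‖ ^ 2 ≤ ‖f‖ ^ 2 :=
    b.orthonormal.sum_inner_products_le f
  calc ‖∑ i ∈ t \ s, inner ℂ (b i) f • T (b i)‖
      ≤ ∑ i ∈ t \ s, ‖inner ℂ (b i) f‖ * ‖T (b i)‖ :=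
        (norm_sum_le _ _).trans (Finset.sum_le_sum fun i _ => (norm_smul _ _).le)
    _ ≤ √(∑ i ∈ t \ s, ‖inner ℂ (b i) f‖ ^ 2) * √(∑ i ∈ t \ s, ‖T (b i)‖ ^ 2) :=
        Real.sum_mul_le_sqrt_mul_sqrt _ _ _
    _ ≤ ‖f‖ * (ε / 2) :=
        mul_le_mul (Real.sqrt_le_iff.2 ⟨norm_nonneg _, h2⟩)
          (Real.sqrt_le_iff.2 ⟨(half_pos hε).le, h1⟩) (Real.sqrt_nonneg _) (norm_nonneg _)
    _ = ε / 2 * ‖f‖ := mul_comm _ _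

variable {X : Type*} [MeasurableSpace X] {μ : Measure X}

lemma lintegral_enorm_sq_eq (f : Lp ℂ 2 μ) : ∫⁻ v, ‖f v‖ₑ ^ 2 ∂μ = ENNReal.ofReal (‖f‖ ^ 2) := by
  have h := eLpNorm_nnreal_pow_eq_lintegral (f := f) (μ := μ) (p := 2) two_ne_zero
  simp only [NNReal.coe_ofNat, ENNReal.coe_ofNat, ENNReal.rpow_ofNat] at h
  rw [← h, Lp.norm_def, ENNReal.ofReal_pow ENNReal.toReal_nonneg,
    ENNReal.ofReal_toReal (Lp.eLpNorm_ne_top f)]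

lemma memLp_two_of_lintegral_lt_top {f : X → ℂ} (hf : AEStronglyMeasurable f μ)
    (h : ∫⁻ v, ‖f v‖ₑ ^ 2 ∂μ < ⊤) : MemLp f 2 μ := by
  refine ⟨hf, ?_⟩
  have h' := eLpNorm_nnreal_pow_eq_lintegral (f := f) (μ := μ) (p := 2) two_ne_zero
  simp only [NNReal.coe_ofNat, ENNReal.coe_ofNat, ENNReal.rpow_ofNat] at h'
  rw [← h'] at h
  exact (ENNReal.pow_lt_top_iff.1 h).resolve_right two_ne_zero

/-- A bounded operator on `L²` from a formula that is linear almost everywhere. -/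
lemma exists_clm_of_lintegral_le (Φ : Lp ℂ 2 μ → X → ℂ) {C : ℝ} (hC : 0 ≤ C)
    (hm : ∀ f, AEStronglyMeasurable (Φ f) μ)
    (hadd : ∀ f g, Φ (f + g) =ᵐ[μ] fun v => Φ f v + Φ g v)
    (hsmul : ∀ (c : ℂ) f, Φ (c • f) =ᵐ[μ] fun v => c * Φ f v)
    (hb : ∀ f, ∫⁻ v, ‖Φ f v‖ₑ ^ 2 ∂μ ≤ ENNReal.ofReal ((C * ‖f‖) ^ 2)) :
    ∃ T : Lp ℂ 2 μ →L[ℂ] Lp ℂ 2 μ, (∀ f, T f =ᵐ[μ] Φ f) ∧ ‖T‖ ≤ C := by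
  have hmem : ∀ f, MemLp (Φ f) 2 μ := fun f =>
    memLp_two_of_lintegral_lt_top (hm f) ((hb f).trans_lt ENNReal.ofReal_lt_top)
  have hcoe : ∀ f, ((hmem f).toLp : X → ℂ) =ᵐ[μ] Φ f := fun f => (hmem f).coeFn_toLp
  let T₀ : Lp ℂ 2 μ →ₗ[ℂ] Lp ℂ 2 μ :=
    { toFun := fun f => (hmem f).toLp
      map_add' := fun f g => by
        refine Lp.ext ?_
        filter_upwards [hcoe (f + g), hcoe f, hcoe g, hadd f g,
          Lp.coeFn_add (hmem f).toLp (hmem g).toLp] with v h1 h2 h3 h4 h5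
        rw [h1, h4, h5, Pi.add_apply, h2, h3]
      map_smul' := fun c f => by
        refine Lp.ext ?_
        filter_upwards [hcoe (c • f), hcoe f, hsmul c f,
          Lp.coeFn_smul c (hmem f).toLp] with v h1 h2 h3 h4
        rw [h1, h3, RingHom.id_apply, h4, Pi.smul_apply, h2, smul_eq_mul] }
  have hT : ∀ f, ‖T₀ f‖ ≤ C * ‖f‖ := by
    intro f
    have h1 := lintegral_enorm_sq_eq (T₀ f)
    have h2 : ∫⁻ v, ‖T₀ f v‖ₑ ^ 2 ∂μ = ∫⁻ v, ‖Φ f v‖ₑ ^ 2 ∂μ :=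
      lintegral_congr_ae (by filter_upwards [hcoe f] with v hv; exact congrArg (‖·‖ₑ ^ 2) hv)
    have h3 := hb f
    rw [← h2, h1, ENNReal.ofReal_le_ofReal_iff (by positivity)] at h3
    exact (sq_le_sq₀ (norm_nonneg _) (by positivity)).1 h3
  exact ⟨T₀.mkContinuous C hT, hcoe, T₀.mkContinuous_norm_le hC hT⟩

/-- Integral operators with square integrable kernel are compact: by Bessel's inequality for the
sections of the kernel, they are square summable on every Hilbert basis. -/
lemma isCompactOperator_of_sq_integrable_kernel [SFinite μ] {k : X → X → ℝ}
    (hk : Measurable (Function.uncurry k))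
    (hk2 : ∫⁻ v, ∫⁻ v', ENNReal.ofReal (k v v' ^ 2) ∂μ ∂μ < ⊤)
    (T : Lp ℂ 2 μ →L[ℂ] Lp ℂ 2 μ) (hT : ∀ f, T f =ᵐ[μ] fun v => ∫ v', (k v v' : ℂ) * f v' ∂μ) :
    IsCompactOperator T := by
  obtain ⟨w, b, -⟩ := exists_hilbertBasis ℂ (Lp ℂ 2 μ)
  refine isCompactOperator_of_summable_sq b T ?_
  have hsec : ∀ v, Measurable fun v' => (k v v' : ℂ) := fun v =>
    Complex.measurable_ofReal.comp (hk.comp measurable_prodMk_left)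
  have henorm : ∀ v v', ‖(k v v' : ℂ)‖ₑ ^ 2 = ENNReal.ofReal (k v v' ^ 2) := fun v v' => by
    rw [← ofReal_norm, ← ENNReal.ofReal_pow (norm_nonneg _), Complex.norm_real,
      Real.norm_eq_abs, sq_abs]
  have hmeas : Measurable fun v => ∫⁻ v', ENNReal.ofReal (k v v' ^ 2) ∂μ :=
    Measurable.lintegral_prod_right' (f := fun p : X × X => ENNReal.ofReal (k p.1 p.2 ^ 2))
      (ENNReal.measurable_ofReal.comp (hk.pow_const 2))
  have hfin := ae_lt_top hmeas hk2.ne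
  refine summable_of_sum_le (c := (∫⁻ v, ∫⁻ v', ENNReal.ofReal (k v v' ^ 2) ∂μ ∂μ).toReal)
    (fun i => sq_nonneg _) fun s => ?_
  rw [← ENNReal.ofReal_le_iff_le_toReal hk2.ne, ENNReal.ofReal_sum_of_nonneg fun i _ => sq_nonneg _]
  simp only [← lintegral_enorm_sq_eq]
  rw [← lintegral_finsetSum' _ fun i _ => (Lp.aestronglyMeasurable _).enorm.pow_const 2]
  refine lintegral_mono_ae ?_
  have hall : ∀ᵐ v ∂μ, ∀ i ∈ s, T (b i) v = ∫ v', (k v v' : ℂ) * b i v' ∂μ :=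
    (Finset.eventually_all s).2 fun i _ => hT (b i)
  filter_upwards [hfin, hall] with v hv hv2
  have hmem : MemLp (fun v' => (k v v' : ℂ)) 2 μ :=
    memLp_two_of_lintegral_lt_top (hsec v).aestronglyMeasurable (by simpa only [henorm] using hv)
  have hin : ∀ i ∈ s, ‖T (b i) v‖ₑ ^ 2 = ENNReal.ofReal (‖inner ℂ (b i) hmem.toLp‖ ^ 2) := by
    intro i hi
    rw [← ofReal_norm, ← ENNReal.ofReal_pow (norm_nonneg _), norm_inner_symm, hv2 i hi,
      L2.inner_def]
    congr 3
    refine integral_congr_ae ?_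
    filter_upwards [hmem.coeFn_toLp] with v' hv'
    rw [hv']
    simp [mul_comm]
  rw [Finset.sum_congr rfl hin, ← ENNReal.ofReal_sum_of_nonneg fun i _ => sq_nonneg _]
  refine (ENNReal.ofReal_le_ofReal (b.orthonormal.sum_inner_products_le hmem.toLp)).trans ?_
  rw [← lintegral_enorm_sq_eq]
  refine (lintegral_congr_ae ?_).le
  filter_upwards [hmem.coeFn_toLp] with v' hv'
  rw [hv', henorm]

end HilbertSchmidt

/-! ### Gain operators with a symmetric kernel -/

section Kernel

open Filter Topology

variable {X : Type*} [MeasurableSpace X] {μ : Measure X}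

/-- Multiplication by a bounded function. -/
lemma exists_mulOp {m : X → ℝ} (hm : Measurable m) {C : ℝ} (hC : 0 ≤ C) (hb : ∀ v, |m v| ≤ C) :
    ∃ T : Lp ℂ 2 μ →L[ℂ] Lp ℂ 2 μ, (∀ f, T f =ᵐ[μ] fun v => (m v : ℂ) * f v) ∧ ‖T‖ ≤ C := by
  refine exists_clm_of_lintegral_le _ hC (fun f => ?_) (fun f g => ?_) (fun c f => ?_)
    fun f => ?_
  · exact (Complex.measurable_ofReal.comp hm).aestronglyMeasurable.mul (Lp.aestronglyMeasurable f)
  · filter_upwards [Lp.coeFn_add f g] with v hv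
    rw [hv, Pi.add_apply, mul_add]
  · filter_upwards [Lp.coeFn_smul c f] with v hv
    rw [hv, Pi.smul_apply, smul_eq_mul, mul_left_comm]
  · rw [mul_pow, ENNReal.ofReal_mul (sq_nonneg C), ← lintegral_enorm_sq_eq,
      ← lintegral_const_mul' _ _ ENNReal.ofReal_ne_top]
    refine lintegral_mono fun v => ?_
    rw [enorm_mul, mul_pow]
    gcongr
    rw [← ofReal_norm, Complex.norm_real, ENNReal.ofReal_pow hC]
    gcongr
    exact hb v

lemma isSelfAdjoint_of_forall_ae_eq_mul {m : X → ℝ} {T : Lp ℂ 2 μ →L[ℂ] Lp ℂ 2 μ}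
    (hT : ∀ f, T f =ᵐ[μ] fun v => (m v : ℂ) * f v) : IsSelfAdjoint T := by
  rw [ContinuousLinearMap.isSelfAdjoint_iff_isSymmetric]
  intro f g
  change inner ℂ (T f) g = inner ℂ f (T g)
  rw [L2.inner_def, L2.inner_def]
  refine integral_congr_ae ?_
  filter_upwards [hT f, hT g] with v h1 h2
  rw [h1, h2]
  simp
  ring

/-- A symmetric collision kernel `J` with respect to a reference measure `μ`, in detailed balance
with the equilibrium `φ`: the function `σ` is the collision frequency, which is bounded below by
its (essential) infimum `s₀ > 0`. The Schur weight bounds the gain operator, and the last two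
fields say that the gain operator is Hilbert-Schmidt where `σ` is bounded, and that `σ` is close
to `s₀` on an infinite-dimensional space. -/
structure BalanceKernel (μ : Measure X) (J : X → X → ℝ) (φ σ : X → ℝ) (s₀ : ℝ) : Prop where
  measurable_J : Measurable (Function.uncurry J)
  J_nonneg : ∀ v v', 0 ≤ J v v'
  J_symm : ∀ v v', J v v' = J v' v
  J_pos : ∀ v, ∀ᵐ v' ∂μ, 0 < J v v'
  measurable_φ : Measurable φ
  φ_pos : ∀ v, 0 < φ v
  lintegral_φ_sq : ∫⁻ v, ENNReal.ofReal (φ v ^ 2) ∂μ = 1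
  measurable_σ : Measurable σ
  s₀_pos : 0 < s₀
  s₀_le : ∀ v, s₀ ≤ σ v
  balance : ∀ v, ∫⁻ v', ENNReal.ofReal (J v v' * φ v') ∂μ = ENNReal.ofReal (σ v * φ v)
  schur : ∃ (ψ : X → ℝ) (C : ℝ), Measurable ψ ∧ (∀ v, 0 < ψ v) ∧ 0 ≤ C ∧
    ∀ v, ∫⁻ v', ENNReal.ofReal (J v v' * ψ v') ∂μ ≤ ENNReal.ofReal (C * ψ v)
  hilbertSchmidt : ∀ R : ℝ, ∃ E : Set X, MeasurableSet E ∧ (∀ v, v ∉ E → R ≤ σ v) ∧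
    ∫⁻ v in E, ∫⁻ v', ENNReal.ofReal (J v v' ^ 2) ∂μ ∂μ < ⊤
  near_inf : ∀ δ : ℝ, 0 < δ → ∃ E : ℕ → Set X, (∀ n, MeasurableSet (E n)) ∧
    Pairwise (Function.onFun Disjoint E) ∧ (∀ n, 0 < μ (E n) ∧ μ (E n) < ⊤) ∧
    ∀ n, ∀ v ∈ E n, σ v ≤ s₀ + δ

namespace BalanceKernel

variable [SFinite μ] {J : X → X → ℝ} {φ σ : X → ℝ} {s₀ : ℝ} (k : BalanceKernel μ J φ σ s₀)
include k

/-- The Schur test: the Cauchy-Schwarz inequality for `J = (J ψ)^(1/2) (J ψ⁻¹)^(1/2)`. -/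
lemma exists_lintegral_sq_le : ∃ C : ℝ, 0 ≤ C ∧ ∀ F : X → ENNReal, Measurable F →
    ∫⁻ v, (∫⁻ v', ENNReal.ofReal (J v v') * F v' ∂μ) ^ 2 ∂μ
      ≤ ENNReal.ofReal (C ^ 2) * ∫⁻ v, F v ^ 2 ∂μ := by
  obtain ⟨ψ, C, hψm, hψ, hC, hS⟩ := k.schur
  refine ⟨C, hC, fun F hF => ?_⟩
  set j : X → X → ENNReal := fun v v' => ENNReal.ofReal (J v v') with hj
  set p : X → ENNReal := fun v => ENNReal.ofReal (ψ v) with hp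
  have hjm : Measurable (Function.uncurry j) := ENNReal.measurable_ofReal.comp k.measurable_J
  have hjv : ∀ v, Measurable (j v) := fun v => hjm.comp measurable_prodMk_left
  have hpm : Measurable p := ENNReal.measurable_ofReal.comp hψm
  have hp0 : ∀ v, p v ≠ 0 := fun v => (ENNReal.ofReal_pos.2 (hψ v)).ne'
  have hpt : ∀ v, p v ≠ ⊤ := fun v => ENNReal.ofReal_ne_top
  have hS' : ∀ v, ∫⁻ v', j v v' * p v' ∂μ ≤ ENNReal.ofReal C * p v := fun v => by
    have := hS v
    rw [ENNReal.ofReal_mul hC] at this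
    refine le_trans (le_of_eq (lintegral_congr fun v' => ?_)) this
    rw [ENNReal.ofReal_mul (k.J_nonneg _ _)]
  have hpt1 : ∀ v, (∫⁻ v', j v v' * F v' ∂μ) ^ 2
      ≤ ENNReal.ofReal C * p v * ∫⁻ v', j v v' * (F v' ^ 2 * (p v')⁻¹) ∂μ := by
    intro v
    have h1 := ENNReal.lintegral_mul_norm_pow_le (μ := μ) (f := fun v' => j v v' * p v')
      (g := fun v' => j v v' * (F v' ^ 2 * (p v')⁻¹)) (p := 1 / 2) (q := 1 / 2)
      ((hjv v).mul hpm).aemeasurable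
      ((hjv v).mul ((hF.pow_const 2).mul hpm.inv)).aemeasurable (by norm_num) (by norm_num)
      (by norm_num)
    have h2 : ∀ v', (j v v' * p v') ^ (1 / 2 : ℝ) * (j v v' * (F v' ^ 2 * (p v')⁻¹)) ^ (1 / 2 : ℝ)
        = j v v' * F v' := by
      intro v'
      rw [← ENNReal.mul_rpow_of_nonneg _ _ (by norm_num)]
      have : j v v' * p v' * (j v v' * (F v' ^ 2 * (p v')⁻¹)) = (j v v' * F v') ^ (2 : ℝ) := by
        rw [ENNReal.rpow_two, mul_pow]
        calc _ = j v v' ^ 2 * F v' ^ 2 * (p v' * (p v')⁻¹) := by ring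
          _ = _ := by rw [ENNReal.mul_inv_cancel (hp0 v') (hpt v'), mul_one]
      rw [this, ← ENNReal.rpow_mul]
      norm_num
    simp only [h2] at h1
    calc (∫⁻ v', j v v' * F v' ∂μ) ^ 2 ≤ _ := pow_le_pow_left' h1 2
      _ = (∫⁻ v', j v v' * p v' ∂μ) * ∫⁻ v', j v v' * (F v' ^ 2 * (p v')⁻¹) ∂μ := by
          rw [mul_pow, ← ENNReal.rpow_two, ← ENNReal.rpow_two, ← ENNReal.rpow_mul,
            ← ENNReal.rpow_mul]
          norm_num
      _ ≤ _ := by gcongr; exact hS' v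
  have hm2 : Measurable fun q : X × X => p q.1 * (j q.1 q.2 * (F q.2 ^ 2 * (p q.2)⁻¹)) :=
    (hpm.comp measurable_fst).mul (hjm.mul
      (((hF.comp measurable_snd).pow_const 2).mul (hpm.comp measurable_snd).inv))
  calc ∫⁻ v, (∫⁻ v', j v v' * F v' ∂μ) ^ 2 ∂μ
      ≤ ∫⁻ v, ENNReal.ofReal C * ∫⁻ v', p v * (j v v' * (F v' ^ 2 * (p v')⁻¹)) ∂μ ∂μ := by
        refine lintegral_mono fun v => (hpt1 v).trans (le_of_eq ?_)
        rw [lintegral_const_mul' _ _ (hpt v), mul_assoc]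
    _ = ENNReal.ofReal C * ∫⁻ v, ∫⁻ v', p v * (j v v' * (F v' ^ 2 * (p v')⁻¹)) ∂μ ∂μ :=
        lintegral_const_mul' _ _ ENNReal.ofReal_ne_top
    _ = ENNReal.ofReal C * ∫⁻ v', ∫⁻ v, p v * (j v v' * (F v' ^ 2 * (p v')⁻¹)) ∂μ ∂μ := by
        rw [lintegral_lintegral_swap hm2.aemeasurable]
    _ ≤ ENNReal.ofReal C * ∫⁻ v', ENNReal.ofReal C * F v' ^ 2 ∂μ := by
        gcongr with v'
        calc ∫⁻ v, p v * (j v v' * (F v' ^ 2 * (p v')⁻¹)) ∂μ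
            = ∫⁻ v, j v' v * p v * (F v' ^ 2 * (p v')⁻¹) ∂μ := by
              refine lintegral_congr fun v => ?_
              simp only [hj, k.J_symm v' v]
              ring
          _ = (∫⁻ v, j v' v * p v ∂μ) * (F v' ^ 2 * (p v')⁻¹) :=
              lintegral_mul_const _ ((hjv v').mul hpm)
          _ ≤ ENNReal.ofReal C * p v' * (F v' ^ 2 * (p v')⁻¹) := by gcongr; exact hS' v'
          _ = ENNReal.ofReal C * F v' ^ 2 * (p v' * (p v')⁻¹) := by ring
          _ = _ := by rw [ENNReal.mul_inv_cancel (hp0 v') (hpt v'), mul_one]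
    _ = _ := by
        rw [lintegral_const_mul' _ _ ENNReal.ofReal_ne_top, ← mul_assoc, ← ENNReal.ofReal_mul hC,
          sq]

omit [SFinite μ] in
lemma enorm_J_mul (v v' : X) (z : ℂ) : ‖(J v v' : ℂ) * z‖ₑ = ENNReal.ofReal (J v v') * ‖z‖ₑ := by
  rw [enorm_mul, ← ofReal_norm (J v v' : ℂ), Complex.norm_real, Real.norm_eq_abs,
    abs_of_nonneg (k.J_nonneg v v')]

omit [SFinite μ] in
lemma measurable_J_right (v : X) : Measurable fun v' => (J v v' : ℂ) :=
  Complex.measurable_ofReal.comp (k.measurable_J.comp measurable_prodMk_left)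

lemma ae_integrable (f : Lp ℂ 2 μ) :
    ∀ᵐ v ∂μ, Integrable (fun v' => (J v v' : ℂ) * f v') μ := by
  obtain ⟨C, hC, h⟩ := k.exists_lintegral_sq_le
  have h1 := h (fun v => ‖f v‖ₑ) (Lp.stronglyMeasurable f).measurable.enorm
  rw [lintegral_enorm_sq_eq] at h1
  have hm : Measurable fun v => (∫⁻ v', ENNReal.ofReal (J v v') * ‖f v'‖ₑ ∂μ) ^ 2 := by
    refine Measurable.pow_const (Measurable.lintegral_prod_right'
      (f := fun q : X × X => ENNReal.ofReal (J q.1 q.2) * ‖f q.2‖ₑ) ?_) 2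
    exact (ENNReal.measurable_ofReal.comp k.measurable_J).mul
      ((Lp.stronglyMeasurable f).measurable.comp measurable_snd).enorm
  have h2 := ae_lt_top hm
    (h1.trans_lt (ENNReal.mul_lt_top ENNReal.ofReal_lt_top ENNReal.ofReal_lt_top)).ne
  filter_upwards [h2] with v hv
  refine ⟨(k.measurable_J_right v).aestronglyMeasurable.mul (Lp.aestronglyMeasurable f), ?_⟩
  rw [HasFiniteIntegral]
  simp only [k.enorm_J_mul]
  exact (ENNReal.pow_lt_top_iff.1 hv).resolve_right two_ne_zero

/-- The gain operator. -/
lemma exists_integralOp : ∃ K : Lp ℂ 2 μ →L[ℂ] Lp ℂ 2 μ,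
    ∀ f, K f =ᵐ[μ] fun v => ∫ v', (J v v' : ℂ) * f v' ∂μ := by
  obtain ⟨C, hC, h⟩ := k.exists_lintegral_sq_le
  refine (exists_clm_of_lintegral_le (μ := μ)
    (fun f v => ∫ v', (J v v' : ℂ) * f v' ∂μ) hC (fun f => ?_) (fun f g => ?_) (fun c f => ?_)
    fun f => ?_).imp fun K hK => hK.1
  · refine (StronglyMeasurable.integral_prod_right'
      (f := fun q : X × X => (J q.1 q.2 : ℂ) * f q.2) ?_).aestronglyMeasurable
    exact (Complex.measurable_ofReal.comp k.measurable_J).stronglyMeasurable.mul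
      ((Lp.stronglyMeasurable f).comp_measurable measurable_snd)
  · filter_upwards [k.ae_integrable f, k.ae_integrable g] with v hf hg
    rw [← integral_add hf hg]
    refine integral_congr_ae ?_
    filter_upwards [Lp.coeFn_add f g] with v' hv'
    rw [hv', Pi.add_apply, mul_add]
  · refine Eventually.of_forall fun v => ?_
    simp only
    rw [← integral_const_mul]
    refine integral_congr_ae ?_
    filter_upwards [Lp.coeFn_smul c f] with v' hv'
    rw [hv', Pi.smul_apply, smul_eq_mul, mul_left_comm]
  · rw [mul_pow, ENNReal.ofReal_mul (sq_nonneg C), ← lintegral_enorm_sq_eq]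
    refine le_trans (lintegral_mono fun v => ?_)
      (h (fun v => ‖f v‖ₑ) (Lp.stronglyMeasurable f).measurable.enorm)
    refine pow_le_pow_left' ((enorm_integral_le_lintegral_enorm _).trans (le_of_eq ?_)) 2
    simp only [k.enorm_J_mul]

variable {K : Lp ℂ 2 μ →L[ℂ] Lp ℂ 2 μ}

lemma integrable_prod (f g : Lp ℂ 2 μ) : Integrable
    (fun q : X × X => starRingEnd ℂ (f q.1) * ((J q.1 q.2 : ℂ) * g q.2)) (μ.prod μ) := by
  have hm : Measurable (fun q : X × X => starRingEnd ℂ (f q.1) * ((J q.1 q.2 : ℂ) * g q.2)) :=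
    (Complex.continuous_conj.measurable.comp
      ((Lp.stronglyMeasurable f).measurable.comp measurable_fst)).mul
      ((Complex.measurable_ofReal.comp k.measurable_J).mul
        ((Lp.stronglyMeasurable g).measurable.comp measurable_snd))
  refine ⟨hm.aestronglyMeasurable, ?_⟩
  rw [HasFiniteIntegral, lintegral_prod _ hm.enorm.aemeasurable]
  obtain ⟨C, hC, h⟩ := k.exists_lintegral_sq_le
  have h1 := h (fun v => ‖g v‖ₑ) (Lp.stronglyMeasurable g).measurable.enorm
  rw [lintegral_enorm_sq_eq] at h1
  have hle : ∀ v, ∫⁻ v', ‖starRingEnd ℂ (f v) * ((J v v' : ℂ) * g v')‖ₑ ∂μ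
      ≤ ‖f v‖ₑ ^ 2 + (∫⁻ v', ENNReal.ofReal (J v v') * ‖g v'‖ₑ ∂μ) ^ 2 := by
    intro v
    simp only [enorm_mul (starRingEnd ℂ (f v)), k.enorm_J_mul]
    rw [lintegral_const_mul' _ _ enorm_ne_top]
    have : ‖starRingEnd ℂ (f v)‖ₑ = ‖f v‖ₑ := by
      rw [← ofReal_norm, ← ofReal_norm, Complex.norm_conj]
    rw [this]
    set a := ‖f v‖ₑ
    set b := ∫⁻ v', ENNReal.ofReal (J v v') * ‖g v'‖ₑ ∂μ
    rcases le_total a b with hab | hab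
    · exact (mul_le_mul_left hab b).trans (by rw [sq b]; exact le_add_self)
    · exact (mul_le_mul_right hab a).trans (by rw [sq a]; exact le_self_add)
  refine (lintegral_mono hle).trans_lt ?_
  rw [lintegral_add_left ((Lp.stronglyMeasurable f).measurable.enorm.pow_const 2),
    lintegral_enorm_sq_eq]
  exact ENNReal.add_lt_top.2 ⟨ENNReal.ofReal_lt_top,
    h1.trans_lt (ENNReal.mul_lt_top ENNReal.ofReal_lt_top ENNReal.ofReal_lt_top)⟩

lemma inner_integralOp (hK : ∀ f, K f =ᵐ[μ] fun v => ∫ v', (J v v' : ℂ) * f v' ∂μ)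
    (f g : Lp ℂ 2 μ) : inner ℂ f (K g)
      = ∫ q : X × X, starRingEnd ℂ (f q.1) * ((J q.1 q.2 : ℂ) * g q.2) ∂μ.prod μ := by
  rw [integral_prod _ (k.integrable_prod f g), L2.inner_def]
  refine integral_congr_ae ?_
  filter_upwards [hK g] with v hv
  rw [integral_const_mul, hv]
  simp [mul_comm]

lemma isSelfAdjoint_integralOp
    (hK : ∀ f, K f =ᵐ[μ] fun v => ∫ v', (J v v' : ℂ) * f v' ∂μ) : IsSelfAdjoint K := by
  rw [ContinuousLinearMap.isSelfAdjoint_iff_isSymmetric]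
  intro f g
  change inner ℂ (K f) g = inner ℂ f (K g)
  rw [← inner_conj_symm, k.inner_integralOp hK, k.inner_integralOp hK, ← integral_conj,
    ← integral_prod_swap]
  refine integral_congr_ae (Eventually.of_forall fun q => ?_)
  simp only [Prod.fst_swap, Prod.snd_swap, map_mul, Complex.conj_conj, Complex.conj_ofReal]
  rw [k.J_symm q.2 q.1]
  ring

end BalanceKernel

end Kernel

/-! ### Dissipation of energy and compactness -/

section Energy

open Filter Topology

variable {X : Type*} [MeasurableSpace X] {μ : Measure X} [SFinite μ]

namespace BalanceKernel

variable {J : X → X → ℝ} {φ σ : X → ℝ} {s₀ : ℝ} (k : BalanceKernel μ J φ σ s₀)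
include k

omit [SFinite μ] in
lemma σ_pos (v : X) : 0 < σ v := k.s₀_pos.trans_le (k.s₀_le v)

/-- By the balance of gain and loss, one of the two square terms in the energy identity integrates
to `‖σ^(1/2) S h‖² = ‖h‖²`. -/
lemma integrable_balance {S : Lp ℂ 2 μ →L[ℂ] Lp ℂ 2 μ}
    (hS : ∀ f, S f =ᵐ[μ] fun v => (((√(σ v))⁻¹ : ℝ) : ℂ) * f v) (h : Lp ℂ 2 μ) :
    Integrable (fun q : X × X => ‖S h q.1‖ ^ 2 / φ q.1 * (J q.1 q.2 * φ q.2)) (μ.prod μ) ∧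
      ∫ q : X × X, ‖S h q.1‖ ^ 2 / φ q.1 * (J q.1 q.2 * φ q.2) ∂μ.prod μ = ‖h‖ ^ 2 := by
  set F : X × X → ℝ := fun q => ‖S h q.1‖ ^ 2 / φ q.1 * (J q.1 q.2 * φ q.2) with hF
  have hFm : Measurable F :=
    ((((Lp.stronglyMeasurable (S h)).measurable.comp measurable_fst).norm.pow_const 2).div
      (k.measurable_φ.comp measurable_fst)).mul
      (k.measurable_J.mul (k.measurable_φ.comp measurable_snd))
  have hF0 : ∀ q, 0 ≤ F q := fun q => by
    have := k.φ_pos q.1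
    have := k.φ_pos q.2
    have := k.J_nonneg q.1 q.2
    positivity
  have hlin : ∫⁻ q, ENNReal.ofReal (F q) ∂μ.prod μ = ENNReal.ofReal (‖h‖ ^ 2) := by
    rw [lintegral_prod (fun q => ENNReal.ofReal (F q)) hFm.ennreal_ofReal.aemeasurable,
      ← lintegral_enorm_sq_eq]
    refine lintegral_congr_ae ?_
    filter_upwards [hS h] with v hv
    have hφ := k.φ_pos v
    have hσ := k.σ_pos v
    have h1 : ∀ v', ENNReal.ofReal (F (v, v'))
        = ENNReal.ofReal (‖S h v‖ ^ 2 / φ v) * ENNReal.ofReal (J v v' * φ v') := fun v' => by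
      rw [← ENNReal.ofReal_mul (by positivity)]
    simp only [h1]
    rw [lintegral_const_mul' _ _ ENNReal.ofReal_ne_top, k.balance,
      ← ENNReal.ofReal_mul (by positivity), hv, ← ofReal_norm, ← ENNReal.ofReal_pow (norm_nonneg _),
      norm_mul, Complex.norm_real, Real.norm_eq_abs, mul_pow, sq_abs, inv_pow, Real.sq_sqrt hσ.le]
    congr 1
    field_simp
  constructor
  · refine ⟨hFm.aestronglyMeasurable, ?_⟩
    rw [hasFiniteIntegral_iff_ofReal (Eventually.of_forall hF0), hlin]
    exact ENNReal.ofReal_lt_top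
  · rw [integral_eq_lintegral_of_nonneg_ae (Eventually.of_forall hF0) hFm.aestronglyMeasurable,
      hlin, ENNReal.toReal_ofReal (sq_nonneg _)]

/-- The energy identity: `-⟨𝓛 f, f⟩` for `f = S h`, with `S` the multiplication by `σ^(-1/2)` and
`𝓛 = K - σ`, is the integral of a square. -/
lemma energy_identity {K S : Lp ℂ 2 μ →L[ℂ] Lp ℂ 2 μ}
    (hK : ∀ f, K f =ᵐ[μ] fun v => ∫ v', (J v v' : ℂ) * f v' ∂μ)
    (hS : ∀ f, S f =ᵐ[μ] fun v => (((√(σ v))⁻¹ : ℝ) : ℂ) * f v) (h : Lp ℂ 2 μ) :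
    Integrable (fun q : X × X => J q.1 q.2 * φ q.1 * φ q.2 / 2 *
        ‖S h q.1 / φ q.1 - S h q.2 / φ q.2‖ ^ 2) (μ.prod μ) ∧
      ∫ q : X × X, J q.1 q.2 * φ q.1 * φ q.2 / 2 *
        ‖S h q.1 / φ q.1 - S h q.2 / φ q.2‖ ^ 2 ∂μ.prod μ
        = ‖h‖ ^ 2 - (inner ℂ (S h) (K (S h))).re := by
  obtain ⟨ha, hai⟩ := k.integrable_balance hS h
  have hb : Integrable (fun q : X × X =>
      ‖S h q.swap.1‖ ^ 2 / φ q.swap.1 * (J q.swap.1 q.swap.2 * φ q.swap.2)) (μ.prod μ) := ha.swap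
  have hbi := integral_prod_swap (μ := μ) (ν := μ)
    (fun q : X × X => ‖S h q.1‖ ^ 2 / φ q.1 * (J q.1 q.2 * φ q.2))
  rw [hai] at hbi
  have hc := (k.integrable_prod (S h) (S h)).re
  have hci : ∫ q : X × X, RCLike.re
      (starRingEnd ℂ (S h q.1) * ((J q.1 q.2 : ℂ) * S h q.2)) ∂μ.prod μ
      = (inner ℂ (S h) (K (S h))).re := by
    rw [k.inner_integralOp hK]
    exact integral_re (k.integrable_prod (S h) (S h))
  have heq : ∀ q : X × X, J q.1 q.2 * φ q.1 * φ q.2 / 2 *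
        ‖S h q.1 / φ q.1 - S h q.2 / φ q.2‖ ^ 2
      = 1 / 2 * (‖S h q.1‖ ^ 2 / φ q.1 * (J q.1 q.2 * φ q.2)
        + ‖S h q.swap.1‖ ^ 2 / φ q.swap.1 * (J q.swap.1 q.swap.2 * φ q.swap.2))
        - RCLike.re (starRingEnd ℂ (S h q.1) * ((J q.1 q.2 : ℂ) * S h q.2)) := by
    intro q
    have h1 := (k.φ_pos q.1).ne'
    have h2 := (k.φ_pos q.2).ne'
    rw [Prod.fst_swap, Prod.snd_swap, k.J_symm q.2 q.1]
    generalize S h q.1 = x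
    generalize S h q.2 = y
    simp only [← Complex.normSq_eq_norm_sq, Complex.normSq_apply, Complex.sub_re,
      Complex.sub_im, Complex.div_ofReal_re, Complex.div_ofReal_im, RCLike.re_eq_complex_re, Complex.mul_re, Complex.mul_im,
      Complex.conj_re, Complex.conj_im, Complex.ofReal_re, Complex.ofReal_im]
    field_simp
    ring
  simp only [heq]
  have hab : Integrable (fun q : X × X => 1 / 2 * (‖S h q.1‖ ^ 2 / φ q.1 * (J q.1 q.2 * φ q.2)
      + ‖S h q.swap.1‖ ^ 2 / φ q.swap.1 * (J q.swap.1 q.swap.2 * φ q.swap.2))) (μ.prod μ) :=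
    (ha.add hb).const_mul (1 / 2)
  refine ⟨hab.sub hc, ?_⟩
  rw [integral_sub hab hc, integral_const_mul, hci, integral_add ha hb, hai, hbi]
  ring

/-- The symmetrised gain operator `S K S` is at most the identity. -/
lemma re_inner_le {K S : Lp ℂ 2 μ →L[ℂ] Lp ℂ 2 μ}
    (hK : ∀ f, K f =ᵐ[μ] fun v => ∫ v', (J v v' : ℂ) * f v' ∂μ)
    (hS : ∀ f, S f =ᵐ[μ] fun v => (((√(σ v))⁻¹ : ℝ) : ℂ) * f v) (h : Lp ℂ 2 μ) :
    (inner ℂ (S h) (K (S h))).re ≤ ‖h‖ ^ 2 := by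
  have h1 := (k.energy_identity hK hS h).2
  have h2 : 0 ≤ ∫ q : X × X, J q.1 q.2 * φ q.1 * φ q.2 / 2 *
        ‖S h q.1 / φ q.1 - S h q.2 / φ q.2‖ ^ 2 ∂μ.prod μ := by
    refine integral_nonneg fun q => ?_
    have := k.φ_pos q.1
    have := k.φ_pos q.2
    have := k.J_nonneg q.1 q.2
    positivity
  linarith

/-- Only multiples of the equilibrium have no dissipation. -/
lemma exists_eq_mul_of_re_inner_eq {K S : Lp ℂ 2 μ →L[ℂ] Lp ℂ 2 μ}
    (hK : ∀ f, K f =ᵐ[μ] fun v => ∫ v', (J v v' : ℂ) * f v' ∂μ)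
    (hS : ∀ f, S f =ᵐ[μ] fun v => (((√(σ v))⁻¹ : ℝ) : ℂ) * f v) (h : Lp ℂ 2 μ)
    (heq : (inner ℂ (S h) (K (S h))).re = ‖h‖ ^ 2) :
    ∃ c : ℂ, S h =ᵐ[μ] fun v => c * φ v := by
  obtain ⟨hi, h1⟩ := k.energy_identity hK hS h
  rw [heq, sub_self, integral_eq_zero_iff_of_nonneg _ hi] at h1
  · have h2 := Measure.ae_ae_of_ae_prod h1
    have hμ : μ ≠ 0 := fun h0 => by
      have := k.lintegral_φ_sq
      rw [h0, lintegral_zero_measure] at this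
      exact zero_ne_one this
    have : NeBot (ae μ) := ae_neBot.2 hμ
    obtain ⟨v, hv⟩ := h2.exists
    refine ⟨S h v / φ v, ?_⟩
    filter_upwards [hv, k.J_pos v] with v' h3 h4
    have h5 := k.φ_pos v
    have h6 := k.φ_pos v'
    have h7 : J v v' * φ v * φ v' / 2 ≠ 0 := by positivity
    have h8 := (mul_eq_zero.1 h3).resolve_left h7
    have h9 := sub_eq_zero.1 (norm_eq_zero.1 (pow_eq_zero_iff two_ne_zero |>.1 h8))
    have h10 : (φ v' : ℂ) ≠ 0 := by exact_mod_cast h6.ne'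
    rw [h9]
    field_simp
  · intro q
    have := k.φ_pos q.1
    have := k.φ_pos q.2
    have := k.J_nonneg q.1 q.2
    change 0 ≤ J q.1 q.2 * φ q.1 * φ q.2 / 2 * ‖S h q.1 / φ q.1 - S h q.2 / φ q.2‖ ^ 2
    positivity

/-- The symmetrised gain operator `S K S` is compact: `S` is small where `σ` is large, and
elsewhere the gain operator is Hilbert-Schmidt. -/
lemma isCompactOperator_symm {K S : Lp ℂ 2 μ →L[ℂ] Lp ℂ 2 μ}
    (hK : ∀ f, K f =ᵐ[μ] fun v => ∫ v', (J v v' : ℂ) * f v' ∂μ)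
    (hS : ∀ f, S f =ᵐ[μ] fun v => (((√(σ v))⁻¹ : ℝ) : ℂ) * f v) :
    IsCompactOperator (S * K * S) := by
  classical
  have hcl := isClosed_setOfPred_isCompactOperator (σ₁₂ := RingHom.id ℂ) (M₁ := Lp ℂ 2 μ)
    (M₂ := Lp ℂ 2 μ)
  have hmem : S * K * S ∈ closure {T : Lp ℂ 2 μ →L[ℂ] Lp ℂ 2 μ | IsCompactOperator T} := by
    rw [Metric.mem_closure_iff]
    intro ε hε
    set D : ℝ := ‖K‖ * ‖S‖ + 1 with hD
    have hDpos : 0 < D := by positivity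
    -- outside `E` the multiplier `σ^(-1/2)` is at most `(ε / 2) / D`
    obtain ⟨E, hE, hER, hE2⟩ := k.hilbertSchmidt ((D / (ε / 2)) ^ 2)
    obtain ⟨I, hI, -⟩ := exists_mulOp (μ := μ) (m := E.indicator fun _ => (1 : ℝ))
      (measurable_const.indicator hE) zero_le_one (fun v => by
        by_cases hv : v ∈ E <;> simp [hv])
    have hIK : IsCompactOperator (I * K) := by
      refine isCompactOperator_of_sq_integrable_kernel
        (k := fun v v' => E.indicator (fun _ => (1 : ℝ)) v * J v v') ?_ ?_ _ fun f => ?_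
      · exact ((measurable_const.indicator hE).comp measurable_fst).mul k.measurable_J
      · rw [← lintegral_indicator hE] at hE2
        refine lt_of_le_of_lt (le_of_eq (lintegral_congr fun v => ?_)) hE2
        by_cases hv : v ∈ E <;> simp [hv]
      · filter_upwards [hI (K f), hK f] with v h1 h2
        rw [mul_apply_eq_comp, h1, h2, ← integral_const_mul]
        refine integral_congr_ae (Eventually.of_forall fun v' => ?_)
        simp only
        push_cast
        ring
    have hc : IsCompactOperator (S * (I * K) * S) :=
      (hIK.clm_comp S).comp_clm S
    refine ⟨_, hc, ?_⟩
    have hsmall : ‖S - S * I‖ ≤ ε / 2 / D := by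
      have hbd : ∀ v, |(√(σ v))⁻¹ * (1 - E.indicator (fun _ => (1 : ℝ)) v)| ≤ ε / 2 / D := by
        intro v
        by_cases hv : v ∈ E
        · simp only [hv, indicator_of_mem, sub_self, mul_zero, abs_zero]
          positivity
        · have h1 := hER v hv
          have h2 : D / (ε / 2) ≤ √(σ v) := Real.le_sqrt_of_sq_le h1
          have h3 : (√(σ v))⁻¹ ≤ ε / 2 / D := by
            rw [← inv_div]
            exact inv_anti₀ (by positivity) h2
          simp only [hv, not_false_eq_true, indicator_of_notMem, sub_zero, mul_one]
          rwa [abs_of_nonneg (by positivity)]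
      obtain ⟨T, hT, hTn⟩ := exists_mulOp (μ := μ)
        (m := fun v => (√(σ v))⁻¹ * (1 - E.indicator (fun _ => (1 : ℝ)) v))
        ((k.measurable_σ.sqrt.inv).mul (measurable_const.sub (measurable_const.indicator hE)))
        (C := ε / 2 / D) (by positivity) hbd
      have hST : S - S * I = T := by
        ext1 f
        refine Lp.ext ?_
        filter_upwards [hT f, Lp.coeFn_sub (S f) (S (I f)), hS f, hS (I f), hI f]
          with v h1 h2 h3 h4 h5
        have : (S - S * I) f = S f - S (I f) := rfl
        rw [this, h1, h2, Pi.sub_apply, h3, h4, h5]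
        push_cast
        ring
      rw [hST]
      exact hTn
    have hdiff : S * K * S - S * (I * K) * S = (S - S * I) * (K * S) := by noncomm_ring
    rw [dist_eq_norm, hdiff]
    calc _ ≤ ‖S - S * I‖ * (‖K‖ * ‖S‖) :=
          (norm_mul_le _ _).trans (mul_le_mul_of_nonneg_left (norm_mul_le _ _) (norm_nonneg _))
      _ ≤ ε / 2 / D * D := by
          refine mul_le_mul hsmall (by linarith) (by positivity) (by positivity)
      _ < ε := by rw [div_mul_cancel₀ _ hDpos.ne']; linarith
  exact (hcl.closure_eq ▸ hmem : S * K * S ∈ {T : Lp ℂ 2 μ →L[ℂ] Lp ℂ 2 μ | IsCompactOperator T})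

end BalanceKernel

end Energy

/-! ### The resolvent of the collision operator -/

section Resolvent

open Filter Topology

/-- A compact operator is not bounded below on a separated bounded sequence. -/
lemma IsCompactOperator.not_forall_norm_sub_le {H : Type*} [NormedAddCommGroup H]
    [InnerProductSpace ℂ H] {C : H →L[ℂ] H} (hC : IsCompactOperator C) {f : ℕ → H}
    (hb : ∀ n, ‖f n‖ ≤ 1) (hsep : ∀ n m, n ≠ m → 1 ≤ ‖f n - f m‖) {L : ℝ} (hL : 0 ≤ L)
    (h : ∀ n m, ‖f n - f m‖ ≤ L * ‖C (f n) - C (f m)‖) : False := by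
  obtain ⟨K, hK, hK'⟩ := hC.image_closedBall_subset_compact (1 : ℝ)
  obtain ⟨y, -, ψ, hψ, hψy⟩ := hK.tendsto_subseq
    (fun n => hK' ⟨f n, by simpa using hb n, rfl⟩)
  obtain ⟨n₀, hn₀⟩ := Metric.cauchySeq_iff'.1 hψy.cauchySeq (1 / (L + 1)) (by positivity)
  have h1 := hn₀ (n₀ + 1) (Nat.le_succ _)
  rw [dist_eq_norm] at h1
  have h2 := hsep (ψ (n₀ + 1)) (ψ n₀) (hψ (Nat.lt_succ_self n₀)).ne'
  have h3 := h (ψ (n₀ + 1)) (ψ n₀)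
  have h4 : L * ‖C (f (ψ (n₀ + 1))) - C (f (ψ n₀))‖ ≤ L * (1 / (L + 1)) :=
    mul_le_mul_of_nonneg_left h1.le hL
  have h5 : L * (1 / (L + 1)) < 1 := by
    rw [mul_one_div, div_lt_one (by positivity)]
    linarith
  linarith

variable {X : Type*} [MeasurableSpace X] {μ : Measure X}

lemma inner_eq_of_isSelfAdjoint {H : Type*} [NormedAddCommGroup H] [InnerProductSpace ℂ H]
    [CompleteSpace H] {S : H →L[ℂ] H} (hS : IsSelfAdjoint S) (f g : H) :
    inner ℂ (S f) g = inner ℂ f (S g) :=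
  (ContinuousLinearMap.isSelfAdjoint_iff_isSymmetric.1 hS) f g

/-- Normalised indicator functions of disjoint sets. -/
lemma exists_separated_seq {E : ℕ → Set X} (hE : ∀ n, MeasurableSet (E n))
    (hd : Pairwise (Function.onFun Disjoint E)) (hμ : ∀ n, 0 < μ (E n) ∧ μ (E n) < ⊤) :
    ∃ f : ℕ → Lp ℂ 2 μ, (∀ n, ‖f n‖ ≤ 1) ∧ (∀ n m, n ≠ m → 1 ≤ ‖f n - f m‖) ∧
      ∀ n, ∀ᵐ v ∂μ, v ∉ E n → f n v = 0 := by
  set i : ℕ → Lp ℂ 2 μ := fun n => indicatorConstLp 2 (hE n) (hμ n).2.ne (1 : ℂ) with hi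
  have hi0 : ∀ n, i n ≠ 0 := by
    intro n h0
    have h1 : ‖i n‖ = μ.real (E n) ^ (1 / (2 : ENNReal).toReal) := by
      rw [hi]
      simp only
      rw [norm_indicatorConstLp two_ne_zero ENNReal.ofNat_ne_top, norm_one, one_mul]
    rw [h0, norm_zero] at h1
    have h2 : 0 < μ.real (E n) := ENNReal.toReal_pos (hμ n).1.ne' (hμ n).2.ne
    exact (Real.rpow_pos_of_pos h2 _).ne h1
  have hsupp : ∀ n, ∀ᵐ v ∂μ, v ∉ E n → i n v = 0 := fun n => by
    filter_upwards [indicatorConstLp_coeFn (p := 2) (hs := hE n) (hμs := (hμ n).2.ne)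
      (c := (1 : ℂ))] with v hv hvE
    rw [hi]
    simp only
    rw [hv, indicator_of_notMem hvE]
  set f : ℕ → Lp ℂ 2 μ := fun n => (((‖i n‖⁻¹ : ℝ) : ℂ)) • i n with hf
  have hfsupp : ∀ n, ∀ᵐ v ∂μ, v ∉ E n → f n v = 0 := fun n => by
    filter_upwards [hsupp n, Lp.coeFn_smul ((‖i n‖⁻¹ : ℝ) : ℂ) (i n)] with v h1 h2 h3
    rw [hf]
    simp only
    rw [h2, Pi.smul_apply, h1 h3, smul_zero]
  have hnorm : ∀ n, ‖f n‖ = 1 := fun n => by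
    simp only [hf, norm_smul, Complex.norm_real, norm_inv, norm_norm]
    exact inv_mul_cancel₀ (norm_ne_zero_iff.2 (hi0 n))
  refine ⟨f, fun n => (hnorm n).le, fun n m hnm => ?_, hfsupp⟩
  have h0 : inner ℂ (f n) (f m) = 0 := by
    rw [L2.inner_def]
    refine integral_eq_zero_of_ae ?_
    filter_upwards [hfsupp n, hfsupp m] with v h1 h2
    by_cases hv : v ∈ E n
    · have : v ∉ E m := fun h => (hd hnm).le_bot ⟨hv, h⟩
      rw [h2 this, inner_zero_right, Pi.zero_apply]
    · rw [h1 hv, inner_zero_left, Pi.zero_apply]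
  have h1 := norm_sub_sq (𝕜 := ℂ) (f n) (f m)
  rw [h0, hnorm, hnorm] at h1
  norm_num at h1
  nlinarith [norm_nonneg (f n - f m)]

namespace BalanceKernel

variable [SFinite μ] {J : X → X → ℝ} {φ σ : X → ℝ} {s₀ : ℝ} (k : BalanceKernel μ J φ σ s₀)
include k

omit [SFinite μ] in
lemma memLp_φ : MemLp (fun v => (φ v : ℂ)) 2 μ := by
  refine memLp_two_of_lintegral_lt_top
    (Complex.measurable_ofReal.comp k.measurable_φ).aestronglyMeasurable ?_
  have : ∀ v, ‖(φ v : ℂ)‖ₑ ^ 2 = ENNReal.ofReal (φ v ^ 2) := fun v => by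
    rw [← ofReal_norm, ← ENNReal.ofReal_pow (norm_nonneg _), Complex.norm_real, Real.norm_eq_abs,
      sq_abs]
  simp only [this, k.lintegral_φ_sq]
  exact ENNReal.one_lt_top

omit [SFinite μ] in
lemma norm_toLp_φ : ‖k.memLp_φ.toLp‖ = 1 := by
  have h1 := lintegral_enorm_sq_eq (k.memLp_φ.toLp)
  have h2 : ∫⁻ v, ‖k.memLp_φ.toLp _ v‖ₑ ^ 2 ∂μ = ∫⁻ v, ENNReal.ofReal (φ v ^ 2) ∂μ := by
    refine lintegral_congr_ae ?_
    filter_upwards [k.memLp_φ.coeFn_toLp] with v hv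
    rw [hv, ← ofReal_norm, ← ENNReal.ofReal_pow (norm_nonneg _), Complex.norm_real,
      Real.norm_eq_abs, sq_abs]
  rw [h2, k.lintegral_φ_sq, ← ENNReal.ofReal_one,
    ENNReal.ofReal_eq_ofReal_iff zero_le_one (sq_nonneg _)] at h1
  exact (pow_eq_one_iff_of_nonneg (norm_nonneg _) two_ne_zero).1 h1.symm

omit [SFinite μ] in
lemma integral_J_mul_φ (v : X) : ∫ v', (J v v' : ℂ) * φ v' ∂μ = (σ v : ℂ) * φ v := by
  have h : ∫ v', J v v' * φ v' ∂μ = σ v * φ v := by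
    rw [integral_eq_lintegral_of_nonneg_ae
      (Eventually.of_forall fun v' => mul_nonneg (k.J_nonneg _ _) (k.φ_pos _).le)
      ((k.measurable_J.comp measurable_prodMk_left).mul k.measurable_φ).aestronglyMeasurable,
      k.balance, ENNReal.toReal_ofReal (mul_nonneg (k.σ_pos v).le (k.φ_pos v).le)]
  simp only [← Complex.ofReal_mul]
  rw [integral_complex_ofReal, h]

/-- The resolvent `A = (1 - 𝓛)⁻¹` of the operator `𝓛 f = ∫ J(·, v') f(v') dμ(v') - σ f` with domain
`{f ; σ f ∈ L²}`, and its comparison with the resolvent `A₀` of the multiplication by `-σ`. With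
`S` the multiplication by `σ^(-1/2)` and `K` the gain operator, `A = S (1 + S² - S K S)⁻¹ S`. -/
theorem exists_gapData : ∃ A A₀ : Lp ℂ 2 μ →L[ℂ] Lp ℂ 2 μ,
    GapData A A₀ (k.memLp_φ.toLp _) (1 + s₀)⁻¹ ∧
    ∀ f g : Lp ℂ 2 μ, A (f - g) = f ↔ MemLp (fun v => (σ v : ℂ) * f v) 2 μ ∧
      g =ᵐ[μ] fun v => (∫ v', (J v v' : ℂ) * f v' ∂μ) - σ v * f v := by
  have hσ := k.σ_pos
  have hs0 := k.s₀_pos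
  obtain ⟨K, hK⟩ := k.exists_integralOp
  obtain ⟨S, hS, -⟩ := exists_mulOp (μ := μ) (m := fun v => (√(σ v))⁻¹) k.measurable_σ.sqrt.inv
    (C := (√s₀)⁻¹) (by positivity) fun v => by
      rw [abs_of_nonneg (by positivity)]
      exact inv_anti₀ (Real.sqrt_pos.2 hs0) (Real.sqrt_le_sqrt (k.s₀_le v))
  -- `N` is multiplication by `σ^(1/2) / (1 + σ)`, that is, `N = (1 + S²)⁻¹ S`
  obtain ⟨N, hN, -⟩ := exists_mulOp (μ := μ) (m := fun v => √(σ v) / (1 + σ v))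
    (k.measurable_σ.sqrt.div (k.measurable_σ.const_add 1)) zero_le_one fun v => by
      have h1 := Real.sq_sqrt (hσ v).le
      have h2 := Real.sqrt_nonneg (σ v)
      have h3 := hσ v
      rw [abs_of_nonneg (by positivity), div_le_one (by positivity)]
      nlinarith
  -- `R² = S N` is the resolvent `(1 + σ)⁻¹` of the multiplication by `-σ`
  obtain ⟨R, hR, hRn⟩ := exists_mulOp (μ := μ) (m := fun v => (√(1 + σ v))⁻¹)
    (k.measurable_σ.const_add 1).sqrt.inv (C := (√(1 + s₀))⁻¹) (by positivity) fun v => by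
      rw [abs_of_nonneg (by positivity)]
      refine inv_anti₀ (Real.sqrt_pos.2 (by positivity)) (Real.sqrt_le_sqrt ?_)
      linarith [k.s₀_le v]
  have hSsa : IsSelfAdjoint S := isSelfAdjoint_of_forall_ae_eq_mul hS
  have hRsa : IsSelfAdjoint R := isSelfAdjoint_of_forall_ae_eq_mul hR
  have hKsa : IsSelfAdjoint K := k.isSelfAdjoint_integralOp hK
  set T := S * K * S with hTdef
  have hTc : IsCompactOperator T := k.isCompactOperator_symm hK hS
  have hSinj : ∀ f, S f = 0 → f = 0 := by
    intro f hf
    refine Lp.ext ?_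
    have h0 : S f =ᵐ[μ] 0 := by rw [hf]; exact Lp.coeFn_zero _ _ _
    filter_upwards [hS f, h0, Lp.coeFn_zero ℂ 2 μ] with v h1 h2 h3
    rw [h3, Pi.zero_apply]
    rw [h2, Pi.zero_apply] at h1
    have h4 : (((√(σ v))⁻¹ : ℝ) : ℂ) ≠ 0 := by
      exact_mod_cast (inv_pos.2 (Real.sqrt_pos.2 (hσ v))).ne'
    exact (mul_eq_zero.1 h1.symm).resolve_left h4
  have hSN : S * N = R * R := by
    ext1 f
    refine Lp.ext ?_
    rw [mul_apply_eq_comp, mul_apply_eq_comp]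
    filter_upwards [hS (N f), hN f, hR (R f), hR f] with v h1 h2 h3 h4
    have h5 := hσ v
    have h6 : (√(σ v))⁻¹ * (√(σ v) / (1 + σ v)) = (√(1 + σ v))⁻¹ * (√(1 + σ v))⁻¹ := by
      rw [← mul_inv, Real.mul_self_sqrt (by positivity)]
      have : √(σ v) ≠ 0 := (Real.sqrt_pos.2 h5).ne'
      field_simp
    rw [h1, h2, h3, h4, ← mul_assoc, ← mul_assoc, ← Complex.ofReal_mul, ← Complex.ofReal_mul, h6]
  have hSdecomp : S = (1 + S * S) * N := by
    ext1 f
    refine Lp.ext ?_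
    have h0 : ((1 + S * S) * N) f = N f + S (S (N f)) := rfl
    rw [h0]
    filter_upwards [hS f, Lp.coeFn_add (N f) (S (S (N f))), hS (S (N f)), hS (N f), hN f]
      with v h1 h2 h3 h4 h5
    have h6 := hσ v
    have h7 : (√(σ v))⁻¹ = √(σ v) / (1 + σ v)
        + (√(σ v))⁻¹ * ((√(σ v))⁻¹ * (√(σ v) / (1 + σ v))) := by
      have h8 : √(σ v) ≠ 0 := (Real.sqrt_pos.2 h6).ne'
      have h9 : √(σ v) ^ 2 = σ v := Real.sq_sqrt h6.le
      field_simp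
      rw [h9]
      ring
    have h8 := congrArg Complex.ofReal h7
    push_cast at h8
    rw [h1, h2, Pi.add_apply, h3, h4, h5]
    push_cast
    linear_combination (f v) * h8
  have hquad : ∀ h, (inner ℂ ((1 + S * S - T) h) h).re
      = ‖h‖ ^ 2 + ‖S h‖ ^ 2 - (inner ℂ (S h) (K (S h))).re := by
    intro h
    have h0 : (1 + S * S - T) h = h + S (S h) - S (K (S h)) := rfl
    rw [h0, inner_sub_left, inner_add_left, inner_eq_of_isSelfAdjoint hSsa (S h),
      inner_eq_of_isSelfAdjoint hSsa (K (S h)), inner_eq_of_isSelfAdjoint hKsa,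
      inner_self_eq_norm_sq_to_K, inner_self_eq_norm_sq_to_K]
    simp [← Complex.ofReal_pow]
  have hunit : IsUnit (1 + S * S - T) := by
    refine isUnit_sub_of_isCompactOperator (isUnit_of_re_inner_ge one_pos fun f => ?_) hTc
      fun h hh => ?_
    · have h0 : (1 + S * S) f = f + S (S f) := rfl
      rw [h0, inner_add_left, inner_eq_of_isSelfAdjoint hSsa (S f), inner_self_eq_norm_sq_to_K,
        inner_self_eq_norm_sq_to_K]
      simp [← Complex.ofReal_pow]
    · have h1 := hquad h
      rw [hh, inner_zero_left, Complex.zero_re] at h1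
      have h2 := k.re_inner_le hK hS h
      have h3 : ‖S h‖ ^ 2 = 0 := le_antisymm (by linarith) (sq_nonneg _)
      exact hSinj h (norm_eq_zero.1 (pow_eq_zero_iff two_ne_zero |>.1 h3))
  obtain ⟨u, hu⟩ := hunit
  set V : Lp ℂ 2 μ →L[ℂ] Lp ℂ 2 μ := ↑u⁻¹ with hV
  have hVB : ∀ f, V ((1 + S * S - T) f) = f := fun f => by
    rw [← hu, ← mul_apply_eq_comp, hV, u.inv_mul]; rfl
  have hBV : ∀ f, (1 + S * S - T) (V f) = f := fun f => by
    rw [← hu, ← mul_apply_eq_comp, hV, u.mul_inv]; rfl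
  have hBsa : IsSelfAdjoint (1 + S * S - T) := by
    have h1 : IsSelfAdjoint (S * S) := by
      rw [IsSelfAdjoint, star_mul, hSsa.star_eq]
    have h2 : IsSelfAdjoint T := by
      rw [IsSelfAdjoint, hTdef, star_mul, star_mul, hSsa.star_eq, hKsa.star_eq, mul_assoc]
    exact ((IsSelfAdjoint.one _).add h1).sub h2
  -- `f = A (f - g)` says that `f` is in the domain of `𝓛` and `g = 𝓛 f`
  have hgraph : ∀ f g : Lp ℂ 2 μ, (S * V * S) (f - g) = f ↔
      MemLp (fun v => (σ v : ℂ) * f v) 2 μ ∧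
        g =ᵐ[μ] fun v => (∫ v', (J v v' : ℂ) * f v' ∂μ) - σ v * f v := by
    intro f g
    have hA : (S * V * S) (f - g) = S (V (S (f - g))) := rfl
    rw [hA]
    constructor
    · intro hf
      set h := V (S (f - g)) with hh
      have h1 : (1 + S * S - T) h = S (f - g) := hBV _
      have h2 : (1 + S * S - T) h = h + S (S h) - S (K (S h)) := rfl
      rw [h2, hf, map_sub] at h1
      have h3 : h = S (K f - g) := by
        rw [map_sub]
        linear_combination (norm := module) h1
      have h4 : (fun v => (σ v : ℂ) * f v) =ᵐ[μ] (K f - g : Lp ℂ 2 μ) := by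
        have h5 : S (S (K f - g)) = f := by rw [← h3, hf]
        filter_upwards [hS (S (K f - g)), hS (K f - g)] with v h6 h7
        rw [h5] at h6
        rw [h6, h7, ← mul_assoc, ← mul_assoc, ← Complex.ofReal_mul, ← Complex.ofReal_mul]
        have h8 : σ v * (√(σ v))⁻¹ * (√(σ v))⁻¹ = 1 := by
          rw [mul_assoc, ← mul_inv, Real.mul_self_sqrt (hσ v).le, mul_inv_cancel₀ (hσ v).ne']
        rw [h8, Complex.ofReal_one, one_mul]
      refine ⟨(memLp_congr_ae h4).2 (Lp.memLp _), ?_⟩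
      filter_upwards [h4, Lp.coeFn_sub (K f) g, hK f] with v h5 h6 h7
      rw [h5, h6, Pi.sub_apply, h7]
      ring
    · rintro ⟨hmem, hg⟩
      set s : Lp ℂ 2 μ := hmem.toLp with hs
      have h1 : g = K f - s := by
        refine Lp.ext ?_
        filter_upwards [hg, hmem.coeFn_toLp, hK f, Lp.coeFn_sub (K f) s] with v h1 h2 h3 h4
        rw [h1, h4, Pi.sub_apply, h2, h3]
      have h2 : S (S s) = f := by
        refine Lp.ext ?_
        filter_upwards [hS (S s), hS s, hmem.coeFn_toLp] with v h6 h7 h8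
        rw [h6, h7, h8, ← mul_assoc, ← mul_assoc, ← Complex.ofReal_mul, ← Complex.ofReal_mul]
        have h9 : (√(σ v))⁻¹ * (√(σ v))⁻¹ * σ v = 1 := by
          rw [← mul_inv, Real.mul_self_sqrt (hσ v).le, inv_mul_cancel₀ (hσ v).ne']
        rw [h9, Complex.ofReal_one, one_mul]
      have h3 : (1 + S * S - T) (S s) = S s + S (S (S s)) - S (K (S (S s))) := rfl
      have h4 : S (f - g) = (1 + S * S - T) (S s) := by
        rw [h3, h2, h1, map_sub, map_sub]
        abel
      rw [h4, hVB, h2]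
  have hSVS : ∀ f, (S * V * S) f = S (V (S f)) := fun f => rfl
  have hsq : ∀ f, (inner ℂ ((S * V * S) f) f).re = ‖V (S f)‖ ^ 2 + ‖S (V (S f))‖ ^ 2
      - (inner ℂ (S (V (S f))) (K (S (V (S f))))).re := by
    intro f
    rw [← hquad, hBV, hSVS, inner_eq_of_isSelfAdjoint hSsa, ← inner_conj_symm, Complex.conj_re]
  refine ⟨S * V * S, R * R, ?_, hgraph⟩
  -- the second resolvent identity: `S V S - R² = S V T N` with `T = S K S` compact
  have hcomp : IsCompactOperator (S * V * S - R * R) := by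
    have h1 : S * V * S - R * R = (S * V) * (T * N) := by
      have h2 : S = (1 + S * S - T) * N + T * N := by
        rw [sub_mul, sub_add_cancel]
        exact hSdecomp
      have h3 : V * (1 + S * S - T) = 1 := by rw [← hu, hV, u.inv_mul]
      calc S * V * S - R * R = S * V * ((1 + S * S - T) * N + T * N) - S * N := by
            rw [← h2, hSN]
        _ = S * (V * (1 + S * S - T)) * N + S * V * (T * N) - S * N := by noncomm_ring
        _ = _ := by rw [h3, mul_one, add_sub_cancel_left]
    rw [h1]
    exact (hTc.comp_clm N).clm_comp (S * V)
  refine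
    { selfAdjoint := ?_
      injective := ?_
      sq_norm_le := ?_
      norm_e := k.norm_toLp_φ
      map_e := ?_
      fixed := ?_
      compact := hcomp
      le_xe := ?_
      xe_pos := by positivity
      xe_lt_one := inv_lt_one_of_one_lt₀ (by linarith)
      xe_mem := ?_ }
  · rw [ContinuousLinearMap.isSelfAdjoint_iff_isSymmetric]
    intro f g
    change inner ℂ (S (V (S f))) g = inner ℂ f (S (V (S g)))
    rw [inner_eq_of_isSelfAdjoint hSsa, ← inner_eq_of_isSelfAdjoint hSsa f]
    calc inner ℂ (V (S f)) (S g) = inner ℂ (V (S f)) ((1 + S * S - T) (V (S g))) := by rw [hBV]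
      _ = inner ℂ ((1 + S * S - T) (V (S f))) (V (S g)) :=
          (inner_eq_of_isSelfAdjoint hBsa _ _).symm
      _ = _ := by rw [hBV]
  · intro f hf
    have h1 : V (S f) = 0 := hSinj _ hf
    have h2 : S f = 0 := by rw [← hBV (S f), h1, map_zero]
    exact hSinj f h2
  · intro f
    rw [hsq, hSVS]
    linarith [k.re_inner_le hK hS (V (S f))]
  · have h1 : (fun v => (σ v : ℂ) * k.memLp_φ.toLp _ v) =ᵐ[μ] K (k.memLp_φ.toLp _) := by
      filter_upwards [hK (k.memLp_φ.toLp _), k.memLp_φ.coeFn_toLp] with v h1 h2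
      rw [h1, h2, ← k.integral_J_mul_φ]
      refine integral_congr_ae ?_
      filter_upwards [k.memLp_φ.coeFn_toLp] with v' h3
      rw [h3]
    have h2 := (hgraph (k.memLp_φ.toLp _) 0).2 ⟨(memLp_congr_ae h1).2 (Lp.memLp _), by
      filter_upwards [h1, hK (k.memLp_φ.toLp _), Lp.coeFn_zero ℂ 2 μ] with v h2 h3 h4
      rw [h4, h2, h3, sub_self, Pi.zero_apply]⟩
    rwa [sub_zero] at h2
  · intro f hf
    have h1 := hsq f
    rw [hf, ← hSVS f, hf, inner_self_eq_norm_sq_to_K] at h1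
    have h2 : ((‖f‖ : ℂ) ^ 2).re = ‖f‖ ^ 2 := by rw [← Complex.ofReal_pow, Complex.ofReal_re]
    erw [h2] at h1
    have h3 : S (V (S f)) = f := hf
    obtain ⟨c, hc⟩ := k.exists_eq_mul_of_re_inner_eq hK hS (V (S f)) (by rw [h3]; linarith)
    refine ⟨c, Lp.ext ?_⟩
    rw [h3] at hc
    filter_upwards [hc, Lp.coeFn_smul c (k.memLp_φ.toLp _), k.memLp_φ.coeFn_toLp] with v h4 h5 h6
    rw [h4, h5, Pi.smul_apply, h6, smul_eq_mul]
  · intro f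
    have h1 : (inner ℂ ((R * R) f) f).re = ‖R f‖ ^ 2 := by
      rw [mul_apply_eq_comp, inner_eq_of_isSelfAdjoint hRsa, inner_self_eq_norm_sq_to_K]
      simp [← Complex.ofReal_pow]
    have h2 : ‖R f‖ ≤ (√(1 + s₀))⁻¹ * ‖f‖ := R.le_of_opNorm_le hRn f
    calc _ = ‖R f‖ ^ 2 := h1
      _ ≤ ((√(1 + s₀))⁻¹ * ‖f‖) ^ 2 := pow_le_pow_left₀ (norm_nonneg _) h2 2
      _ = _ := by rw [mul_pow, inv_pow, Real.sq_sqrt (by positivity)]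
  -- If `(1 + s₀)⁻¹` were not in the spectrum, then the compact operator `A - A₀` would be bounded
  -- below on a separated sequence of functions supported where `σ` is close to `s₀`.
  · by_contra hcon
    rw [spectrum.notMem_iff] at hcon
    obtain ⟨w, hw⟩ := hcon
    set W : Lp ℂ 2 μ →L[ℂ] Lp ℂ 2 μ := ↑w⁻¹ with hW
    obtain ⟨E, hE, hd, hμE, hσE⟩ := k.near_inf (1 / (2 * (‖W‖ + 1))) (by positivity)
    obtain ⟨f, hf1, hf2, hf3⟩ := exists_separated_seq hE hd hμE
    refine IsCompactOperator.not_forall_norm_sub_le hcomp hf1 hf2 (L := 2 * ‖W‖) (by positivity)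
      fun n m => ?_
    rw [← map_sub]
    set d := f n - f m with hddef
    have h1 : ‖(algebraMap ℂ (Lp ℂ 2 μ →L[ℂ] Lp ℂ 2 μ) (((1 + s₀)⁻¹ : ℝ) : ℂ) - R * R) d‖
        ≤ 1 / (2 * (‖W‖ + 1)) * ‖d‖ := by
      refine Lp.norm_le_mul_norm_of_ae_le_mul ?_
      have h0 : (algebraMap ℂ (Lp ℂ 2 μ →L[ℂ] Lp ℂ 2 μ) (((1 + s₀)⁻¹ : ℝ) : ℂ) - R * R) d
          = (((1 + s₀)⁻¹ : ℝ) : ℂ) • d - R (R d) := rfl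
      rw [h0]
      filter_upwards [Lp.coeFn_sub ((((1 + s₀)⁻¹ : ℝ) : ℂ) • d) (R (R d)),
        Lp.coeFn_smul (((1 + s₀)⁻¹ : ℝ) : ℂ) d, hR (R d), hR d, hf3 n, hf3 m,
        Lp.coeFn_sub (f n) (f m)] with v h1 h2 h3 h4 h5 h6 h7
      have h8 := hσ v
      rw [h1, Pi.sub_apply, h2, Pi.smul_apply, h3, h4, ← mul_assoc, ← Complex.ofReal_mul,
        ← mul_inv, Real.mul_self_sqrt (by positivity), smul_eq_mul, ← sub_mul,
        ← Complex.ofReal_sub, norm_mul, Complex.norm_real, Real.norm_eq_abs]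
      by_cases hv : v ∈ E n ∪ E m
      · refine mul_le_mul_of_nonneg_right ?_ (norm_nonneg _)
        have h9 : σ v ≤ s₀ + 1 / (2 * (‖W‖ + 1)) := hv.elim (hσE n v) (hσE m v)
        have h10 := k.s₀_le v
        have h11 : (1 + s₀)⁻¹ - (1 + σ v)⁻¹ = (σ v - s₀) / ((1 + s₀) * (1 + σ v)) := by
          field_simp
          ring
        rw [h11, abs_of_nonneg (div_nonneg (by linarith) (by positivity))]
        refine (div_le_self (by linarith) ?_).trans (by linarith)
        nlinarith
      · rw [mem_union, not_or] at hv
        rw [hddef, h7, Pi.sub_apply, h5 hv.1, h6 hv.2, sub_self, norm_zero, mul_zero, mul_zero]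
    have h2 : d = W ((algebraMap ℂ (Lp ℂ 2 μ →L[ℂ] Lp ℂ 2 μ) (((1 + s₀)⁻¹ : ℝ) : ℂ) - R * R) d
        - (S * V * S - R * R) d) := by
      rw [← sub_apply, sub_sub_sub_cancel_right, ← hw, ← mul_apply_eq_comp, hW, w.inv_mul]
      rfl
    have h3 : ‖d‖ ≤ ‖W‖ * (1 / (2 * (‖W‖ + 1)) * ‖d‖ + ‖(S * V * S - R * R) d‖) := by
      conv_lhs => rw [h2]
      exact (W.le_opNorm _).trans
        (mul_le_mul_of_nonneg_left ((norm_sub_le _ _).trans (by linarith)) (norm_nonneg _))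
    have h4 : ‖W‖ * (1 / (2 * (‖W‖ + 1))) ≤ 1 / 2 := by
      rw [mul_one_div, div_le_div_iff₀ (by positivity) two_pos]
      nlinarith [norm_nonneg W]
    have h5 := mul_le_mul_of_nonneg_right h4 (norm_nonneg d)
    nlinarith

end BalanceKernel

end Resolvent

/-! ### Gaussian slices and polar coordinates -/

section Slicing

open Filter Topology

/-- The centred Gaussian density `√(κ/π) exp (-κ x²)` on the line. -/
noncomputable def gauss (κ x : ℝ) : ℝ := √(κ / Real.pi) * Real.exp (-κ * x ^ 2)

/-- The centred Gaussian density with the same parameter on `ℝ³`. -/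
noncomputable def gauss₃ (κ : ℝ) (x : Vel) : ℝ :=
  √(κ / Real.pi) ^ 3 * Real.exp (-κ * ‖x‖ ^ 2)

lemma gauss_nonneg (κ x : ℝ) : 0 ≤ gauss κ x := by unfold gauss; positivity

lemma gauss_neg (κ x : ℝ) : gauss κ (-x) = gauss κ x := by unfold gauss; rw [neg_sq]

lemma continuous_gauss (κ : ℝ) : Continuous (gauss κ) := by unfold gauss; fun_prop

lemma continuous_gauss₃ (κ : ℝ) : Continuous (gauss₃ κ) := by unfold gauss₃; fun_prop

lemma lintegral_gauss_sub {κ : ℝ} (hκ : 0 < κ) (x : ℝ) :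
    ∫⁻ r, ENNReal.ofReal (gauss κ (x - r)) = 1 := by
  rw [lintegral_sub_left_eq_self (fun r => ENNReal.ofReal (gauss κ r)) x,
    ← ofReal_integral_eq_lintegral_ofReal]
  · unfold gauss
    rw [integral_const_mul, integral_gaussian, ← Real.sqrt_mul (by positivity)]
    have : κ / Real.pi * (Real.pi / κ) = 1 := by field_simp
    rw [this, Real.sqrt_one, ENNReal.ofReal_one]
  · exact (integrable_exp_neg_mul_sq hκ).const_mul _
  · exact Eventually.of_forall fun r => gauss_nonneg κ r

/-- Cartesian coordinates along an orthonormal basis. -/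
lemma lintegral_eq_lintegral_orthonormalBasis (e : OrthonormalBasis (Fin 3) ℝ Vel)
    {H : Vel → ENNReal} (hH : Measurable H) :
    ∫⁻ q, H q = ∫⁻ r : ℝ, ∫⁻ y : ℝ, ∫⁻ z : ℝ, H (r • e 0 + y • e 1 + z • e 2) := by
  have h1 := e.measurePreserving_repr_symm.comp (PiLp.volume_preserving_toLp (Fin 3))
  have h2 := (volume_preserving_piFinSuccAbove (fun _ : Fin 3 => ℝ) 0).symm
  have h3 := h1.comp h2
  have h4 := (volume_preserving_finTwoArrow ℝ).symm
  have hm := hH.comp h3.measurable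
  rw [← h3.lintegral_comp hH, Measure.volume_eq_prod]
  refine (lintegral_prod _ hm.aemeasurable).trans (lintegral_congr fun r => ?_)
  have hm2 := hm.comp (measurable_prodMk_left (x := r))
  refine (h4.lintegral_comp hm2).symm.trans ?_
  rw [Measure.volume_eq_prod]
  refine (lintegral_prod _ ?_).trans ?_
  · exact (hm2.comp h4.measurable).aemeasurable
  · refine lintegral_congr fun y => lintegral_congr fun z => ?_
    change H (e.repr.symm (WithLp.toLp 2 ((MeasurableEquiv.piFinSuccAbove (fun _ : Fin 3 => ℝ) 0).symm
      (r, MeasurableEquiv.finTwoArrow.symm (y, z))))) = _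
    congr 1
    rw [← e.sum_repr (r • e 0 + y • e 1 + z • e 2), ← e.sum_repr (e.repr.symm _)]
    simp [Fin.sum_univ_three, MeasurableEquiv.piFinSuccAbove, MeasurableEquiv.finTwoArrow]

lemma exists_orthonormalBasis_zero_eq {n : Vel} (hn : ‖n‖ = 1) :
    ∃ e : OrthonormalBasis (Fin 3) ℝ Vel, e 0 = n := by
  obtain ⟨e, he⟩ := Orthonormal.exists_orthonormalBasis_extension_of_card_eq (𝕜 := ℝ) (E := Vel)
    (ι := Fin 3) (by simp) (v := fun _ => n) (s := {0}) (by
      refine ⟨fun i => hn, fun i j hij => ?_⟩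
      exact absurd (Subsingleton.elim i j) hij)
  exact ⟨e, he 0 rfl⟩

/-- Only the component of the relative velocity `q` along the direction `n` of impact matters: the
Gaussian integrals over the two orthogonal components are equal to `1`. -/
lemma lintegral_gauss₃_slice {κ : ℝ} (hκ : 0 < κ) {n : Vel} (hn : ‖n‖ = 1) (y : Vel) (b : ℝ)
    {Ψ : ℝ → ENNReal} (hΨ : Measurable Ψ) :
    ∫⁻ q : Vel, Ψ (inner ℝ q n) *
        ENNReal.ofReal (gauss₃ κ (y - q + (b * inner ℝ q n) • n))
      = ∫⁻ r, Ψ r * ENNReal.ofReal (gauss κ (inner ℝ y n - (1 - b) * r)) := by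
  obtain ⟨e, rfl⟩ := exists_orthonormalBasis_zero_eq hn
  have hm : Measurable fun q : Vel => Ψ (inner ℝ q (e 0)) *
      ENNReal.ofReal (gauss₃ κ (y - q + (b * inner ℝ q (e 0)) • e 0)) := by
    refine (hΨ.comp (by fun_prop)).mul (ENNReal.measurable_ofReal.comp
      ((continuous_gauss₃ κ).measurable.comp (by fun_prop)))
  rw [lintegral_eq_lintegral_orthonormalBasis e hm]
  refine lintegral_congr fun r => ?_
  have hin : ∀ s z : ℝ, inner ℝ (r • e 0 + s • e 1 + z • e 2) (e 0) = r := fun s z => by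
    simp [inner_add_left, inner_smul_left, e.inner_eq_ite]
  have hg : ∀ s z : ℝ, gauss₃ κ (y - (r • e 0 + s • e 1 + z • e 2) + (b * r) • e 0)
      = gauss κ (inner ℝ y (e 0) - (1 - b) * r) * gauss κ (inner ℝ y (e 1) - s)
        * gauss κ (inner ℝ y (e 2) - z) := fun s z => by
    have hnorm : ‖y - (r • e 0 + s • e 1 + z • e 2) + (b * r) • e 0‖ ^ 2
        = (inner ℝ y (e 0) - (1 - b) * r) ^ 2 + (inner ℝ y (e 1) - s) ^ 2
          + (inner ℝ y (e 2) - z) ^ 2 := by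
      rw [← e.repr.norm_map, EuclideanSpace.norm_sq_eq, Fin.sum_univ_three]
      simp only [e.repr_apply_apply, inner_add_right, inner_sub_right, inner_smul_right,
        e.inner_eq_ite, Real.norm_eq_abs, sq_abs, real_inner_comm]
      simp
      ring
    unfold gauss₃ gauss
    rw [hnorm, mul_add, mul_add, Real.exp_add, Real.exp_add]
    ring
  simp only [hin, hg]
  have h0 : ∀ s z : ℝ, ENNReal.ofReal (gauss κ (inner ℝ y (e 0) - (1 - b) * r) *
      gauss κ (inner ℝ y (e 1) - s) * gauss κ (inner ℝ y (e 2) - z))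
      = ENNReal.ofReal (gauss κ (inner ℝ y (e 0) - (1 - b) * r)) *
        ENNReal.ofReal (gauss κ (inner ℝ y (e 1) - s)) *
        ENNReal.ofReal (gauss κ (inner ℝ y (e 2) - z)) := fun s z => by
    rw [ENNReal.ofReal_mul (mul_nonneg (gauss_nonneg _ _) (gauss_nonneg _ _)),
      ENNReal.ofReal_mul (gauss_nonneg _ _)]
  have hgm : ∀ x : ℝ, Measurable fun z : ℝ => ENNReal.ofReal (gauss κ (x - z)) := fun x =>
    ENNReal.measurable_ofReal.comp ((continuous_gauss κ).measurable.comp (by fun_prop))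
  simp only [h0, ← mul_assoc]
  calc _ = ∫⁻ s, Ψ r * ENNReal.ofReal (gauss κ (inner ℝ y (e 0) - (1 - b) * r)) *
        ENNReal.ofReal (gauss κ (inner ℝ y (e 1) - s)) := by
        refine lintegral_congr fun s => ?_
        rw [lintegral_const_mul _ (hgm _), lintegral_gauss_sub hκ, mul_one]
    _ = _ := by rw [lintegral_const_mul _ (hgm _), lintegral_gauss_sub hκ, mul_one]

/-- Polar coordinates in `ℝ³`. -/
lemma lintegral_sphere_lintegral_Ioi {H : Vel → ENNReal} (hH : Measurable H) :
    ∫⁻ n : Sph, (∫⁻ s in Ioi (0 : ℝ), ENNReal.ofReal (s ^ 2) * H (s • (n : Vel)))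
      ∂(volume : Measure Vel).toSphere = ∫⁻ q, H q := by
  have hdim : Module.finrank ℝ Vel - 1 = 2 := by simp
  have hmp := (volume : Measure Vel).measurePreserving_homeomorphUnitSphereProd
  rw [hdim] at hmp
  have h1 : ∫⁻ q, H q = ∫⁻ x : ({(0 : Vel)}ᶜ : Set Vel), H x ∂(volume.comap Subtype.val) := by
    rw [lintegral_subtype_comap (measurableSet_singleton _).compl, restrict_compl_singleton]
  have hm : Measurable fun p : Sph × Ioi (0 : ℝ) => H ((p.2 : ℝ) • (p.1 : Vel)) :=
    hH.comp (by fun_prop)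
  have h2 := hmp.lintegral_comp hm
  have h3 : ∀ x : ({(0 : Vel)}ᶜ : Set Vel), H (((homeomorphUnitSphereProd Vel x).2 : ℝ) •
      ((homeomorphUnitSphereProd Vel x).1 : Vel)) = H x := fun x => by
    congr 1
    have hx : ‖(x : Vel)‖ ≠ 0 := norm_ne_zero_iff.2 x.2
    simp [smul_smul, hx]
  simp only [h3] at h2
  rw [h1, h2, lintegral_prod _ hm.aemeasurable]
  refine lintegral_congr fun n => ?_
  have hm2 : Measurable fun s : Ioi (0 : ℝ) => H ((s : ℝ) • (n : Vel)) := hH.comp (by fun_prop)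
  rw [Measure.volumeIoiPow]
  refine Eq.trans ?_ (lintegral_withDensity_eq_lintegral_mul _ (by fun_prop) hm2).symm
  exact (lintegral_subtype_comap measurableSet_Ioi
    fun s : ℝ => ENNReal.ofReal (s ^ 2) * H (s • (n : Vel))).symm

end Slicing

/-! ### Change of variables in the collision integral -/

section Carleman

open Filter Topology

lemma lintegral_comp_const_mul {a : ℝ} (ha : 0 < a) {f : ℝ → ENNReal} (hf : Measurable f) :
    ∫⁻ r, f r = ∫⁻ s, ENNReal.ofReal a⁻¹ * f (a⁻¹ * s) := by
  conv_lhs => rw [← Real.smul_map_volume_mul_left (inv_ne_zero ha.ne')]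
  rw [lintegral_smul_measure, lintegral_map hf (measurable_const_mul _),
    abs_of_pos (inv_pos.2 ha), lintegral_const_mul' _ _ ENNReal.ofReal_ne_top, smul_eq_mul]

lemma lintegral_eq_add_Ioi {f : ℝ → ENNReal} (hf : Measurable f) :
    ∫⁻ r, f r = ∫⁻ r in Ioi (0 : ℝ), (f r + f (-r)) := by
  rw [lintegral_add_left hf, ← lintegral_add_compl f (measurableSet_Ioi (a := (0 : ℝ))), compl_Ioi,
    ← restrict_Iio_eq_restrict_Iic]
  congr 1
  have h := (Measure.measurePreserving_neg (volume : Measure ℝ)).setLIntegral_comp_preimage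
    (measurableSet_Iio (a := (0 : ℝ))) hf
  rw [← h]
  congr 2
  ext x
  simp

/-- Integrals over the field velocity `w` and the direction `n` of impact, rewritten as integrals
over the velocity `v' = v - a (q · n) n` with `q = v - w`. For fixed `n` the components of `q`
orthogonal to `n` are integrated out; the remaining variable `s = a (q · n)` and `n` are the polar
coordinates of `v - v'`, each point being met twice because `s` takes both signs. -/
lemma lintegral_collision {κ a : ℝ} (hκ : 0 < κ) (ha : 0 < a) (b : ℝ) (v u : Vel)
    {F : Vel → ENNReal} (hF : Measurable F) :
    ∫⁻ p : Vel × Sph, ENNReal.ofReal (|inner ℝ (v - p.1) (p.2 : Vel)| *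
        gauss₃ κ (p.1 + (b * inner ℝ (v - p.1) (p.2 : Vel)) • (p.2 : Vel) - u)) *
        F (v - (a * inner ℝ (v - p.1) (p.2 : Vel)) • (p.2 : Vel)) ∂Params.collisionMeasure
      = ∫⁻ v', ENNReal.ofReal (2 * a⁻¹ ^ 2 * ‖v - v'‖⁻¹ *
        gauss κ (inner ℝ (v - v') (v - u) / ‖v - v'‖ - (1 - b) / a * ‖v - v'‖)) * F v' := by
  have hg := (continuous_gauss κ).measurable
  have hg3 := (continuous_gauss₃ κ).measurable
  have hm : Measurable fun p : Vel × Sph => ENNReal.ofReal (|inner ℝ (v - p.1) (p.2 : Vel)| *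
        gauss₃ κ (p.1 + (b * inner ℝ (v - p.1) (p.2 : Vel)) • (p.2 : Vel) - u)) *
        F (v - (a * inner ℝ (v - p.1) (p.2 : Vel)) • (p.2 : Vel)) := by
    have h1 : Continuous fun p : Vel × Sph => (inner ℝ (v - p.1) (p.2 : Vel) : ℝ) := by fun_prop
    have h2 : Continuous fun p : Vel × Sph =>
        p.1 + (b * inner ℝ (v - p.1) (p.2 : Vel)) • (p.2 : Vel) - u := by fun_prop
    have h3 : Continuous fun p : Vel × Sph =>
        v - (a * inner ℝ (v - p.1) (p.2 : Vel)) • (p.2 : Vel) := by fun_prop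
    exact (h1.abs.measurable.mul (hg3.comp h2.measurable)).ennreal_ofReal.mul
      (hF.comp h3.measurable)
  -- the integrand of the polar representation, as a function of `q = v - v'`
  set H : Vel → ENNReal := fun q => ENNReal.ofReal (a⁻¹ ^ 2 * ‖q‖⁻¹ *
    gauss κ (inner ℝ q (v - u) / ‖q‖ - (1 - b) / a * ‖q‖)) * F (v - q) with hH
  have hHm : Measurable H := by
    refine Measurable.mul (Measurable.ennreal_ofReal ?_) (hF.comp (by fun_prop))
    exact (measurable_const.mul measurable_norm.inv).mul (hg.comp
      (((by fun_prop : Measurable fun q : Vel => (inner ℝ q (v - u) : ℝ)).div measurable_norm).sub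
        (measurable_const.mul measurable_norm)))
  set Θ : Sph → ℝ → ENNReal := fun n r => ENNReal.ofReal |r| * F (v - (a * r) • (n : Vel)) *
    ENNReal.ofReal (gauss κ (inner ℝ (v - u) (n : Vel) - (1 - b) * r)) with hΘ
  have hΘm : ∀ n, Measurable (Θ n) := fun n => by
    have h1 : Continuous fun r : ℝ => v - (a * r) • (n : Vel) := by fun_prop
    exact ((by fun_prop : Measurable fun r : ℝ => ENNReal.ofReal |r|).mul
      (hF.comp h1.measurable)).mul (hg.comp (by fun_prop)).ennreal_ofReal
  have hslice : ∀ n : Sph, ∫⁻ w : Vel, ENNReal.ofReal (|inner ℝ (v - w) (n : Vel)| *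
        gauss₃ κ (w + (b * inner ℝ (v - w) (n : Vel)) • (n : Vel) - u)) *
        F (v - (a * inner ℝ (v - w) (n : Vel)) • (n : Vel)) = ∫⁻ r, Θ n r := by
    intro n
    have hn : ‖(n : Vel)‖ = 1 := by simp
    have h1 := lintegral_gauss₃_slice hκ hn (v - u) b
      (Ψ := fun r => ENNReal.ofReal |r| * F (v - (a * r) • (n : Vel)))
      ((by fun_prop : Measurable fun r : ℝ => ENNReal.ofReal |r|).mul
        (hF.comp (by fun_prop : Continuous fun r : ℝ => v - (a * r) • (n : Vel)).measurable))
    rw [← lintegral_sub_left_eq_self _ v, ← h1]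
    refine lintegral_congr fun q => ?_
    rw [sub_sub_cancel, ENNReal.ofReal_mul (abs_nonneg _),
      show v - q + (b * inner ℝ q (n : Vel)) • (n : Vel) - u
        = v - u - q + (b * inner ℝ q (n : Vel)) • (n : Vel) by abel]
    ring
  have hpolar : ∀ n : Sph, ∫⁻ r, Θ n r = ∫⁻ s in Ioi (0 : ℝ),
      (ENNReal.ofReal (s ^ 2) * H (s • (n : Vel))
        + ENNReal.ofReal (s ^ 2) * H (-(s • (n : Vel)))) := by
    intro n
    have hn : ‖(n : Vel)‖ = 1 := by simp
    rw [lintegral_comp_const_mul ha (hΘm n), lintegral_eq_add_Ioi (by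
      exact measurable_const.mul ((hΘm n).comp (measurable_const_mul _)))]
    refine setLIntegral_congr_fun measurableSet_Ioi fun s hs => ?_
    have hs' : 0 < s := hs
    have hns : ‖s • (n : Vel)‖ = s := by rw [norm_smul, hn, mul_one, Real.norm_of_nonneg hs'.le]
    have hin : inner ℝ (s • (n : Vel)) (v - u) / s = inner ℝ (v - u) (n : Vel) := by
      rw [inner_smul_left, real_inner_comm]
      simp
      field_simp
    have harg1 : inner ℝ (v - u) (n : Vel) - (1 - b) * (a⁻¹ * s)
        = inner ℝ (v - u) (n : Vel) - (1 - b) / a * s := by ring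
    have harg2 : inner ℝ (v - u) (n : Vel) - -((1 - b) * (a⁻¹ * s))
        = -(-inner ℝ (v - u) (n : Vel) - (1 - b) / a * s) := by ring
    have hcoef : ∀ x : ℝ, 0 ≤ x → ENNReal.ofReal (s ^ 2) * ENNReal.ofReal (a⁻¹ ^ 2 * s⁻¹ * x)
        = ENNReal.ofReal a⁻¹ * (ENNReal.ofReal (a⁻¹ * s) * ENNReal.ofReal x) := fun x hx => by
      rw [← ENNReal.ofReal_mul (by positivity), ← ENNReal.ofReal_mul (by positivity),
        ← ENNReal.ofReal_mul (by positivity)]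
      congr 1
      field_simp
    simp only [hΘ, hH, norm_neg, inner_neg_left, neg_div, hns, hin, harg1, harg2, gauss_neg,
      mul_neg, abs_neg, neg_smul]
    rw [abs_of_pos (by positivity : 0 < a⁻¹ * s), ← mul_assoc a a⁻¹ s, mul_inv_cancel₀ ha.ne',
      one_mul, ← mul_assoc (ENNReal.ofReal (s ^ 2)), ← mul_assoc (ENNReal.ofReal (s ^ 2)),
      hcoef _ (gauss_nonneg _ _), hcoef _ (gauss_nonneg _ _)]
    ring
  have hHn : Measurable fun q => H (-q) := hHm.comp measurable_neg
  rw [Params.collisionMeasure, lintegral_prod_symm _ hm.aemeasurable]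
  simp only [hslice, hpolar]
  have hinner : ∀ n : Sph, ∫⁻ s in Ioi (0 : ℝ),
      (ENNReal.ofReal (s ^ 2) * H (s • (n : Vel))
        + ENNReal.ofReal (s ^ 2) * H (-(s • (n : Vel))))
      = ∫⁻ s in Ioi (0 : ℝ), ENNReal.ofReal (s ^ 2) * (H (s • (n : Vel)) + H (-(s • (n : Vel)))) :=
    fun n => lintegral_congr fun s => (mul_add _ _ _).symm
  simp only [hinner]
  rw [lintegral_sphere_lintegral_Ioi (H := fun q => H q + H (-q)) (hHm.add hHn),
    lintegral_add_left hHm,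
    (Measure.measurePreserving_neg (volume : Measure Vel)).lintegral_comp hHm, ← two_mul,
    ← lintegral_const_mul _ hHm, ← lintegral_sub_left_eq_self (fun q => 2 * H q) v]
  refine lintegral_congr fun v' => ?_
  simp only [hH]
  rw [sub_sub_cancel, mul_assoc 2, mul_assoc 2, ENNReal.ofReal_mul zero_le_two,
    ENNReal.ofReal_ofNat, mul_assoc]
  exact (mul_assoc _ _ _).symm

end Carleman

/-! ### The kernel of the gain operator -/

namespace Params

open Filter Topology

variable (P : Params)

/-- The Gaussian parameter of the host fluid: `𝓜₁(w)` is proportional to `exp (-κ |w - u₁|²)`. -/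
noncomputable def κ : ℝ := P.m₁ / (2 * P.ϑ₁)

/-- The Gaussian parameter of the equilibrium: `𝓜(v)` is proportional to `exp (-η |v - u₁|²)`. -/
noncomputable def η : ℝ := P.m / (2 * P.ϑsharp)

/-- The factor `2 α (1 - β) = α (1 + ε)` by which a collision changes the velocity of a test
particle: the post-collisional velocity is `v - c (q · n) n`. -/
noncomputable def c : ℝ := 2 * P.α * (1 - P.β)

/-- The constant `c⁻¹ - 1/2`, which relates the two Gaussian parameters by `η = 2 d κ`. -/
noncomputable def d : ℝ := P.c⁻¹ - 1 / 2

lemma κ_pos : 0 < P.κ := div_pos P.m₁_pos (by linarith [P.ϑ₁_pos])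

lemma η_pos : 0 < P.η := div_pos P.m_pos (by linarith [P.ϑsharp_pos])

lemma one_sub_two_mul_β : 1 - 2 * P.β = P.ε := by unfold β; ring

lemma one_sub_β_pos : 0 < 1 - P.β := by unfold β; linarith [P.ε_pos]

lemma one_sub_β_lt_one : 1 - P.β < 1 := by unfold β; linarith [P.ε_lt_one]

lemma c_pos : 0 < P.c := by
  have := P.α_pos
  have := P.one_sub_β_pos
  unfold c
  positivity

lemma c_lt_two : P.c < 2 := by
  have := P.α_pos
  have := P.α_lt_one
  have := P.one_sub_β_pos
  have := P.one_sub_β_lt_one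
  unfold c
  nlinarith

lemma d_pos : 0 < P.d := by
  have h := inv_strictAnti₀ P.c_pos P.c_lt_two
  unfold d
  linarith

lemma η_eq : P.η = 2 * P.d * P.κ := by
  have h1 := P.α_pos
  have h2 := P.α_lt_one
  have h3 := P.one_sub_β_pos
  have h4 := P.one_sub_β_lt_one
  have h5 := P.m_pos
  have h6 := P.m₁_pos
  have h7 := P.ϑ₁_pos
  have h8 : 0 < 1 - P.α * (1 - P.β) := by nlinarith
  have h9 : 0 < 1 - P.α := by linarith
  have h10 : P.α * P.m = P.m₁ * (1 - P.α) := by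
    unfold α
    field_simp
    ring
  unfold η d κ c ϑsharp
  generalize 1 - P.β = b at *
  field_simp
  linear_combination h10

lemma rpow_three_halves {x : ℝ} (hx : 0 ≤ x) : x ^ (3 / 2 : ℝ) = √x ^ 3 := by
  rw [Real.sqrt_eq_rpow, ← Real.rpow_natCast, ← Real.rpow_mul hx]
  norm_num

lemma maxwellian₁_eq (v : Vel) : P.maxwellian₁ v = gauss₃ P.κ (v - P.u₁) := by
  have h6 := P.m₁_pos
  have h7 := P.ϑ₁_pos
  have hpi := Real.pi_pos
  unfold maxwellian₁ gauss₃
  rw [rpow_three_halves (by positivity)]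
  have h1 : P.m₁ / (2 * Real.pi * P.ϑ₁) = P.κ / Real.pi := by
    unfold κ
    field_simp
  have h2 : -(P.m₁ * ‖v - P.u₁‖ ^ 2) / (2 * P.ϑ₁) = -P.κ * ‖v - P.u₁‖ ^ 2 := by
    unfold κ
    ring
  rw [h1, h2]

lemma maxwellian_eq (v : Vel) : P.maxwellian v = gauss₃ P.η (v - P.u₁) := by
  have h6 := P.m_pos
  have h7 := P.ϑsharp_pos
  have hpi := Real.pi_pos
  unfold maxwellian gauss₃
  rw [rpow_three_halves (by positivity)]
  have h1 : P.m / (2 * Real.pi * P.ϑsharp) = P.η / Real.pi := by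
    unfold η
    field_simp
  have h2 : -(P.m * ‖v - P.u₁‖ ^ 2) / (2 * P.ϑsharp) = -P.η * ‖v - P.u₁‖ ^ 2 := by
    unfold η
    ring
  rw [h1, h2]

/-- The part `G` of the collision kernel which remains after the symmetrisation by `𝓜^(1/2)`. It
depends on `ρ = |v - v'|` and on `A = (|v - u₁|² - |v' - u₁|²) / (2ρ)`, the component of
`(v + v') / 2 - u₁` along `v - v'`, and is symmetric in `v` and `v'`. -/
noncomputable def symmKernel (v v' : Vel) : ℝ :=
  2 * P.c⁻¹ ^ 2 * ‖v - v'‖⁻¹ * (√(P.κ / Real.pi) *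
    Real.exp (-P.κ * (((‖v - P.u₁‖ ^ 2 - ‖v' - P.u₁‖ ^ 2) / (2 * ‖v - v'‖)) ^ 2
      + P.d ^ 2 * ‖v - v'‖ ^ 2)))

/-- The square root of the equilibrium, up to a constant. -/
noncomputable def halfMaxwellian (v : Vel) : ℝ := Real.exp (-(P.η / 2) * ‖v - P.u₁‖ ^ 2)

/-- The kernel of the gain operator with respect to the measure `𝓜⁻¹(v) dv`. -/
noncomputable def kernel (v v' : Vel) : ℝ :=
  √(P.η / Real.pi) ^ 3 * P.halfMaxwellian v * P.halfMaxwellian v' * P.symmKernel v v'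

lemma halfMaxwellian_pos (v : Vel) : 0 < P.halfMaxwellian v := Real.exp_pos _

lemma maxwellian_eq_half_sq (v : Vel) :
    P.maxwellian v = √(P.η / Real.pi) ^ 3 * P.halfMaxwellian v ^ 2 := by
  rw [maxwellian_eq, gauss₃, halfMaxwellian, ← Real.exp_nat_mul]
  congr 2
  push_cast
  ring

lemma symmKernel_nonneg (v v' : Vel) : 0 ≤ P.symmKernel v v' := by
  have := P.c_pos
  unfold symmKernel
  positivity

lemma symmKernel_comm (v v' : Vel) : P.symmKernel v v' = P.symmKernel v' v := by
  unfold symmKernel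
  rw [norm_sub_rev v' v, ← neg_sub (‖v - P.u₁‖ ^ 2), neg_div, neg_sq]

lemma symmKernel_pos {v v' : Vel} (h : v ≠ v') : 0 < P.symmKernel v v' := by
  have := P.c_pos
  have := P.κ_pos
  have := Real.pi_pos
  have : 0 < ‖v - v'‖ := norm_pos_iff.2 (sub_ne_zero.2 h)
  unfold symmKernel
  positivity

lemma sqrt_η_pos : 0 < √(P.η / Real.pi) := Real.sqrt_pos.2 (div_pos P.η_pos Real.pi_pos)

lemma kernel_nonneg (v v' : Vel) : 0 ≤ P.kernel v v' := by
  have := P.halfMaxwellian_pos v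
  have := P.halfMaxwellian_pos v'
  have := P.symmKernel_nonneg v v'
  unfold kernel
  positivity

lemma kernel_comm (v v' : Vel) : P.kernel v v' = P.kernel v' v := by
  unfold kernel
  rw [P.symmKernel_comm]
  ring

lemma kernel_pos {v v' : Vel} (h : v ≠ v') : 0 < P.kernel v v' := by
  have := P.halfMaxwellian_pos v
  have := P.halfMaxwellian_pos v'
  have := P.symmKernel_pos h
  have := P.sqrt_η_pos
  unfold kernel
  positivity

lemma measurable_symmKernel : Measurable fun p : Vel × Vel => P.symmKernel p.1 p.2 := by
  unfold symmKernel
  have h1 : Measurable fun p : Vel × Vel => ‖p.1 - p.2‖ := by fun_prop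
  have h2 : Measurable fun p : Vel × Vel => ‖p.1 - P.u₁‖ ^ 2 - ‖p.2 - P.u₁‖ ^ 2 := by fun_prop
  exact (measurable_const.mul h1.inv).mul (measurable_const.mul (Real.measurable_exp.comp
    (measurable_const.mul (((h2.div (measurable_const.mul h1)).pow_const 2).add
      (measurable_const.mul (h1.pow_const 2))))))

lemma continuous_halfMaxwellian : Continuous P.halfMaxwellian := by
  unfold halfMaxwellian
  fun_prop

lemma measurable_kernel : Measurable (Function.uncurry P.kernel) := by
  have h := P.continuous_halfMaxwellian.measurable
  exact ((measurable_const.mul (h.comp measurable_fst)).mul (h.comp measurable_snd)).mul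
    P.measurable_symmKernel

/-- The two conditional forms of the kernel. With `ρ = |v - v'|` and `A` as in `symmKernel`, the
component of `v - u₁` along `v - v'` is `A + ρ / 2`; the Gaussian in `A ± d ρ` differs from that in
`A² + d² ρ²` by the factor `exp (∓ 2 κ d A ρ) = (𝓜(v) / 𝓜(v'))^(± 1/2)`, because `η = 2 d κ`. -/
lemma kernel_div_eq (v v' : Vel) :
    P.kernel v v' * (P.maxwellian v')⁻¹ = 2 * P.c⁻¹ ^ 2 * ‖v - v'‖⁻¹ *
      gauss P.κ (inner ℝ (v - v') (v - P.u₁) / ‖v - v'‖ - (1 - P.c⁻¹) * ‖v - v'‖) ∧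
    P.kernel v v' * (P.maxwellian v)⁻¹ = 2 * P.c⁻¹ ^ 2 * ‖v - v'‖⁻¹ *
      gauss P.κ (inner ℝ (v - v') (v - P.u₁) / ‖v - v'‖ - P.c⁻¹ * ‖v - v'‖) := by
  have hN := P.sqrt_η_pos
  have hψ := P.halfMaxwellian_pos v
  have hψ' := P.halfMaxwellian_pos v'
  rcases eq_or_ne v v' with rfl | hne
  · simp [kernel, symmKernel]
  have hρ : 0 < ‖v - v'‖ := norm_pos_iff.2 (sub_ne_zero.2 hne)
  have hin : inner ℝ (v - v') (v - P.u₁)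
      = (‖v - P.u₁‖ ^ 2 - ‖v' - P.u₁‖ ^ 2 + ‖v - v'‖ ^ 2) / 2 := by
    have h1 : v' - P.u₁ = (v - P.u₁) - (v - v') := by abel
    have h2 := norm_sub_sq_real (v - P.u₁) (v - v')
    rw [← h1, real_inner_comm] at h2
    linarith
  have hη := P.η_eq
  rw [maxwellian_eq_half_sq, maxwellian_eq_half_sq, hin]
  unfold kernel symmKernel gauss
  set ρ := ‖v - v'‖
  set X := ‖v - P.u₁‖ ^ 2
  set X' := ‖v' - P.u₁‖ ^ 2
  have hX : P.halfMaxwellian v = Real.exp (-(P.d * P.κ) * X) := by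
    unfold halfMaxwellian; rw [hη]; congr 1; ring
  have hX' : P.halfMaxwellian v' = Real.exp (-(P.d * P.κ) * X') := by
    unfold halfMaxwellian; rw [hη]; congr 1; ring
  have hd : P.c⁻¹ = P.d + 1 / 2 := by unfold d; ring
  constructor
  · have h1 : √(P.η / Real.pi) ^ 3 * P.halfMaxwellian v * P.halfMaxwellian v' *
        (2 * P.c⁻¹ ^ 2 * ρ⁻¹ * (√(P.κ / Real.pi) *
        Real.exp (-P.κ * (((X - X') / (2 * ρ)) ^ 2 + P.d ^ 2 * ρ ^ 2)))) *
        (√(P.η / Real.pi) ^ 3 * P.halfMaxwellian v' ^ 2)⁻¹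
        = 2 * P.c⁻¹ ^ 2 * ρ⁻¹ * (√(P.κ / Real.pi) * (P.halfMaxwellian v *
          Real.exp (-P.κ * (((X - X') / (2 * ρ)) ^ 2 + P.d ^ 2 * ρ ^ 2)) /
          P.halfMaxwellian v')) := by
      field_simp
    rw [h1, hX, hX', ← Real.exp_add, ← Real.exp_sub]
    congr 3
    rw [hd]
    field_simp
    ring
  · have h1 : √(P.η / Real.pi) ^ 3 * P.halfMaxwellian v * P.halfMaxwellian v' *
        (2 * P.c⁻¹ ^ 2 * ρ⁻¹ * (√(P.κ / Real.pi) *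
        Real.exp (-P.κ * (((X - X') / (2 * ρ)) ^ 2 + P.d ^ 2 * ρ ^ 2)))) *
        (√(P.η / Real.pi) ^ 3 * P.halfMaxwellian v ^ 2)⁻¹
        = 2 * P.c⁻¹ ^ 2 * ρ⁻¹ * (√(P.κ / Real.pi) * (P.halfMaxwellian v' *
          Real.exp (-P.κ * (((X - X') / (2 * ρ)) ^ 2 + P.d ^ 2 * ρ ^ 2)) /
          P.halfMaxwellian v)) := by
      field_simp
    rw [h1, hX, hX', ← Real.exp_add, ← Real.exp_sub]
    congr 3
    rw [hd]
    field_simp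
    ring

lemma maxwellian₁_nonneg (v : Vel) : 0 ≤ P.maxwellian₁ v := by
  rw [maxwellian₁_eq, gauss₃]
  positivity

lemma continuous_maxwellian₁ : Continuous P.maxwellian₁ := by
  have : P.maxwellian₁ = fun v => gauss₃ P.κ (v - P.u₁) := funext P.maxwellian₁_eq
  rw [this]
  exact (continuous_gauss₃ _).comp (continuous_id.sub continuous_const)

lemma lintegral_collisionFrequency (v : Vel) :
    ∫⁻ p : Vel × Sph, ENNReal.ofReal (|inner ℝ (v - p.1) (p.2 : Vel)| * P.maxwellian₁ p.1)
      ∂collisionMeasure = ∫⁻ v', ENNReal.ofReal (P.kernel v v' * (P.maxwellian v)⁻¹) := by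
  have h := lintegral_collision P.κ_pos P.c_pos 0 v P.u₁ (F := fun _ => 1) measurable_const
  simp only [mul_one, zero_mul, zero_smul, add_zero, sub_zero, one_div] at h
  simp only [maxwellian₁_eq, (P.kernel_div_eq v _).2]
  exact h

lemma lintegral_gain (v : Vel) {F : Vel → ENNReal} (hF : Measurable F) :
    ∫⁻ p : Vel × Sph, ENNReal.ofReal (|inner ℝ (v - p.1) (p.2 : Vel)| *
        P.maxwellian₁ (P.preW v p.1 p.2)) * F (P.preV v p.1 p.2) ∂collisionMeasure
      = ∫⁻ v', ENNReal.ofReal (P.ε ^ 2 * (P.kernel v v' * (P.maxwellian v')⁻¹)) * F v' := by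
  have hε := P.ε_pos
  have hb := P.one_sub_β_pos
  have hα := P.α_pos
  have h := lintegral_collision P.κ_pos
    (a := 2 * P.α * ((1 - P.β) / (1 - 2 * P.β))) (by
      rw [one_sub_two_mul_β]; positivity)
    (2 * (1 - P.α) * ((1 - P.β) / (1 - 2 * P.β))) v P.u₁ hF
  have ha : 2 * P.α * ((1 - P.β) / (1 - 2 * P.β)) = P.c / P.ε := by
    rw [one_sub_two_mul_β, c]; ring
  have hc := P.c_pos
  have hab : (1 - 2 * (1 - P.α) * ((1 - P.β) / (1 - 2 * P.β))) /
      (2 * P.α * ((1 - P.β) / (1 - 2 * P.β))) = 1 - P.c⁻¹ := by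
    rw [ha, one_sub_two_mul_β, c]
    have h2 : P.β = (1 - P.ε) / 2 := rfl
    rw [h2]
    have h3 : 0 < 1 + P.ε := by linarith
    have h4 : 1 - (1 - P.ε) / 2 = (1 + P.ε) / 2 := by ring
    rw [h4]
    field_simp
    ring
  rw [hab] at h
  simp only [maxwellian₁_eq, preW, preV, (P.kernel_div_eq v _).1]
  refine h.trans (lintegral_congr fun v' => ?_)
  rw [ha]
  congr 2
  field_simp

/-- A change of variables for nonnegative functions holds for the Bochner integral, too. -/
lemma integral_mul_comp_eq {X Y : Type*} [MeasurableSpace X] [MeasurableSpace Y] {μ : Measure X}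
    {ν : Measure Y} {w : X → ℝ} {k : Y → ℝ} {T : X → Y} (hw : Measurable w) (hw0 : ∀ p, 0 ≤ w p)
    (hk : Measurable k) (hk0 : ∀ y, 0 ≤ k y) (hT : Measurable T)
    (h : ∀ F : Y → ENNReal, Measurable F →
      ∫⁻ p, ENNReal.ofReal (w p) * F (T p) ∂μ = ∫⁻ y, ENNReal.ofReal (k y) * F y ∂ν)
    {f : Y → ℂ} (hf : StronglyMeasurable f) :
    ∫ p, (w p : ℂ) * f (T p) ∂μ = ∫ y, (k y : ℂ) * f y ∂ν := by
  have hmap : (μ.withDensity fun p => ENNReal.ofReal (w p)).map T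
      = ν.withDensity fun y => ENNReal.ofReal (k y) := by
    refine Measure.ext_of_lintegral _ fun F hF => ?_
    rw [lintegral_map hF hT, lintegral_withDensity_eq_lintegral_mul _ hw.ennreal_ofReal
      (show Measurable fun p => F (T p) from hF.comp hT), lintegral_withDensity_eq_lintegral_mul _ hk.ennreal_ofReal hF]
    exact h F hF
  calc _ = ∫ p, f (T p) ∂(μ.withDensity fun p => ENNReal.ofReal (w p)) := by
        rw [integral_withDensity_eq_integral_toReal_smul hw.ennreal_ofReal (by simp)]
        refine integral_congr_ae (Eventually.of_forall fun p => ?_)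
        simp only
        rw [ENNReal.toReal_ofReal (hw0 p), Complex.real_smul]
    _ = ∫ y, f y ∂(ν.withDensity fun y => ENNReal.ofReal (k y)) := by
        rw [← hmap, integral_map hT.aemeasurable hf.aestronglyMeasurable]
    _ = _ := by
        rw [integral_withDensity_eq_integral_toReal_smul hk.ennreal_ofReal (by simp)]
        refine integral_congr_ae (Eventually.of_forall fun y => ?_)
        simp only
        rw [ENNReal.toReal_ofReal (hk0 y), Complex.real_smul]

lemma measurable_weight_density : Measurable fun v => ENNReal.ofReal (P.maxwellian v)⁻¹ :=
  P.continuous_maxwellian.measurable.inv.ennreal_ofReal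

lemma integral_weight (f : Vel → ℂ) :
    ∫ v, f v ∂P.weight = ∫ v, ((P.maxwellian v)⁻¹ : ℝ) * f v := by
  rw [weight, integral_withDensity_eq_integral_toReal_smul
    P.measurable_weight_density (by simp)]
  refine integral_congr_ae (Eventually.of_forall fun v => ?_)
  simp only
  rw [ENNReal.toReal_ofReal (inv_nonneg.2 (P.maxwellian_pos _).le), Complex.real_smul]

lemma lintegral_weight {F : Vel → ENNReal} (hF : Measurable F) :
    ∫⁻ v, F v ∂P.weight = ∫⁻ v, ENNReal.ofReal (P.maxwellian v)⁻¹ * F v := by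
  rw [weight, lintegral_withDensity_eq_lintegral_mul _
    P.measurable_weight_density hF]
  rfl

lemma measurable_preV (v : Vel) : Measurable fun p : Vel × Sph => P.preV v p.1 p.2 := by
  refine Continuous.measurable ?_
  unfold preV
  fun_prop

lemma measurable_gain_weight (v : Vel) : Measurable fun p : Vel × Sph =>
    |inner ℝ (v - p.1) (p.2 : Vel)| * P.maxwellian₁ (P.preW v p.1 p.2) := by
  refine Continuous.measurable ?_
  have h1 : Continuous fun p : Vel × Sph => P.preW v p.1 p.2 := by
    unfold preW
    fun_prop
  exact (by fun_prop : Continuous fun p : Vel × Sph =>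
    |inner ℝ (v - p.1) (p.2 : Vel)|).mul (P.continuous_maxwellian₁.comp h1)

lemma measurable_kernel_right (v : Vel) : Measurable fun v' => P.kernel v v' :=
  P.measurable_kernel.of_uncurry_left

lemma measurable_gain_kernel (v : Vel) :
    Measurable fun v' => P.ε ^ 2 * (P.kernel v v' * (P.maxwellian v')⁻¹) :=
  measurable_const.mul ((P.measurable_kernel_right v).mul P.continuous_maxwellian.measurable.inv)

lemma gain_kernel_nonneg (v v' : Vel) : 0 ≤ P.ε ^ 2 * (P.kernel v v' * (P.maxwellian v')⁻¹) :=
  mul_nonneg (sq_nonneg _) (mul_nonneg (P.kernel_nonneg _ _) (inv_nonneg.2 (P.maxwellian_pos _).le))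

lemma gain_weight_nonneg (v : Vel) (p : Vel × Sph) :
    0 ≤ |inner ℝ (v - p.1) (p.2 : Vel)| * P.maxwellian₁ (P.preW v p.1 p.2) :=
  mul_nonneg (abs_nonneg _) (P.maxwellian₁_nonneg _)

/-- The gain operator as an integral operator. -/
theorem gain_eq (v : Vel) {f : Vel → ℂ} (hf : StronglyMeasurable f) :
    P.gain f v = ∫ v', (P.kernel v v' : ℂ) * f v' ∂P.weight := by
  have h : ∫ p : Vel × Sph,
      ((|inner ℝ (v - p.1) (p.2 : Vel)| * P.maxwellian₁ (P.preW v p.1 p.2) : ℝ) : ℂ) *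
        f (P.preV v p.1 p.2) ∂collisionMeasure
      = ∫ v', ((P.ε ^ 2 * (P.kernel v v' * (P.maxwellian v')⁻¹) : ℝ) : ℂ) * f v' :=
    integral_mul_comp_eq (P.measurable_gain_weight v) (P.gain_weight_nonneg v)
      (P.measurable_gain_kernel v) (P.gain_kernel_nonneg v) (P.measurable_preV v)
      (fun _ hF => P.lintegral_gain v hF) hf
  have hε : (P.ε : ℂ) ≠ 0 := by exact_mod_cast P.ε_pos.ne'
  rw [gain, h, integral_weight, ← integral_const_mul]
  refine integral_congr_ae (Eventually.of_forall fun v' => ?_)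
  simp only
  push_cast
  field_simp

end Params

/-! ### Bounds for the collision kernel -/

namespace Params

open Filter Topology

variable (P : Params)

lemma integrable_norm_inv_mul_gaussian {b : ℝ} (hb : 0 < b) :
    Integrable fun q : Vel => ‖q‖⁻¹ * Real.exp (-b * ‖q‖ ^ 2) := by
  rw [integrable_fun_norm_addHaar volume (f := fun r : ℝ => r⁻¹ * Real.exp (-b * r ^ 2))]
  refine (integrable_mul_exp_neg_mul_sq hb).integrableOn.congr_fun (fun r hr => ?_)
    measurableSet_Ioi
  have : (r : ℝ) ≠ 0 := (mem_Ioi.1 hr).ne'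
  simp only [finrank_euclideanSpace_fin, smul_eq_mul]
  field_simp

lemma integrable_sq_norm_inv_mul_gaussian {b : ℝ} (hb : 0 < b) :
    Integrable fun q : Vel => (‖q‖⁻¹ * Real.exp (-b * ‖q‖ ^ 2)) ^ 2 := by
  rw [integrable_fun_norm_addHaar volume (f := fun r : ℝ => (r⁻¹ * Real.exp (-b * r ^ 2)) ^ 2)]
  refine (integrable_exp_neg_mul_sq (b := 2 * b) (by positivity)).integrableOn.congr_fun
    (fun r hr => ?_) measurableSet_Ioi
  have : (r : ℝ) ≠ 0 := (mem_Ioi.1 hr).ne'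
  simp only [finrank_euclideanSpace_fin, smul_eq_mul, mul_pow]
  rw [← Real.exp_nat_mul]
  field_simp
  congr 1
  push_cast
  ring_nf

/-- The function of `v - v'` which bounds the symmetrised kernel. -/
noncomputable def symmKernelBound (q : Vel) : ℝ :=
  2 * P.c⁻¹ ^ 2 * √(P.κ / Real.pi) * (‖q‖⁻¹ * Real.exp (-(P.κ * P.d ^ 2) * ‖q‖ ^ 2))

lemma symmKernel_le (v v' : Vel) : P.symmKernel v v' ≤ P.symmKernelBound (v - v') := by
  have h1 := P.c_pos
  have h2 := P.κ_pos
  unfold symmKernel symmKernelBound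
  calc _ ≤ 2 * P.c⁻¹ ^ 2 * ‖v - v'‖⁻¹ * (√(P.κ / Real.pi) *
        Real.exp (-(P.κ * P.d ^ 2) * ‖v - v'‖ ^ 2)) := by
        have h3 := mul_nonneg h2.le
          (sq_nonneg ((‖v - P.u₁‖ ^ 2 - ‖v' - P.u₁‖ ^ 2) / (2 * ‖v - v'‖)))
        refine mul_le_mul_of_nonneg_left (mul_le_mul_of_nonneg_left (Real.exp_le_exp.2 ?_)
          (Real.sqrt_nonneg _)) (by positivity)
        linarith
    _ = _ := by ring

lemma exists_lintegral_symmKernel_le :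
    ∃ C : ℝ, 0 ≤ C ∧ ∀ v, ∫⁻ v', ENNReal.ofReal (P.symmKernel v v') ≤ ENNReal.ofReal C := by
  have hb : 0 < P.κ * P.d ^ 2 := mul_pos P.κ_pos (pow_pos P.d_pos 2)
  have hi : Integrable P.symmKernelBound := (integrable_norm_inv_mul_gaussian hb).const_mul _
  refine ⟨(∫⁻ q, ENNReal.ofReal (P.symmKernelBound q)).toReal, ENNReal.toReal_nonneg, fun v => ?_⟩
  rw [ENNReal.ofReal_toReal hi.lintegral_lt_top.ne]
  exact (lintegral_mono fun v' => ENNReal.ofReal_le_ofReal (P.symmKernel_le v v')).trans_eq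
    (lintegral_sub_left_eq_self (fun q => ENNReal.ofReal (P.symmKernelBound q)) v)

lemma exists_lintegral_symmKernel_sq_le :
    ∃ C : ℝ, 0 ≤ C ∧ ∀ v, ∫⁻ v', ENNReal.ofReal (P.symmKernel v v' ^ 2) ≤ ENNReal.ofReal C := by
  have hb : 0 < P.κ * P.d ^ 2 := mul_pos P.κ_pos (pow_pos P.d_pos 2)
  have hi : Integrable fun q => P.symmKernelBound q ^ 2 := by
    simp only [symmKernelBound, mul_pow _ (‖_‖⁻¹ * _)]
    exact (integrable_sq_norm_inv_mul_gaussian hb).const_mul _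
  refine ⟨(∫⁻ q, ENNReal.ofReal (P.symmKernelBound q ^ 2)).toReal, ENNReal.toReal_nonneg,
    fun v => ?_⟩
  rw [ENNReal.ofReal_toReal hi.lintegral_lt_top.ne]
  exact (lintegral_mono fun v' => ENNReal.ofReal_le_ofReal
    (pow_le_pow_left₀ (P.symmKernel_nonneg v v') (P.symmKernel_le v v') 2)).trans_eq
    (lintegral_sub_left_eq_self (fun q => ENNReal.ofReal (P.symmKernelBound q ^ 2)) v)

lemma lintegral_gauss₃ {κ : ℝ} (hκ : 0 < κ) (u : Vel) :
    ∫⁻ v : Vel, ENNReal.ofReal (gauss₃ κ (v - u)) = 1 := by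
  have h := lintegral_gauss₃_slice hκ (n := EuclideanSpace.single (0 : Fin 3) (1 : ℝ)) (by simp)
    0 0 (Ψ := fun _ => 1) measurable_const
  simp only [one_mul, zero_mul, zero_smul, add_zero, sub_zero] at h
  rw [lintegral_gauss_sub hκ, lintegral_sub_left_eq_self
    (fun q : Vel => ENNReal.ofReal (gauss₃ κ q)) 0] at h
  rw [lintegral_sub_right_eq_self (fun q : Vel => ENNReal.ofReal (gauss₃ κ q)) u, h]

lemma lintegral_maxwellian : ∫⁻ v, ENNReal.ofReal (P.maxwellian v) = 1 := by
  simp only [maxwellian_eq]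
  exact lintegral_gauss₃ P.η_pos P.u₁

lemma integrable_maxwellian₁ : Integrable P.maxwellian₁ := by
  refine ⟨P.continuous_maxwellian₁.aestronglyMeasurable, ?_⟩
  rw [hasFiniteIntegral_iff_ofReal (Eventually.of_forall P.maxwellian₁_nonneg)]
  simp only [maxwellian₁_eq]
  rw [lintegral_gauss₃ P.κ_pos]
  exact ENNReal.one_lt_top

lemma weight_absolutelyContinuous : P.weight ≪ volume := withDensity_absolutelyContinuous _ _

lemma absolutelyContinuous_weight : volume ≪ P.weight :=
  withDensity_absolutelyContinuous' P.measurable_weight_density.aemeasurable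
    (Eventually.of_forall fun v => (ENNReal.ofReal_pos.2 (inv_pos.2 (P.maxwellian_pos v))).ne')

instance : SigmaFinite P.weight := SigmaFinite.withDensity_ofReal _

instance : collisionMeasure.IsOpenPosMeasure := by unfold collisionMeasure; infer_instance

/-! ### The collision frequency -/

lemma lintegral_kernel_lt_top (v : Vel) :
    ∫⁻ v', ENNReal.ofReal (P.kernel v v' * (P.maxwellian v)⁻¹) < ⊤ := by
  obtain ⟨C, -, hC⟩ := P.exists_lintegral_symmKernel_le
  have hM := P.maxwellian_pos v
  have hψ := P.halfMaxwellian_pos v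
  have h0 : 0 ≤ √(P.η / Real.pi) ^ 3 * P.halfMaxwellian v * (P.maxwellian v)⁻¹ := by positivity
  calc _ ≤ ∫⁻ v', ENNReal.ofReal (√(P.η / Real.pi) ^ 3 * P.halfMaxwellian v *
        (P.maxwellian v)⁻¹) * ENNReal.ofReal (P.symmKernel v v') := by
        refine lintegral_mono fun v' => ?_
        rw [← ENNReal.ofReal_mul h0]
        refine ENNReal.ofReal_le_ofReal ?_
        have h1 : P.halfMaxwellian v' ≤ 1 := Real.exp_le_one_iff.2 (by
          nlinarith [P.η_pos, sq_nonneg ‖v' - P.u₁‖])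
        have h2 := P.symmKernel_nonneg v v'
        unfold kernel
        calc _ = (√(P.η / Real.pi) ^ 3 * P.halfMaxwellian v * (P.maxwellian v)⁻¹ *
              P.symmKernel v v') * P.halfMaxwellian v' := by ring
          _ ≤ _ := mul_le_of_le_one_right (mul_nonneg h0 h2) h1
    _ = ENNReal.ofReal (√(P.η / Real.pi) ^ 3 * P.halfMaxwellian v * (P.maxwellian v)⁻¹) *
        ∫⁻ v', ENNReal.ofReal (P.symmKernel v v') :=
        lintegral_const_mul' _ _ ENNReal.ofReal_ne_top
    _ < ⊤ := ENNReal.mul_lt_top ENNReal.ofReal_lt_top ((hC v).trans_lt ENNReal.ofReal_lt_top)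

lemma continuous_abs_inner_mul (v : Vel) : Continuous fun p : Vel × Sph =>
    |inner ℝ (v - p.1) (p.2 : Vel)| * P.maxwellian₁ p.1 :=
  (by fun_prop : Continuous fun p : Vel × Sph => |inner ℝ (v - p.1) (p.2 : Vel)|).mul
    (P.continuous_maxwellian₁.comp continuous_fst)

lemma abs_inner_mul_nonneg (y : Vel) (p : Vel × Sph) :
    0 ≤ |inner ℝ y (p.2 : Vel)| * P.maxwellian₁ p.1 :=
  mul_nonneg (abs_nonneg _) (P.maxwellian₁_nonneg _)

lemma abs_inner_sub_mul_nonneg (v : Vel) (p : Vel × Sph) :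
    0 ≤ |inner ℝ (v - p.1) (p.2 : Vel)| * P.maxwellian₁ p.1 :=
  mul_nonneg (abs_nonneg _) (P.maxwellian₁_nonneg _)

lemma integrable_collisionFrequency (v : Vel) : Integrable (fun p : Vel × Sph =>
    |inner ℝ (v - p.1) (p.2 : Vel)| * P.maxwellian₁ p.1) collisionMeasure := by
  refine ⟨(P.continuous_abs_inner_mul v).measurable.aestronglyMeasurable, ?_⟩
  rw [hasFiniteIntegral_iff_ofReal (Eventually.of_forall (P.abs_inner_sub_mul_nonneg v)), P.lintegral_collisionFrequency]
  exact P.lintegral_kernel_lt_top v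

lemma collisionFrequency_nonneg (v : Vel) : 0 ≤ P.collisionFrequency v :=
  integral_nonneg (P.abs_inner_sub_mul_nonneg v)

/-- In the equilibrium the gain balances the loss. -/
lemma lintegral_kernel_eq (v : Vel) : ∫⁻ v', ENNReal.ofReal (P.kernel v v')
    = ENNReal.ofReal (P.collisionFrequency v * P.maxwellian v) := by
  have hM := P.maxwellian_pos v
  rw [ENNReal.ofReal_mul (P.collisionFrequency_nonneg v), collisionFrequency,
    ofReal_integral_eq_lintegral_ofReal (P.integrable_collisionFrequency v)
      (Eventually.of_forall (P.abs_inner_sub_mul_nonneg v)),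
    P.lintegral_collisionFrequency, ← lintegral_mul_const' _ _ ENNReal.ofReal_ne_top]
  refine lintegral_congr fun v' => ?_
  rw [← ENNReal.ofReal_mul' hM.le, mul_assoc, inv_mul_cancel₀ hM.ne', mul_one]

/-- The collision frequency `∫ |y · n| 𝓜₁(w) dw dn` of a particle with relative velocity `y`
in a medium without thermal motion. -/
noncomputable def coldFrequency (y : Vel) : ℝ :=
  ∫ p : Vel × Sph, |inner ℝ y (p.2 : Vel)| * P.maxwellian₁ p.1 ∂collisionMeasure

/-- The total mass of `𝓜₁(w) dw dn`, a Lipschitz constant of the collision frequency. -/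
noncomputable def mass : ℝ := ∫ p : Vel × Sph, P.maxwellian₁ p.1 ∂collisionMeasure

lemma integrable_mass : Integrable (fun p : Vel × Sph => P.maxwellian₁ p.1) collisionMeasure :=
  P.integrable_maxwellian₁.comp_fst _

lemma mass_nonneg : 0 ≤ P.mass := integral_nonneg fun p => P.maxwellian₁_nonneg p.1

lemma abs_inner_sphere_le (y : Vel) (n : Sph) : |inner ℝ y (n : Vel)| ≤ ‖y‖ := by
  have h := abs_real_inner_le_norm y (n : Vel)
  rwa [norm_eq_of_mem_sphere n, mul_one] at h

lemma continuous_coldFrequency_integrand (y : Vel) : Continuous fun p : Vel × Sph =>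
    |inner ℝ y (p.2 : Vel)| * P.maxwellian₁ p.1 :=
  (by fun_prop : Continuous fun p : Vel × Sph => |inner ℝ y (p.2 : Vel)|).mul
    (P.continuous_maxwellian₁.comp continuous_fst)

lemma integrable_coldFrequency (y : Vel) : Integrable (fun p : Vel × Sph =>
    |inner ℝ y (p.2 : Vel)| * P.maxwellian₁ p.1) collisionMeasure := by
  refine (P.integrable_mass.const_mul ‖y‖).mono'
    (P.continuous_coldFrequency_integrand y).measurable.aestronglyMeasurable
    (Eventually.of_forall fun p => ?_)
  rw [Real.norm_of_nonneg (P.abs_inner_mul_nonneg y p)]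
  exact mul_le_mul_of_nonneg_right (abs_inner_sphere_le y p.2) (P.maxwellian₁_nonneg _)

lemma coldFrequency_le (y : Vel) : P.coldFrequency y ≤ P.mass * ‖y‖ := by
  rw [mass, mul_comm, ← integral_const_mul]
  exact integral_mono (P.integrable_coldFrequency y) (P.integrable_mass.const_mul _) fun p =>
    mul_le_mul_of_nonneg_right (abs_inner_sphere_le y p.2) (P.maxwellian₁_nonneg _)

lemma coldFrequency_smul (a : ℝ) (y : Vel) :
    P.coldFrequency (a • y) = |a| * P.coldFrequency y := by
  unfold coldFrequency
  rw [← integral_const_mul]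
  congr 1
  ext p
  rw [real_inner_smul_left, abs_mul, mul_assoc]

lemma maxwellian₁_pos (v : Vel) : 0 < P.maxwellian₁ v := by
  have := P.κ_pos
  have := Real.pi_pos
  rw [maxwellian₁_eq, gauss₃]
  positivity

lemma coldFrequency_pos {y : Vel} (hy : y ≠ 0) : 0 < P.coldFrequency y := by
  have hn : 0 < ‖y‖ := norm_pos_iff.2 hy
  refine integral_pos_of_integrable_nonneg_nonzero
    (x := ((0 : Vel), (⟨‖y‖⁻¹ • y, by simp [norm_smul, hn.ne']⟩ : Sph)))
    (P.continuous_coldFrequency_integrand y) (P.integrable_coldFrequency y)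
    (P.abs_inner_mul_nonneg y) (mul_pos (abs_pos.2 ?_) (P.maxwellian₁_pos _)).ne'
  rw [real_inner_smul_right, real_inner_self_eq_norm_sq]
  positivity

lemma coldFrequency_sub_le (v v' : Vel) :
    P.coldFrequency v ≤ P.coldFrequency v' + P.coldFrequency (v - v') := by
  unfold coldFrequency
  rw [← integral_add (P.integrable_coldFrequency _) (P.integrable_coldFrequency _)]
  refine integral_mono (P.integrable_coldFrequency v) ((P.integrable_coldFrequency _).add
    (P.integrable_coldFrequency _)) fun p => ?_
  simp only
  rw [← add_mul, inner_sub_left]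
  refine mul_le_mul_of_nonneg_right ?_ (P.maxwellian₁_nonneg _)
  have := abs_add_le (inner ℝ v' (p.2 : Vel)) (inner ℝ v (p.2 : Vel) - inner ℝ v' (p.2 : Vel))
  rwa [add_sub_cancel] at this

lemma collisionFrequency_le_add (v v' : Vel) :
    P.collisionFrequency v ≤ P.collisionFrequency v' + P.coldFrequency (v - v') := by
  unfold coldFrequency collisionFrequency
  rw [← integral_add (P.integrable_collisionFrequency _) (P.integrable_coldFrequency _)]
  refine integral_mono (P.integrable_collisionFrequency v)
    ((P.integrable_collisionFrequency _).add (P.integrable_coldFrequency _)) fun p => ?_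
  simp only
  rw [← add_mul]
  refine mul_le_mul_of_nonneg_right ?_ (P.maxwellian₁_nonneg _)
  have h : inner ℝ (v - p.1) (p.2 : Vel)
      = inner ℝ (v' - p.1) (p.2 : Vel) + inner ℝ (v - v') (p.2 : Vel) := by
    rw [← inner_add_left]
    congr 1
    abel
  rw [h]
  exact abs_add_le _ _

lemma lipschitzWith_collisionFrequency :
    LipschitzWith P.mass.toNNReal P.collisionFrequency := by
  refine LipschitzWith.of_le_add_mul _ fun v v' => ?_
  rw [Real.coe_toNNReal _ P.mass_nonneg, dist_eq_norm]
  linarith [P.collisionFrequency_le_add v v', P.coldFrequency_le (v - v')]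

lemma lipschitzWith_coldFrequency : LipschitzWith P.mass.toNNReal P.coldFrequency := by
  refine LipschitzWith.of_le_add_mul _ fun v v' => ?_
  rw [Real.coe_toNNReal _ P.mass_nonneg, dist_eq_norm]
  linarith [P.coldFrequency_sub_le v v', P.coldFrequency_le (v - v')]

lemma exists_mul_norm_le_coldFrequency : ∃ k : ℝ, 0 < k ∧ ∀ y, k * ‖y‖ ≤ P.coldFrequency y := by
  obtain ⟨z, hz, hmin⟩ := (isCompact_sphere (0 : Vel) 1).exists_isMinOn
    (NormedSpace.sphere_nonempty.2 zero_le_one) P.lipschitzWith_coldFrequency.continuous.continuousOn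
  refine ⟨P.coldFrequency z, P.coldFrequency_pos (ne_zero_of_mem_unit_sphere ⟨z, hz⟩),
    fun y => ?_⟩
  rcases eq_or_ne y 0 with rfl | hy
  · rw [norm_zero, mul_zero]
    exact integral_nonneg (P.abs_inner_mul_nonneg 0)
  have hn : 0 < ‖y‖ := norm_pos_iff.2 hy
  have h := hmin (show ‖y‖⁻¹ • y ∈ Metric.sphere (0 : Vel) 1 by simp [norm_smul, hn.ne'])
  rw [mem_ofPred_eq, coldFrequency_smul, abs_of_pos (inv_pos.2 hn)] at h
  calc _ ≤ ‖y‖⁻¹ * P.coldFrequency y * ‖y‖ := mul_le_mul_of_nonneg_right h hn.le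
    _ = _ := by field_simp

/-- The distribution of the field particles is invariant under the reflection in `u₁`. -/
lemma measurePreserving_reflect : MeasurePreserving
    (fun p : Vel × Sph => (P.u₁ + P.u₁ - p.1, p.2)) collisionMeasure collisionMeasure :=
  (Measure.measurePreserving_sub_left (volume : Measure Vel) (P.u₁ + P.u₁)).prod
    (MeasurePreserving.id (volume : Measure Vel).toSphere)

lemma maxwellian₁_reflect (w : Vel) : P.maxwellian₁ (P.u₁ + P.u₁ - w) = P.maxwellian₁ w := by
  unfold maxwellian₁
  rw [show P.u₁ + P.u₁ - w - P.u₁ = P.u₁ - w by abel, norm_sub_rev]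

lemma collisionFrequency_reflect (v : Vel) :
    Integrable (fun p : Vel × Sph => |inner ℝ (v - (P.u₁ + P.u₁ - p.1)) (p.2 : Vel)| *
      P.maxwellian₁ p.1) collisionMeasure ∧
    P.collisionFrequency v = ∫ p : Vel × Sph,
      |inner ℝ (v - (P.u₁ + P.u₁ - p.1)) (p.2 : Vel)| * P.maxwellian₁ p.1 ∂collisionMeasure := by
  have hT := P.measurePreserving_reflect
  have hi := P.integrable_collisionFrequency v
  have h1 := hT.integrable_comp_of_integrable hi
  have h2 := integral_map hT.measurable.aemeasurable
    (hT.map_eq.symm ▸ hi.aestronglyMeasurable)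
  rw [hT.map_eq] at h2
  simp only [Function.comp_def, maxwellian₁_reflect] at h1 h2
  exact ⟨h1, h2⟩

/-- Thermal motion and relative velocity both increase the collision frequency, because
`2 max (|x|, |a|) ≤ |x - a| + |x + a|`. -/
lemma collisionFrequency_ge (v : Vel) : P.collisionFrequency P.u₁ ≤ P.collisionFrequency v ∧
    P.coldFrequency (v - P.u₁) ≤ P.collisionFrequency v := by
  obtain ⟨hi', he'⟩ := P.collisionFrequency_reflect v
  have hi := P.integrable_collisionFrequency v
  have hsum : P.collisionFrequency v + P.collisionFrequency v = ∫ p : Vel × Sph,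
      (|inner ℝ (v - p.1) (p.2 : Vel)| * P.maxwellian₁ p.1 +
      |inner ℝ (v - (P.u₁ + P.u₁ - p.1)) (p.2 : Vel)| * P.maxwellian₁ p.1) ∂collisionMeasure := by
    rw [integral_add hi hi', ← he']
    rfl
  have hin : ∀ p : Vel × Sph, inner ℝ (v - p.1) (p.2 : Vel)
        = inner ℝ (v - P.u₁) (p.2 : Vel) + inner ℝ (P.u₁ - p.1) (p.2 : Vel) ∧
      inner ℝ (v - (P.u₁ + P.u₁ - p.1)) (p.2 : Vel)
        = inner ℝ (v - P.u₁) (p.2 : Vel) - inner ℝ (P.u₁ - p.1) (p.2 : Vel) := fun p => by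
    rw [← inner_add_left, ← inner_sub_left]
    constructor <;> congr 1 <;> abel
  constructor
  · suffices P.collisionFrequency P.u₁ + P.collisionFrequency P.u₁
        ≤ P.collisionFrequency v + P.collisionFrequency v by linarith
    have hi₁ := P.integrable_collisionFrequency P.u₁
    rw [hsum, collisionFrequency, ← integral_add hi₁ hi₁]
    refine integral_mono (hi₁.add hi₁) (hi.add hi') fun p => ?_
    simp only
    rw [← add_mul, ← add_mul, (hin p).1, (hin p).2]
    refine mul_le_mul_of_nonneg_right ?_ (P.maxwellian₁_nonneg _)
    generalize (inner ℝ (v - P.u₁) (p.2 : Vel) : ℝ) = x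
    generalize (inner ℝ (P.u₁ - p.1) (p.2 : Vel) : ℝ) = a
    have := abs_sub (x + a) (x - a)
    rw [show x + a - (x - a) = 2 * a by ring, abs_mul, abs_two] at this
    rwa [← two_mul]
  · suffices P.coldFrequency (v - P.u₁) + P.coldFrequency (v - P.u₁)
        ≤ P.collisionFrequency v + P.collisionFrequency v by linarith
    have hi₁ := P.integrable_coldFrequency (v - P.u₁)
    rw [hsum, coldFrequency, ← integral_add hi₁ hi₁]
    refine integral_mono (hi₁.add hi₁) (hi.add hi') fun p => ?_
    simp only
    rw [← add_mul, ← add_mul, (hin p).1, (hin p).2]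
    refine mul_le_mul_of_nonneg_right ?_ (P.maxwellian₁_nonneg _)
    generalize (inner ℝ (v - P.u₁) (p.2 : Vel) : ℝ) = x
    generalize (inner ℝ (P.u₁ - p.1) (p.2 : Vel) : ℝ) = a
    have := abs_add_le (x + a) (x - a)
    rw [show x + a + (x - a) = 2 * x by ring, abs_mul, abs_two] at this
    rwa [← two_mul]

/-- The collision frequency is smallest for a particle at rest in the medium. -/
lemma ν₀_eq : P.ν₀ = P.collisionFrequency P.u₁ :=
  le_antisymm (ciInf_le ⟨0, by rintro _ ⟨v, rfl⟩; exact P.collisionFrequency_nonneg v⟩ _)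
    (le_ciInf fun v => (P.collisionFrequency_ge v).1)

lemma ν₀_pos : 0 < P.ν₀ := by
  obtain ⟨y, hy⟩ := exists_ne (0 : Vel)
  have hn : 0 < ‖y‖ := norm_pos_iff.2 hy
  rw [ν₀_eq]
  refine integral_pos_of_integrable_nonneg_nonzero
    (x := (P.u₁ - y, (⟨‖y‖⁻¹ • y, by simp [norm_smul, hn.ne']⟩ : Sph)))
    (P.continuous_abs_inner_mul P.u₁) (P.integrable_collisionFrequency P.u₁)
    (P.abs_inner_sub_mul_nonneg P.u₁) (mul_pos (abs_pos.2 ?_) (P.maxwellian₁_pos _)).ne'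
  rw [sub_sub_cancel, real_inner_smul_right, real_inner_self_eq_norm_sq]
  positivity

/-! ### The collision kernel as a balance kernel -/

lemma setLIntegral_maxwellian_weight {E : Set Vel} (hE : MeasurableSet E) :
    ∫⁻ v in E, ENNReal.ofReal (P.maxwellian v) ∂P.weight = volume E := by
  rw [weight, setLIntegral_withDensity_eq_setLIntegral_mul _ P.measurable_weight_density
    P.continuous_maxwellian.measurable.ennreal_ofReal hE, ← setLIntegral_one]
  refine lintegral_congr fun v => ?_
  have := P.maxwellian_pos v
  rw [Pi.mul_apply, ← ENNReal.ofReal_mul (inv_nonneg.2 this.le), inv_mul_cancel₀ this.ne',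
    ENNReal.ofReal_one]

lemma weight_closedBall_lt_top (r : ℝ) : P.weight (Metric.closedBall P.u₁ r) < ⊤ := by
  have hc : Continuous fun v => (P.maxwellian v)⁻¹ :=
    P.continuous_maxwellian.inv₀ fun v => (P.maxwellian_pos v).ne'
  rw [weight, withDensity_apply _ measurableSet_closedBall]
  exact (hc.continuousOn.integrableOn_compact (isCompact_closedBall P.u₁ r)).lintegral_lt_top

/-- Disjoint annuli of positive finite measure in every neighbourhood of `u₁`. -/
lemma exists_annuli {δ : ℝ} (hδ : 0 < δ) : ∃ E : ℕ → Set Vel, (∀ n, MeasurableSet (E n)) ∧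
    Pairwise (Function.onFun Disjoint E) ∧ (∀ n, 0 < P.weight (E n) ∧ P.weight (E n) < ⊤) ∧
    ∀ n, ∀ v ∈ E n, ‖v - P.u₁‖ ≤ δ := by
  have hlt : ∀ n : ℕ, δ / ((n : ℝ) + 2) < δ / ((n : ℝ) + 1) := fun n =>
    div_lt_div_of_pos_left hδ (by positivity) (by linarith)
  have hle : ∀ n : ℕ, δ / ((n : ℝ) + 1) ≤ δ := fun n =>
    div_le_self hδ.le (by linarith [n.cast_nonneg (α := ℝ)])
  have hnorm : Continuous fun v : Vel => ‖v - P.u₁‖ := by fun_prop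
  have hopen : ∀ n : ℕ, IsOpen {v : Vel | ‖v - P.u₁‖ ∈ Ioo (δ / ((n : ℝ) + 2)) (δ / ((n : ℝ) + 1))} :=
    fun n => isOpen_Ioo.preimage hnorm
  refine ⟨fun n => {v : Vel | ‖v - P.u₁‖ ∈ Ioo (δ / ((n : ℝ) + 2)) (δ / ((n : ℝ) + 1))},
    fun n => (hopen n).measurableSet, ?_, fun n => ⟨?_, ?_⟩, fun n v hv => hv.2.le.trans (hle n)⟩
  · refine (pairwise_disjoint_on _).2 fun m n hmn => Set.disjoint_left.2 fun v hm hn => ?_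
    have h1 : (m : ℝ) + 1 ≤ n := by exact_mod_cast hmn
    have h2 : δ / ((n : ℝ) + 1) ≤ δ / ((m : ℝ) + 2) :=
      div_le_div_of_nonneg_left hδ.le (by positivity) (by linarith)
    exact absurd (hn.2.trans_le h2) (not_lt.2 hm.1.le)
  · obtain ⟨s, hs⟩ := exists_between (hlt n)
    have hs0 : 0 ≤ s := (by positivity : 0 ≤ δ / ((n : ℝ) + 2)).trans hs.1.le
    obtain ⟨y, hy⟩ := exists_norm_eq Vel hs0
    have h1 : 0 < volume {v : Vel | ‖v - P.u₁‖ ∈ Ioo (δ / ((n : ℝ) + 2)) (δ / ((n : ℝ) + 1))} :=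
      (hopen n).measure_pos _ ⟨y + P.u₁, by simpa [hy] using hs⟩
    exact pos_iff_ne_zero.2 fun h => h1.ne' (P.absolutelyContinuous_weight h)
  · refine (measure_mono fun v hv => ?_).trans_lt (P.weight_closedBall_lt_top δ)
    rw [Metric.mem_closedBall, dist_eq_norm]
    exact hv.2.le.trans (hle n)

/-- The collision kernel satisfies all hypotheses of the spectral theory. The Schur weight is the
square root of the equilibrium, which removes the Maxwellian factors from `J`. -/
lemma balanceKernel : BalanceKernel P.weight P.kernel P.maxwellian P.collisionFrequency P.ν₀ where
  measurable_J := P.measurable_kernel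
  J_nonneg := P.kernel_nonneg
  J_symm := P.kernel_comm
  J_pos v := by
    refine P.weight_absolutelyContinuous.ae_le ?_
    filter_upwards [compl_mem_ae_iff.2 (measure_singleton (μ := volume) v)] with v' hv'
    exact P.kernel_pos (Ne.symm hv')
  measurable_φ := P.continuous_maxwellian.measurable
  φ_pos := P.maxwellian_pos
  lintegral_φ_sq := by
    rw [P.lintegral_weight (by have := P.continuous_maxwellian; fun_prop), ← P.lintegral_maxwellian]
    refine lintegral_congr fun v => ?_
    have := P.maxwellian_pos v
    rw [← ENNReal.ofReal_mul (inv_nonneg.2 this.le)]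
    congr 1
    field_simp
  measurable_σ := P.lipschitzWith_collisionFrequency.continuous.measurable
  s₀_pos := P.ν₀_pos
  s₀_le v := P.ν₀_eq.trans_le (P.collisionFrequency_ge v).1
  balance v := by
    have hm := P.measurable_kernel_right v
    have hM := P.continuous_maxwellian.measurable
    rw [P.lintegral_weight (show Measurable fun v' =>
      ENNReal.ofReal (P.kernel v v' * P.maxwellian v') from (hm.mul hM).ennreal_ofReal), ← P.lintegral_kernel_eq]
    refine lintegral_congr fun v' => ?_
    have := P.maxwellian_pos v'
    rw [← ENNReal.ofReal_mul (inv_nonneg.2 this.le)]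
    congr 1
    field_simp
  schur := by
    obtain ⟨C, hC, h⟩ := P.exists_lintegral_symmKernel_le
    refine ⟨P.halfMaxwellian, C, P.continuous_halfMaxwellian.measurable, P.halfMaxwellian_pos, hC,
      fun v => ?_⟩
    have hm := P.measurable_kernel_right v
    have hM := P.continuous_halfMaxwellian.measurable
    have hψ := P.halfMaxwellian_pos v
    rw [P.lintegral_weight (show Measurable fun v' =>
      ENNReal.ofReal (P.kernel v v' * P.halfMaxwellian v') from (hm.mul hM).ennreal_ofReal)]
    calc _ = ∫⁻ v', ENNReal.ofReal (P.halfMaxwellian v) * ENNReal.ofReal (P.symmKernel v v') := by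
          refine lintegral_congr fun v' => ?_
          have h1 := P.maxwellian_pos v'
          have h2 := P.halfMaxwellian_pos v'
          have h3 := P.sqrt_η_pos
          rw [← ENNReal.ofReal_mul (inv_nonneg.2 h1.le), ← ENNReal.ofReal_mul hψ.le,
            maxwellian_eq_half_sq, kernel]
          congr 1
          field_simp
      _ = ENNReal.ofReal (P.halfMaxwellian v) * ∫⁻ v', ENNReal.ofReal (P.symmKernel v v') :=
          lintegral_const_mul' _ _ ENNReal.ofReal_ne_top
      _ ≤ ENNReal.ofReal (P.halfMaxwellian v) * ENNReal.ofReal C := by gcongr; exact h v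
      _ = _ := by rw [← ENNReal.ofReal_mul hψ.le, mul_comm]
  hilbertSchmidt R := by
    obtain ⟨a, ha, hcold⟩ := P.exists_mul_norm_le_coldFrequency
    obtain ⟨C, hC, h⟩ := P.exists_lintegral_symmKernel_sq_le
    refine ⟨Metric.closedBall P.u₁ (R / a), measurableSet_closedBall, fun v hv => ?_, ?_⟩
    · rw [Metric.mem_closedBall, not_le, dist_eq_norm, div_lt_iff₀ ha] at hv
      linarith [hcold (v - P.u₁), (P.collisionFrequency_ge v).2]
    have hin : ∀ v, ∫⁻ v', ENNReal.ofReal (P.kernel v v' ^ 2) ∂P.weight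
        ≤ ENNReal.ofReal (P.maxwellian v) * ENNReal.ofReal C := fun v => by
      have hm := P.measurable_kernel_right v
      have hψ := P.maxwellian_pos v
      rw [P.lintegral_weight (hm.pow_const 2).ennreal_ofReal]
      calc _ = ∫⁻ v', ENNReal.ofReal (P.maxwellian v) *
            ENNReal.ofReal (P.symmKernel v v' ^ 2) := by
            refine lintegral_congr fun v' => ?_
            have h1 := P.maxwellian_pos v'
            have h2 := P.halfMaxwellian_pos v'
            have h3 := P.sqrt_η_pos
            rw [← ENNReal.ofReal_mul (inv_nonneg.2 h1.le), ← ENNReal.ofReal_mul hψ.le,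
              maxwellian_eq_half_sq, maxwellian_eq_half_sq, kernel]
            congr 1
            field_simp
        _ = ENNReal.ofReal (P.maxwellian v) * ∫⁻ v', ENNReal.ofReal (P.symmKernel v v' ^ 2) :=
            lintegral_const_mul' _ _ ENNReal.ofReal_ne_top
        _ ≤ _ := by gcongr; exact h v
    refine (lintegral_mono hin).trans_lt ?_
    rw [lintegral_mul_const' _ _ ENNReal.ofReal_ne_top,
      P.setLIntegral_maxwellian_weight measurableSet_closedBall]
    exact ENNReal.mul_lt_top measure_closedBall_lt_top ENNReal.ofReal_lt_top
  near_inf δ hδ := by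
    have hm : 0 < P.mass + 1 := by linarith [P.mass_nonneg]
    obtain ⟨E, h1, h2, h3, h4⟩ := P.exists_annuli (div_pos hδ hm)
    refine ⟨E, h1, h2, h3, fun n v hv => ?_⟩
    have h5 := h4 n v hv
    rw [le_div_iff₀ hm] at h5
    rw [ν₀_eq]
    nlinarith [P.collisionFrequency_le_add v P.u₁, P.coldFrequency_le (v - P.u₁),
      norm_nonneg (v - P.u₁)]

end Params

/-! ### Spectrum and solutions of the linear Boltzmann equation -/

/-- The resolvent set of the operator `1 - A⁻¹`, described in terms of the spectrum of its
resolvent `A` at `1`: with `x = (1 - z)⁻¹`, the equation `z f - 𝓛 f = h` reads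
`(x - A) f = x A h`. -/
theorem exists_resolvent_iff {H : Type*} [NormedAddCommGroup H] [InnerProductSpace ℂ H]
    (A : H →L[ℂ] H) (z : ℂ) :
    (∃ R : H →L[ℂ] H, ∀ f h : H, R h = f ↔ ∃ g, A (f - g) = f ∧ z • f - g = h) ↔
      z = 1 ∨ (1 - z)⁻¹ ∉ spectrum ℂ A := by
  have hg : ∀ f h : H, (∃ g, A (f - g) = f ∧ z • f - g = h) ↔ (1 - z) • A f + A h = f :=
    fun f h => by
      have h1 : (1 - z) • A f + A h = A (f - (z • f - h)) := by
        rw [map_sub, map_sub, map_smul, sub_smul, one_smul]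
        abel
      rw [h1]
      constructor
      · rintro ⟨g, hg, rfl⟩
        rwa [sub_sub_cancel]
      · exact fun h => ⟨z • f - _, h, sub_sub_cancel _ _⟩
  simp only [hg]
  rcases eq_or_ne z 1 with rfl | hz
  · simpa using ⟨A, fun f h => Iff.rfl⟩
  have hx0 : 1 - z ≠ 0 := sub_ne_zero.2 hz.symm
  obtain ⟨x, hx⟩ : ∃ x, x = (1 - z)⁻¹ := ⟨_, rfl⟩
  have hx1 : 1 - z = x⁻¹ := by rw [hx, inv_inv]
  have hxne : x ≠ 0 := hx ▸ inv_ne_zero hx0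
  rw [← hx, hx1, spectrum.notMem_iff]
  simp only [hz, false_or]
  set T : H →L[ℂ] H := algebraMap ℂ (H →L[ℂ] H) x - A with hT
  have hTf : ∀ f, T f = x • f - A f := fun f => by
    rw [hT, sub_apply, ContinuousLinearMap.algebraMap_apply]
  have key : ∀ f h, x⁻¹ • A f + A h = f ↔ T f = x • A h := fun f h => by
    rw [hTf, ← (smul_right_injective H hxne).eq_iff, smul_add, smul_inv_smul₀ hxne, eq_comm,
      sub_eq_iff_eq_add, add_comm]
  simp only [key]
  constructor
  · rintro ⟨R, hR⟩
    have hinj : ∀ f, T f = 0 → f = 0 := fun f hf => by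
      have := (hR f 0).2 (by rw [hf, map_zero, smul_zero])
      rw [← this, map_zero]
    -- `(x - A) (p / x) = p - A p / x`, and the error `A p / x = x A (x⁻² p)` is removed by `R`
    set B : H →L[ℂ] H := x⁻¹ • ContinuousLinearMap.id ℂ H + (x⁻¹ ^ 2) • R with hB
    have hTB : ∀ p, T (B p) = p := fun p => by
      have h1 := (hR _ p).1 rfl
      rw [hB, add_apply, smul_apply,
        smul_apply, ContinuousLinearMap.id_apply, map_add, map_smul, map_smul,
        h1, hTf, smul_sub, inv_smul_smul₀ hxne, smul_smul, pow_two, mul_assoc,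
        inv_mul_cancel₀ hxne, mul_one, sub_add_cancel]
    refine ⟨⟨T, B, ContinuousLinearMap.ext hTB, ContinuousLinearMap.ext fun f => ?_⟩, rfl⟩
    refine sub_eq_zero.1 (hinj _ ?_)
    rw [map_sub]
    exact sub_eq_zero.2 (hTB (T f))
  · rintro ⟨u, hu⟩
    refine ⟨(u⁻¹ : (H →L[ℂ] H)ˣ).val.comp (x • A), fun f h => ?_⟩
    have h1 : ∀ p, T ((u⁻¹ : (H →L[ℂ] H)ˣ).val p) = p := fun p => by
      rw [← hu]; exact congr($(u.mul_inv) p)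
    have h2 : ∀ p, (u⁻¹ : (H →L[ℂ] H)ˣ).val (T p) = p := fun p => by
      rw [← hu]; exact congr($(u.inv_mul) p)
    constructor
    · rintro rfl
      exact h1 _
    · intro hf
      rw [ContinuousLinearMap.comp_apply, smul_apply, ← hf, h2]

namespace Params

open Filter Topology

variable (P : Params)

lemma graph_iff (f g : P.Hsp) : P.Graph f g ↔
    MemLp (fun v => (P.collisionFrequency v : ℂ) * f v) 2 P.weight ∧
      g =ᵐ[P.weight] fun v => (∫ v', (P.kernel v v' : ℂ) * f v' ∂P.weight)
        - P.collisionFrequency v * f v := by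
  have h : P.collision f = fun v => (∫ v', (P.kernel v v' : ℂ) * f v' ∂P.weight)
      - P.collisionFrequency v * f v := by
    ext v
    rw [collision, P.gain_eq v (Lp.stronglyMeasurable f)]
  rw [Graph, h]
  exact and_congr_right fun _ =>
    ⟨fun h => P.weight_absolutelyContinuous.ae_le h, fun h => P.absolutelyContinuous_weight.ae_le h⟩

/-- The mass of `f` is its component along the equilibrium, because the weight is `𝓜⁻¹`. -/
lemma inner_equilibrium (f : P.Hsp) : inner ℂ P.equilibrium f = ∫ v, f v := by
  have h : ∫ v, inner ℂ (P.equilibrium v) (f v) ∂P.weight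
      = ∫ v, (P.maxwellian v : ℂ) * f v ∂P.weight := by
    refine integral_congr_ae ?_
    filter_upwards [P.memLp_maxwellian.coeFn_toLp] with v hv
    rw [equilibrium, hv, RCLike.inner_apply, Complex.conj_ofReal, mul_comm]
  rw [L2.inner_def, h, integral_weight]
  refine integral_congr_ae (Eventually.of_forall fun v => ?_)
  have := P.maxwellian_pos v
  simp only
  rw [← mul_assoc, ← Complex.ofReal_mul, inv_mul_cancel₀ this.ne', Complex.ofReal_one, one_mul]

/-- The resolvent `A = (1 - 𝓛)⁻¹` of the linear Boltzmann operator. -/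
lemma exists_resolvent : ∃ A A₀ : P.Hsp →L[ℂ] P.Hsp,
    GapData A A₀ P.equilibrium (1 + P.ν₀)⁻¹ ∧ ∀ f g, P.Graph f g ↔ A (f - g) = f := by
  obtain ⟨A, A₀, h, hA⟩ := P.balanceKernel.exists_gapData
  exact ⟨A, A₀, h, fun f g => (P.graph_iff f g).trans (hA f g).symm⟩

end Params

end GranularBoltzmann

theorem corollary3p7 (P : GranularBoltzmann.Params) :
    ∃ lam₁ : ℝ,
      -- `lam₁` is the largest point of the spectrum of `𝓛` other than `0`
      ((lam₁ : ℂ) ∈ P.spectrum ∧ lam₁ ≠ 0 ∧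
        ∀ z ∈ P.spectrum, z ≠ 0 → ∃ x : ℝ, z = (x : ℂ) ∧ x ≤ lam₁) ∧
      -- it is an eigenvalue, unless it is equal to `-ν₀`
      (lam₁ = -P.ν₀ ∨ P.IsEigenvalue (lam₁ : ℂ)) ∧
      lam₁ < 0 ∧ |lam₁| ≤ P.ν₀ ∧
      ∃ C : ℝ, 0 ≤ C ∧ ∀ f₀ : P.Hsp,
        ∃ f : ℝ → P.Hsp, P.IsSolution f₀ f ∧
          (∀ g : ℝ → P.Hsp, P.IsSolution f₀ g → Set.EqOn g f (Set.Ici 0)) ∧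
          ((∫ v, f₀ v) = 1 → ∀ t : ℝ, 0 ≤ t →
            ‖f t - P.equilibrium‖ ≤ C * Real.exp (-|lam₁| * t) * ‖f₀ - P.equilibrium‖) := by
  obtain ⟨A, A₀, hG, hA⟩ := P.exists_resolvent
  have hspec : ∀ z : ℂ, z ∈ P.spectrum ↔ z ≠ 1 ∧ (1 - z)⁻¹ ∈ spectrum ℂ A := fun z => by
    have h := GranularBoltzmann.exists_resolvent_iff A z
    simp only [← hA] at h
    rw [GranularBoltzmann.Params.spectrum, Set.mem_compl_iff]
    change ¬ (∃ R : P.Hsp →L[ℂ] P.Hsp, ∀ f h : P.Hsp, R h = f ↔ ∃ g, P.Graph f g ∧ z • f - g = h) ↔ _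
    rw [h]
    tauto
  -- the spectrum of `𝓛` is the image of the spectrum of `A` under `x ↦ 1 - x⁻¹`
  obtain ⟨x₁, hxe, hx₁, hmem, hmax, hev, hdef⟩ := hG.exists_gap
  have hν := P.ν₀_pos
  have hx0 : 0 < x₁ := hG.xe_pos.trans_le hxe
  have hinv : 1 < x₁⁻¹ := (one_lt_inv₀ hx0).2 hx₁
  have hinv' : x₁⁻¹ ≤ 1 + P.ν₀ := inv_le_of_inv_le₀ (by linarith) hxe
  have habs : |1 - x₁⁻¹| = x₁⁻¹ - 1 := by rw [abs_of_neg (by linarith)]; ring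
  have hsol : ∀ f₀ f, P.IsSolution f₀ f ↔ GranularBoltzmann.IsEvolution A f₀ f := fun f₀ f => by
    constructor
    · rintro ⟨h1, h2, h3⟩
      exact ⟨h1, h2, fun t ht => (h3 t ht).imp fun g hg => ⟨(hA _ _).1 hg.1, hg.2⟩⟩
    · rintro ⟨h1, h2, h3⟩
      exact ⟨h1, h2, fun t ht => (h3 t ht).imp fun g hg => ⟨(hA _ _).2 hg.1, hg.2⟩⟩
  refine ⟨1 - x₁⁻¹, ⟨(hspec _).2 ⟨?_, ?_⟩, by linarith, fun z hz hz0 => ?_⟩, ?_, by linarith, ?_, 1,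
    zero_le_one, fun f₀ => ?_⟩
  · have : 1 - x₁⁻¹ ≠ 1 := by linarith
    exact_mod_cast this
  · push_cast
    rwa [sub_sub_cancel, inv_inv]
  · obtain ⟨hz1, hzA⟩ := (hspec z).1 hz
    obtain ⟨x, hx, hx0', hxle⟩ := hmax _ hzA fun h => hz0 (by
      rw [inv_eq_one, sub_eq_self] at h
      exact h)
    have hxpos : 0 < x := lt_of_le_of_ne hx0' fun h => by
      rw [← h, Complex.ofReal_zero, inv_eq_zero, sub_eq_zero] at hx
      exact hz1 hx.symm
    refine ⟨1 - x⁻¹, ?_, ?_⟩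
    · push_cast
      rw [← hx, inv_inv, sub_sub_cancel]
    · have := inv_anti₀ hxpos hxle
      linarith
  · refine hev.imp (fun h => ?_) ?_
    · rw [h, inv_inv]
      ring
    · rintro ⟨f, hf0, hf⟩
      refine ⟨f, hf0, (hA _ _).2 ?_⟩
      have : (x₁ : ℂ) ≠ 0 := by exact_mod_cast hx0.ne'
      rw [map_sub, map_smul, hf, smul_smul, ← sub_smul]
      push_cast
      rw [sub_mul, inv_mul_cancel₀ this, one_mul, sub_sub_cancel, one_smul]
  · rw [habs]
    linarith
  · obtain ⟨f, hf, hdecay⟩ := hG.exists_evolution hx₁ hdef f₀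
    refine ⟨f, (hsol _ _).2 hf, fun g hg => hG.evolution_unique hf ((hsol _ _).1 hg),
      fun hint t ht => ?_⟩
    rw [habs, one_mul, show -(x₁⁻¹ - 1) * t = t * (1 - x₁⁻¹) by ring]
    exact hdecay ((P.inner_equilibrium f₀).trans hint) t ht
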